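/- Let $d\in\{1,2\}$ and let $m_1(\xi)=\xi\sqrt{\tanh\xi/\xi}$ for $\xi\in\mathbb R$, $m_2(\xi)=|\xi|\sqrt{\tanh|\xi|/|\xi|}$ for $\xi\in\mathbb R^2$ (with value $0$ at $\xi=0$). Write $S_{m_d}(\pm t)=e^{\mp itm_d(D)}$ for the unitary group on $L^2(\mathbb R^d)$ with Fourier symbol $e^{\mp itm_d(\xi)}$. Fix an even function $\chi\in C_0^\infty((-2,2))$, real-valued, with $\chi(s)=1$ for $|s|\le 1$, put $\beta(s)=\chi(s)-\chi(2s)$, and for dyadic $\lambda=2^k>1$ ($k\in\mathbb Z$) let $P_\lambda$ be the Fourier multiplier in $x$ with symbol $\beta(|\xi|/\lambda)$; write $f_\lambda=P_\lambda f$ and $u_\lambda=P_\lambda u$ for tempered distributions $f$ on $\mathbb R^d$ and $u$ on $\mathbb R\times\mathbb R^d$ (where $P_\lambda$ acts in the $x$ variable only). Let $$\|u\|_{L^q_tL^r_x}=\big\|\,\|u(t,\cdot)\|_{L^r_x(\mathbb R^d)}\big\|_{L^q_t(\mathbb R)},\qquad \|u\|_{X^{0,b}_\pm}=\big\|\langle\tau\pm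 m_d(\xi)\rangle^b\,\widetilde u(\tau,\xi)\big\|_{L^2_{\tau,\xi}},$$ where $\langle x\rangle=(1+|x|^2)^{1/2}$ and $\widetilde u(\tau,\xi)=\int_{\mathbb R^{1+d}} e^{-i(t\tau+x\cdot\xi)}u(t,x)\,dt\,dx$ is the space-time Fourier transform; the first norm is taken to be $\infty$ if $u$ is not a function, and the second if $\widetilde u$ is not a function. Assume that $2<q<\infty$ and $2\le r\le\infty$ satisfy $$\frac2q=\frac d2\Big(1-\frac2r\Big).$$ Then: (i) There is a constant $C>0$, independent of $\lambda$ and $f$, such that for both signs, all dyadic $\lambda>1$ and all tempered distributions $f$ on $\mathbb R^d$ with $f_\lambda\in L^2(\mathbb R^d)$, $$\|S_{m_d}(\pm t)f_\lambda\|_{L^q_tL^r_x}\le C\,\lambda^{\frac{3d}8(1-\frac2r)}\,\|f_\lambda\|_{L^2_x}.$$ (ii) For every $b>1/2$ there is a constant $C>0$, independent of $\lambda$ and $u$, such that for both signs, all dyadic $\lambda>1$ and all tempered distributions $u$ on $\mathbb R\times\mathbb R^d$, $$\|u_\lambda\|_{L^q_tL^r_x}\le C\,\lambda^{\frac{3d}8(1-\frac2r)}\,\|u_\lambda\|_{X^{0,b}_\pm}.$$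 -/

import Mathlib

open MeasureTheory FourierTransform SchwartzMap Real
open scoped ENNReal ContDiff

noncomputable section

namespace Whitham

/-- Physical (or frequency) space `ℝ^d` with its Euclidean norm. -/
abbrev Space (d : ℕ) : Type := EuclideanSpace ℝ (Fin d)

/-- Space-time `ℝ × ℝ^d`, with points `(t, x)` (or dual points `(τ, ξ)`), as a Euclidean space. -/
abbrev SpaceTime (d : ℕ) : Type := WithLp 2 (ℝ × Space d)

/-- The dispersion relation: `m_1(ξ) = ξ √(tanh ξ / ξ)` (odd) in dimension one, and
`m_d(ξ) = |ξ| √(tanh |ξ| / |ξ|)` otherwise; the value at `ξ = 0` is `0`. -/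
def dispersion : (d : ℕ) → Space d → ℝ
  | 1, ξ => ξ 0 * √(tanh (ξ 0) / ξ 0)
  | _, ξ => ‖ξ‖ * √(tanh ‖ξ‖ / ‖ξ‖)

theorem measurable_dispersion (d : ℕ) : Measurable (dispersion d) := by
  have htanh : Measurable Real.tanh := by
    have : Real.tanh = fun x => Real.sinh x / Real.cosh x := funext Real.tanh_eq_sinh_div_cosh
    rw [this]
    fun_prop
  match d with
  | 0 => unfold dispersion; fun_prop
  | 1 => unfold dispersion; fun_prop
  | n + 2 => unfold dispersion; fun_prop

/-- The Fourier coefficients of the free wave, in Mathlib's normalization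
`𝓕 f(ξ) = ∫ e^{-2πi x·ξ} f(x) dx`, in which `a(D)` is multiplication by `a(2πξ)`. -/
theorem memLp_freeWave (d : ℕ) (s : ℝ) (f : Lp (α := Space d) ℂ 2 volume) :
    MemLp (fun ξ : Space d =>
      Complex.exp (-Complex.I * s * dispersion d ((2 * π) • ξ)) * (𝓕 f : Lp (α := Space d) ℂ 2 volume) ξ)
      2 volume := by
  refine (Lp.memLp (𝓕 f : Lp (α := Space d) ℂ 2 volume)).of_le ?_ ?_
  · refine AEStronglyMeasurable.mul ?_ (Lp.aestronglyMeasurable _)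
    have := (measurable_dispersion d).comp (measurable_const_smul (α := Space d) (2 * π))
    refine Measurable.aestronglyMeasurable ?_
    exact Complex.measurable_exp.comp
      ((Complex.measurable_ofReal.comp this).const_mul (-Complex.I * s))
  · refine Filter.Eventually.of_forall fun ξ => ?_
    rw [norm_mul, Complex.norm_exp]
    simp

/-- The unitary group `S_{m_d}(s) = e^{-i s m_d(D)}` on `L²(ℝ^d)`. -/
def freeWave (d : ℕ) (s : ℝ) (f : Lp (α := Space d) ℂ 2 volume) : Lp (α := Space d) ℂ 2 volume :=
  𝓕⁻ ((memLp_freeWave d s f).toLp)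

/-- The cut-offs `χ` on which the Littlewood-Paley decomposition is built: `χ` is even and smooth,
its support is a compact subset of `(-2, 2)`, and `χ = 1` on `[-1, 1]`. -/
structure IsCutoff (χ : ℝ → ℝ) : Prop where
  contDiff : ContDiff ℝ ∞ χ
  even : ∀ s, χ (-s) = χ s
  hasCompactSupport : HasCompactSupport χ
  tsupport_subset : tsupport χ ⊆ Set.Ioo (-2) 2
  eq_one : ∀ s, |s| ≤ 1 → χ s = 1

/-- The radial profile of `P_L`: it is `χ(ρ)` for `L = 1`, and `β(ρ / L)`
with `β(s) = χ(s) - χ(2s)` otherwise. -/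
def lpProfile (χ : ℝ → ℝ) (L ρ : ℝ) : ℝ :=
  if L = 1 then χ ρ else χ (ρ / L) - χ (2 * (ρ / L))

/-- The frequency projection `P_L` on tempered distributions on `ℝ^d`. -/
def lpProj (d : ℕ) (χ : ℝ → ℝ) (L : ℝ) (f : 𝓢'(Space d, ℂ)) : 𝓢'(Space d, ℂ) :=
  TemperedDistribution.fourierMultiplierCLM ℂ
    (fun ξ : Space d => (lpProfile χ L ‖(2 * π) • ξ‖ : ℂ)) f

/-- The frequency projection `P_L`, acting in the space variable only, on tempered distributions
on space-time. -/
def lpProjST (d : ℕ) (χ : ℝ → ℝ) (L : ℝ) (u : 𝓢'(SpaceTime d, ℂ)) : 𝓢'(SpaceTime d, ℂ) :=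
  TemperedDistribution.fourierMultiplierCLM ℂ
    (fun p : SpaceTime d => (lpProfile χ L ‖(2 * π) • p.snd‖ : ℂ)) u

/-- The tempered distribution `T` is (integration against) the function `g`. Such a `g` is unique
up to a null set. -/
def IsRepresentedBy {V : Type*} [NormedAddCommGroup V] [NormedSpace ℝ V] [MeasureSpace V]
    (T : 𝓢'(V, ℂ)) (g : V → ℂ) : Prop :=
  AEStronglyMeasurable g volume ∧
    ∀ φ : 𝓢(V, ℂ), Integrable (fun x => φ x * g x) volume ∧ T φ = ∫ x, φ x * g x

/-- The mixed norm `‖ ‖u(t, x)‖_{L^r_x} ‖_{L^q_t}` of a function `u` of `t` and `x`. -/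
def mixedNorm (d : ℕ) (q r : ℝ≥0∞) (u : ℝ → Space d → ℂ) : ℝ≥0∞ :=
  eLpNorm (fun t : ℝ => eLpNorm (u t) r volume) q volume

/-- The `L^q_t L^r_x` norm of a tempered distribution on space-time: the mixed norm of the function
that represents it, and `∞` if it is not a function. -/
def mixedNormDist (d : ℕ) (q r : ℝ≥0∞) (u : 𝓢'(SpaceTime d, ℂ)) : ℝ≥0∞ :=
  ⨅ g : SpaceTime d → ℂ, ⨅ _ : IsRepresentedBy u g,
    mixedNorm d q r (fun t x => g (WithLp.toLp 2 (t, x)))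

/-- The Japanese bracket `⟨x⟩ = (1 + |x|²)^{1/2}`. -/
def japanese {V : Type*} [Norm V] (x : V) : ℝ := √(1 + ‖x‖ ^ 2)

/-- The Bourgain norm `‖ ⟨ξ⟩^s ⟨τ + σ m_d(ξ)⟩^b ũ(τ, ξ) ‖_{L²_{τ,ξ}}` with sign `σ`, equal to `∞` if
`ũ` is not a function. Here `ũ(τ, ξ) = ∫ e^{-i(tτ + x·ξ)} u(t, x) dt dx`, that is
`ũ(ζ) = g(ζ / 2π)`, `ζ = (τ, ξ)`, if `g` is the Fourier transform of `u` in Mathlib's normalization. -/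
def bourgainNorm (d : ℕ) (s b σ : ℝ) (u : 𝓢'(SpaceTime d, ℂ)) : ℝ≥0∞ :=
  ⨅ g : SpaceTime d → ℂ, ⨅ _ : IsRepresentedBy (𝓕 u) g,
    eLpNorm (fun ζ : SpaceTime d =>
      ((japanese ζ.snd ^ s * japanese (ζ.fst + σ * dispersion d ζ.snd) ^ b : ℝ) : ℂ) *
        g ((2 * π)⁻¹ • ζ)) 2 volume

/-- `L` is a dyadic number `2^k`, `k ∈ ℤ`. -/
def IsDyadic (L : ℝ) : Prop := ∃ k : ℤ, L = (2 : ℝ) ^ k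

end Whitham

end

/-!
# Localized Strichartz estimates for the Whitham dispersion relation

The dispersion relation is `m(ξ) = √(r tanh r)` with `r = |ξ|`, up to a sign in dimension one. Its
radial profile is increasing and concave, with `m' ~ L^{-1/2}` and `-m'' ~ L^{-3/2}` at frequencies
of size `L ≥ 2`. Both parts of the theorem come down to the decay in time of the kernel of
`e^{-itm(D)}` restricted to the shell `L / 2 ≤ |ξ| ≤ 2 L`,
`|K_t(x)| ≲ (L^{3/4} |t|^{-1/2})^d` (`norm_kernel_le`).

*Dispersive estimate.* In dimension one the decay is van der Corput's second-derivative test. In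
dimension two, in polar coordinates, that test in the radius gives half of the decay; the other half
comes from the angle. Angles within `(L |x|)^{-1/2}` of the direction of `± x` are estimated by their
measure, and away from them an integration by parts in the angle gains `1 / (|x| s)`, which also
cancels the weight `s` of the area element. If `|x|` is small compared with `|t| m'`, the phase has
no critical point and the first-derivative test suffices (`norm_integral_quarter_le`). Since these
tests do not see cut-offs, the sharp localization to the shell can be used, and the smooth cut-off
`β` only enters through its support.

*Strichartz estimate.* By Plancherel the localized group is bounded by `1` on `L²`, and
interpolation with the `L¹ → L^∞` bound (`lintegral_rpow_le_of_interpolation`) gives the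
`L^{r'} → L^r` bound with decay `L^{3/q} |t|^{-2/q}`. The admissibility of `(q, r)` makes this the
kernel of the Hardy-Littlewood-Sobolev inequality on the line (`hardy_littlewood_sobolev`), so that
the `T T*` identity bounds the adjoint `F ↦ ∫ e^{itm(D)} F(t) dt` from `L^{q'} L^{r'}` to `L²`
(`exists_lintegral_adjoint_sq_le`). The estimate for waves follows by duality, that is by the
converse of Hölder's inequality in mixed norms (`mixedNorm_le_of_isTest`). For `r = ∞` the dual
exponent is `1`, no interpolation is needed, and the supremum in `x` is recovered by averaging over
small balls around measurably chosen almost maximal points.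

*Bourgain spaces.* A function `u` with Fourier transform `g` is the superposition over `τ` of
the modulations by `e^{itτ}` of the free waves with Fourier coefficients `g(τ - σ m(ξ), ξ)`.
Minkowski's inequality, used here in its dual form `enorm_integral_mul_fourierInv_le`, reduces the
estimate to the integrability in `τ` of the `L²` norms of these coefficients, and since
`⟨τ⟩^{-b}` is square integrable for `b > 1/2`, this follows from the Cauchy-Schwarz inequality
(`lintegral_eLpNorm_shift_le`).
-/

open MeasureTheory FourierTransform SchwartzMap Real
open scoped ENNReal ContDiff

noncomputable section

namespace Whitham

/-! ### Van der Corput estimates -/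

section VanDerCorput

variable {φ φ₁ φ₂ : ℝ → ℝ} {a b : ℝ}

theorem hasDerivAt_exp_I_mul {x : ℝ} (h : HasDerivAt φ (φ₁ x) x) :
    HasDerivAt (fun x => Complex.exp (Complex.I * φ x))
      (Complex.exp (Complex.I * φ x) * (Complex.I * φ₁ x)) x :=
  (h.ofReal_comp.const_mul Complex.I).cexp

theorem norm_exp_I_mul (s : ℝ) : ‖Complex.exp (Complex.I * s)‖ = 1 := by
  rw [mul_comm]; exact Complex.norm_exp_ofReal_mul_I s

/-- Van der Corput's first-derivative test for a convex phase, by integration by parts: the total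
variation of `1 / φ'` telescopes because `φ''` has a sign. -/
theorem norm_integral_exp_le_of_abs_deriv_ge {μ : ℝ} (hab : a ≤ b) (hμ : 0 < μ)
    (h₁ : ∀ x ∈ Set.Icc a b, HasDerivAt φ (φ₁ x) x)
    (h₂ : ∀ x ∈ Set.Icc a b, HasDerivAt φ₁ (φ₂ x) x)
    (hc : ContinuousOn φ₂ (Set.Icc a b)) (hconv : ∀ x ∈ Set.Icc a b, 0 ≤ φ₂ x)
    (hlow : ∀ x ∈ Set.Icc a b, μ ≤ |φ₁ x|) :
    ‖∫ x in a..b, Complex.exp (Complex.I * φ x)‖ ≤ 4 / μ := by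
  have hne : ∀ x ∈ Set.Icc a b, φ₁ x ≠ 0 := fun x hx h0 => by
    have := hlow x hx
    rw [h0, abs_zero] at this
    linarith
  have hinv : ∀ x ∈ Set.Icc a b, |(φ₁ x)⁻¹| ≤ 1 / μ := fun x hx => by
    rw [abs_inv, ← one_div]
    exact one_div_le_one_div_of_le hμ (hlow x hx)
  have hu : ∀ x ∈ Set.Icc a b, HasDerivAt (fun x => (φ₁ x)⁻¹) (-φ₂ x / φ₁ x ^ 2) x :=
    fun x hx => (h₂ x hx).fun_inv (hne x hx)
  have hφ₁c : ContinuousOn φ₁ (Set.Icc a b) := fun x hx => (h₂ x hx).continuousAt.continuousWithinAt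
  have hu'c : ContinuousOn (fun x => -φ₂ x / φ₁ x ^ 2) (Set.Icc a b) :=
    hc.neg.div (hφ₁c.pow 2) fun x hx => pow_ne_zero 2 (hne x hx)
  have hec : ContinuousOn (fun x => Complex.exp (Complex.I * φ x)) (Set.Icc a b) := fun x hx =>
    (hasDerivAt_exp_I_mul (h₁ x hx)).continuousAt.continuousWithinAt
  have huIcc : Set.uIcc a b = Set.Icc a b := Set.uIcc_of_le hab
  have hparts := intervalIntegral.integral_mul_deriv_eq_deriv_mul
    (u := fun x => (((φ₁ x)⁻¹ : ℝ) : ℂ)) (v := fun x => -Complex.I * Complex.exp (Complex.I * φ x))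
    (u' := fun x => ((-φ₂ x / φ₁ x ^ 2 : ℝ) : ℂ))
    (v' := fun x => -Complex.I * (Complex.exp (Complex.I * φ x) * (Complex.I * φ₁ x)))
    (a := a) (b := b)
    (fun x hx => (hu x (huIcc ▸ hx)).ofReal_comp)
    (fun x hx => (hasDerivAt_exp_I_mul (h₁ x (huIcc ▸ hx))).const_mul _)
    (by
      apply ContinuousOn.intervalIntegrable
      rw [huIcc]
      exact Complex.continuous_ofReal.comp_continuousOn hu'c)
    (by
      apply ContinuousOn.intervalIntegrable
      rw [huIcc]
      exact (hec.mul (continuousOn_const.mul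
        (Complex.continuous_ofReal.comp_continuousOn hφ₁c))).const_smul (-Complex.I))
  have hlhs : ∫ x in a..b, Complex.exp (Complex.I * φ x) =
      ∫ x in a..b, (((φ₁ x)⁻¹ : ℝ) : ℂ) *
        (-Complex.I * (Complex.exp (Complex.I * φ x) * (Complex.I * φ₁ x))) := by
    apply intervalIntegral.integral_congr
    intro x hx
    have : (φ₁ x : ℂ) ≠ 0 := by exact_mod_cast hne x (huIcc ▸ hx)
    simp only [Complex.ofReal_inv]
    field_simp
    rw [Complex.I_sq]
    ring
  have hvar : ‖∫ x in a..b, ((-φ₂ x / φ₁ x ^ 2 : ℝ) : ℂ) *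
      (-Complex.I * Complex.exp (Complex.I * φ x))‖ ≤ 2 / μ := by
    have hint : IntervalIntegrable (fun x => -φ₂ x / φ₁ x ^ 2) volume a b := by
      apply ContinuousOn.intervalIntegrable
      rwa [huIcc]
    have hftc : ∫ x in a..b, -φ₂ x / φ₁ x ^ 2 = (φ₁ b)⁻¹ - (φ₁ a)⁻¹ :=
      intervalIntegral.integral_eq_sub_of_hasDerivAt (fun x hx => hu x (huIcc ▸ hx)) hint
    calc _ ≤ ∫ x in a..b, -(-φ₂ x / φ₁ x ^ 2) := by
          apply intervalIntegral.norm_integral_le_of_norm_le hab _ hint.neg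
          refine Filter.Eventually.of_forall fun x hx => ?_
          have hx' : x ∈ Set.Icc a b := Set.Ioc_subset_Icc_self hx
          rw [norm_mul, norm_mul, norm_exp_I_mul, norm_neg, Complex.norm_I, Complex.norm_real,
            Real.norm_eq_abs, mul_one, mul_one, Pi.neg_apply, neg_div, abs_neg, neg_neg,
            abs_of_nonneg (div_nonneg (hconv x hx') (sq_nonneg _))]
      _ = (φ₁ a)⁻¹ - (φ₁ b)⁻¹ := by rw [intervalIntegral.integral_neg, hftc]; ring
      _ ≤ 2 / μ := by
          have h1 := (abs_le.1 (hinv a (Set.left_mem_Icc.2 hab))).2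
          have h2 := (abs_le.1 (hinv b (Set.right_mem_Icc.2 hab))).1
          have : 2 / μ = 1 / μ + 1 / μ := by ring
          linarith
  have hbd : ∀ x ∈ Set.Icc a b,
      ‖(((φ₁ x)⁻¹ : ℝ) : ℂ) * (-Complex.I * Complex.exp (Complex.I * φ x))‖ ≤ 1 / μ := by
    intro x hx
    rw [norm_mul, norm_mul, norm_exp_I_mul, norm_neg, Complex.norm_I, Complex.norm_real,
      Real.norm_eq_abs, mul_one, mul_one]
    exact hinv x hx
  rw [hlhs, hparts]
  calc _ ≤ 1 / μ + 1 / μ + 2 / μ :=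
        (norm_sub_le _ _).trans (add_le_add ((norm_sub_le _ _).trans (add_le_add
          (hbd b (Set.right_mem_Icc.2 hab)) (hbd a (Set.left_mem_Icc.2 hab)))) hvar)
    _ = 4 / μ := by ring

theorem intervalIntegrable_exp_phase (hab : a ≤ b)
    (h₁ : ∀ x ∈ Set.Icc a b, HasDerivAt φ (φ₁ x) x) :
    IntervalIntegrable (fun x => Complex.exp (Complex.I * φ x)) volume a b := by
  apply ContinuousOn.intervalIntegrable
  rw [Set.uIcc_of_le hab]
  exact fun x hx => (hasDerivAt_exp_I_mul (h₁ x hx)).continuousAt.continuousWithinAt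

/-- Van der Corput's second-derivative test: the interval of length `2 / √κ` around the critical
point is estimated trivially, and `|φ'| ≥ √κ` off it. -/
theorem norm_integral_exp_le_of_deriv_deriv_ge {κ : ℝ} (hab : a ≤ b) (hκ : 0 < κ)
    (h₁ : ∀ x ∈ Set.Icc a b, HasDerivAt φ (φ₁ x) x)
    (h₂ : ∀ x ∈ Set.Icc a b, HasDerivAt φ₁ (φ₂ x) x)
    (hc : ContinuousOn φ₂ (Set.Icc a b)) (hconv : ∀ x ∈ Set.Icc a b, κ ≤ φ₂ x) :
    ‖∫ x in a..b, Complex.exp (Complex.I * φ x)‖ ≤ 10 / √κ := by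
  have hsκ : 0 < √κ := Real.sqrt_pos.2 hκ
  have hφ₁c : ContinuousOn φ₁ (Set.Icc a b) := fun x hx => (h₂ x hx).continuousAt.continuousWithinAt
  have hgrow : ∀ x ∈ Set.Icc a b, ∀ y ∈ Set.Icc a b, x ≤ y → κ * (y - x) ≤ φ₁ y - φ₁ x := by
    intro x hx y hy hxy
    refine (convex_Icc a b).mul_sub_le_image_sub_of_le_deriv hφ₁c
      (fun z hz => (h₂ z (interior_subset hz)).differentiableAt.differentiableWithinAt)
      (fun z hz => ?_) x hx y hy hxy
    rw [(h₂ z (interior_subset hz)).deriv]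
    exact hconv z (interior_subset hz)
  have ha := Set.left_mem_Icc.2 hab
  have hb := Set.right_mem_Icc.2 hab
  obtain ⟨c, hcab, hlow⟩ : ∃ c ∈ Set.Icc a b, ∀ x ∈ Set.Icc a b, κ * |x - c| ≤ |φ₁ x| := by
    by_cases h0a : 0 ≤ φ₁ a
    · refine ⟨a, ha, fun x hx => ?_⟩
      have := hgrow a ha x hx hx.1
      rw [abs_of_nonneg (sub_nonneg.2 hx.1)]
      exact le_trans (by linarith) (le_abs_self _)
    by_cases h0b : φ₁ b ≤ 0
    · refine ⟨b, hb, fun x hx => ?_⟩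
      have := hgrow x hx b hb hx.2
      rw [abs_of_nonpos (sub_nonpos.2 hx.2)]
      exact le_trans (by linarith) (neg_le_abs _)
    · obtain ⟨c, hc, hc0⟩ := intermediate_value_Icc hab hφ₁c
        (show (0 : ℝ) ∈ Set.Icc (φ₁ a) (φ₁ b) from ⟨by linarith, by linarith⟩)
      refine ⟨c, hc, fun x hx => ?_⟩
      rcases le_total c x with h | h
      · have := hgrow c hc x hx h
        rw [abs_of_nonneg (sub_nonneg.2 h)]
        exact le_trans (by linarith) (le_abs_self _)
      · have := hgrow x hx c hc h
        rw [abs_of_nonpos (sub_nonpos.2 h)]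
        exact le_trans (by linarith) (neg_le_abs _)
  set δ : ℝ := 1 / √κ with hδ
  have hδ0 : 0 < δ := by positivity
  have hκδ : κ * δ = √κ := by
    rw [hδ, mul_one_div]
    exact Real.div_sqrt
  have hmid : ∀ x y, a ≤ x → x ≤ y → y ≤ b → IntervalIntegrable
      (fun x => Complex.exp (Complex.I * φ x)) volume x y := fun x y hax hxy hyb =>
    intervalIntegrable_exp_phase hxy fun z hz => h₁ z ⟨hax.trans hz.1, hz.2.trans hyb⟩
  have hoff : ∀ x y, a ≤ x → x ≤ y → y ≤ b → (∀ z ∈ Set.Icc x y, δ ≤ |z - c|) →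
      ‖∫ x in x..y, Complex.exp (Complex.I * φ x)‖ ≤ 4 / √κ := fun x y hax hxy hyb hz => by
    have hsub : Set.Icc x y ⊆ Set.Icc a b := Set.Icc_subset_Icc hax hyb
    refine norm_integral_exp_le_of_abs_deriv_ge hxy hsκ (fun z hz => h₁ z (hsub hz))
      (fun z hz => h₂ z (hsub hz)) (hc.mono hsub) (fun z hz => hκ.le.trans (hconv z (hsub hz)))
      fun z hz' => ?_
    rw [← hκδ]
    exact (mul_le_mul_of_nonneg_left (hz z hz') hκ.le).trans (hlow z (hsub hz'))
  have h4 : (0 : ℝ) ≤ 4 / √κ := by positivity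
  have hc1 : a ≤ max a (c - δ) := le_max_left _ _
  have hc12 : max a (c - δ) ≤ min b (c + δ) :=
    max_le (le_min hab (by linarith [hcab.1])) (le_min (by linarith [hcab.2]) (by linarith))
  have hc2 : min b (c + δ) ≤ b := min_le_left _ _
  have hleft : ‖∫ x in a..max a (c - δ), Complex.exp (Complex.I * φ x)‖ ≤ 4 / √κ := by
    rcases le_total (c - δ) a with h | h
    · rw [max_eq_left h]; simpa using h4
    · rw [max_eq_right h]
      refine hoff _ _ le_rfl h (by linarith [hcab.2]) fun z hz => ?_
      exact le_trans (by linarith [hz.2]) (neg_le_abs _)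
  have hright : ‖∫ x in min b (c + δ)..b, Complex.exp (Complex.I * φ x)‖ ≤ 4 / √κ := by
    rcases le_total b (c + δ) with h | h
    · rw [min_eq_left h]; simpa using h4
    · rw [min_eq_right h]
      refine hoff _ _ (by linarith [hcab.1]) h le_rfl fun z hz => ?_
      exact le_trans (by linarith [hz.1]) (le_abs_self _)
  have hcenter : ‖∫ x in max a (c - δ)..min b (c + δ), Complex.exp (Complex.I * φ x)‖ ≤ 2 / √κ := by
    refine (intervalIntegral.norm_integral_le_of_norm_le_const (C := 1)
      fun x _ => (norm_exp_I_mul _).le).trans ?_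
    rw [one_mul, abs_of_nonneg (sub_nonneg.2 hc12)]
    have h2 : 2 / √κ = 2 * δ := by rw [hδ]; ring
    linarith [le_max_right a (c - δ), min_le_right b (c + δ)]
  rw [← intervalIntegral.integral_add_adjacent_intervals (hmid a _ le_rfl hc1 (hc12.trans hc2))
      (hmid _ b hc1 (hc12.trans hc2) le_rfl),
    ← intervalIntegral.integral_add_adjacent_intervals (hmid _ _ hc1 hc12 hc2)
      (hmid _ b (hc1.trans hc12) hc2 le_rfl)]
  calc _ ≤ 4 / √κ + (2 / √κ + 4 / √κ) := (norm_add_le _ _).trans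
        (add_le_add hleft ((norm_add_le _ _).trans (add_le_add hcenter hright)))
    _ = 10 / √κ := by ring

/-- A linear amplitude is inserted by an integration by parts. -/
theorem norm_integral_mul_id_le {e : ℝ → ℂ} {B : ℝ} (ha : 0 ≤ a) (hab : a ≤ b)
    (hec : ContinuousOn e (Set.Icc a b))
    (hB : ∀ x ∈ Set.Icc a b, ‖∫ y in a..x, e y‖ ≤ B) :
    ‖∫ x in a..b, (x : ℂ) * e x‖ ≤ 2 * b * B := by
  have huIcc : Set.uIcc a b = Set.Icc a b := Set.uIcc_of_le hab
  have hei : IntervalIntegrable e volume a b := by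
    apply ContinuousOn.intervalIntegrable
    rwa [huIcc]
  have hB0 : 0 ≤ B := (norm_nonneg _).trans (hB a (Set.left_mem_Icc.2 hab))
  have hE : ContinuousOn (fun x => ∫ y in a..x, e y) (Set.uIcc a b) :=
    intervalIntegral.continuousOn_primitive_interval
      (by rw [huIcc]; exact hec.integrableOn_Icc)
  have hE' : ∀ x ∈ Set.Ioo (min a b) (max a b), HasDerivAt (fun x => ∫ y in a..x, e y) (e x) x := by
    intro x hx
    rw [min_eq_left hab, max_eq_right hab] at hx
    have hxI : x ∈ Set.Icc a b := Set.Ioo_subset_Icc_self hx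
    have hn : Set.Icc a b ∈ nhds x := Icc_mem_nhds hx.1 hx.2
    refine intervalIntegral.integral_hasDerivAt_right ?_ ?_ (hec.continuousAt hn)
    · apply ContinuousOn.intervalIntegrable
      rw [Set.uIcc_of_le hxI.1]
      exact hec.mono (Set.Icc_subset_Icc_right hxI.2)
    · exact (hec.mono Set.Ioo_subset_Icc_self).stronglyMeasurableAtFilter isOpen_Ioo x hx
  rw [intervalIntegral.integral_mul_deriv_eq_deriv_mul_of_hasDerivAt
    (u := fun x : ℝ => (x : ℂ)) (u' := fun _ => 1) (v := fun x => ∫ y in a..x, e y)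
    Complex.continuous_ofReal.continuousOn hE
    (fun x _ => by simpa using (hasDerivAt_id x).ofReal_comp) hE'
    (by simp) hei]
  have h1 : ‖(b : ℂ) * ∫ y in a..b, e y‖ ≤ b * B := by
    rw [norm_mul, Complex.norm_real, Real.norm_eq_abs, abs_of_nonneg (ha.trans hab)]
    exact mul_le_mul_of_nonneg_left (hB b (Set.right_mem_Icc.2 hab)) (ha.trans hab)
  have h2 : ‖∫ x in a..b, (1 : ℂ) * ∫ y in a..x, e y‖ ≤ B * |b - a| :=
    intervalIntegral.norm_integral_le_of_norm_le_const fun x hx => by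
      rw [one_mul]
      rw [Set.uIoc_of_le hab] at hx
      exact hB x (Set.Ioc_subset_Icc_self hx)
  rw [abs_of_nonneg (sub_nonneg.2 hab)] at h2
  simp only [intervalIntegral.integral_same, mul_zero, sub_zero]
  refine (norm_sub_le _ _).trans ((add_le_add h1 h2).trans ?_)
  nlinarith

end VanDerCorput

/-! ### The dispersion relation -/

/-- The radial profile `√(r tanh r)` of the dispersion relation. -/
def profile (r : ℝ) : ℝ := √(r * tanh r)

/-- The derivative of `profile` on the positive half-line. -/
def profileDeriv (r : ℝ) : ℝ := (tanh r + r * (1 - tanh r ^ 2)) / (2 * √(r * tanh r))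

/-- The second derivative of `profile` on the positive half-line. With `T = tanh r` and
`S = 1 - T²`, its numerator is `2 g g'' - g'²` for `g = r T`, which is minus a sum of squares. -/
def profileDeriv₂ (r : ℝ) : ℝ :=
  -((tanh r - r * (1 - tanh r ^ 2)) ^ 2 + 4 * r ^ 2 * tanh r ^ 2 * (1 - tanh r ^ 2)) /
    (4 * (r * tanh r) * √(r * tanh r))

theorem hasDerivAt_tanh (r : ℝ) : HasDerivAt tanh (1 - tanh r ^ 2) r := by
  have h := (Real.hasDerivAt_sinh r).fun_div (Real.hasDerivAt_cosh r) (Real.cosh_pos r).ne'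
  have hf : (fun x => Real.sinh x / Real.cosh x) = tanh := by
    ext x; exact (Real.tanh_eq_sinh_div_cosh x).symm
  rw [hf] at h
  refine h.congr_deriv ?_
  have := (Real.cosh_pos r).ne'
  rw [Real.tanh_eq_sinh_div_cosh]
  field_simp

theorem tanh_pos_of_pos {r : ℝ} (hr : 0 < r) : 0 < tanh r := by
  rw [Real.tanh_eq_sinh_div_cosh]
  exact div_pos (Real.sinh_pos_iff.2 hr) (Real.cosh_pos r)

theorem tanh_sq_lt_one' (r : ℝ) : tanh r ^ 2 < 1 := by
  rw [Real.tanh_eq_sinh_div_cosh, div_pow, div_lt_one (by positivity), Real.cosh_sq]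
  linarith

theorem tanh_lt_one' (r : ℝ) : tanh r < 1 := by
  nlinarith [tanh_sq_lt_one' r]

theorem continuous_tanh' : Continuous tanh :=
  continuous_iff_continuousAt.2 fun r => (hasDerivAt_tanh r).continuousAt

theorem hasDerivAt_profile {r : ℝ} (hr : 0 < r) : HasDerivAt profile (profileDeriv r) r := by
  have hT := tanh_pos_of_pos hr
  have h := ((hasDerivAt_id r).mul (hasDerivAt_tanh r)).sqrt (mul_pos hr hT).ne'
  refine h.congr_deriv ?_
  simp [profileDeriv]

theorem hasDerivAt_profileDeriv {r : ℝ} (hr : 0 < r) :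
    HasDerivAt profileDeriv (profileDeriv₂ r) r := by
  have hT := tanh_pos_of_pos hr
  have hg : 0 < r * tanh r := mul_pos hr hT
  have hT' := hasDerivAt_tanh r
  have hnum : HasDerivAt (fun r => tanh r + r * (1 - tanh r ^ 2))
      (2 * (1 - tanh r ^ 2) - 2 * r * tanh r * (1 - tanh r ^ 2)) r := by
    refine (hT'.add ((hasDerivAt_id r).mul ((hT'.pow 2).const_sub 1))).congr_deriv ?_
    simp
    ring
  have h := hnum.fun_div ((hasDerivAt_profile hr).const_mul 2)
    (mul_pos two_pos (Real.sqrt_pos.2 hg)).ne'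
  refine h.congr_deriv ?_
  have hs : 0 < √(r * tanh r) := Real.sqrt_pos.2 hg
  have hsq : √(r * tanh r) ^ 2 = r * tanh r := Real.sq_sqrt hg.le
  rw [profileDeriv₂, profileDeriv, profile]
  set s := √(r * tanh r)
  set T := tanh r
  rw [← hsq]
  field_simp
  rw [hsq]
  ring

theorem continuousOn_profileDeriv₂ {a b : ℝ} (ha : 0 < a) :
    ContinuousOn profileDeriv₂ (Set.Icc a b) := by
  have hT := continuous_tanh'
  have hs : Continuous fun r => √(r * tanh r) := (continuous_id.mul hT).sqrt
  refine ContinuousOn.div (by fun_prop) (by fun_prop) fun r hr => ?_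
  have hr0 : 0 < r := ha.trans_le hr.1
  have hg : 0 < r * tanh r := mul_pos hr0 (tanh_pos_of_pos hr0)
  have := Real.sqrt_pos.2 hg
  positivity

theorem tanh_sq_ge {r : ℝ} (hr : 1 ≤ r) : 24 / 49 ≤ tanh r ^ 2 ∧ 7 / 5 ≤ Real.cosh r := by
  have hc : 7 / 5 ≤ Real.cosh r := by
    have h1 := Real.cosh_sq r
    have h2 : r ≤ Real.sinh r := Real.self_le_sinh_iff.2 (by linarith)
    nlinarith [Real.cosh_pos r]
  refine ⟨?_, hc⟩
  rw [Real.tanh_eq_sinh_div_cosh, div_pow, Real.sinh_sq, le_div_iff₀ (by positivity)]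
  nlinarith

theorem profileDeriv_ge {r : ℝ} (hr : 1 ≤ r) : 1 / (3 * √r) ≤ profileDeriv r := by
  have hr0 : 0 < r := by linarith
  have hT := tanh_pos_of_pos hr0
  have hT1 := tanh_lt_one' r
  have hT2 := tanh_sq_lt_one' r
  have hT23 : 2 / 3 ≤ tanh r := by nlinarith [(tanh_sq_ge hr).1]
  have hsr : 0 < √r := Real.sqrt_pos.2 hr0
  have hsg : √(r * tanh r) ≤ √r := Real.sqrt_le_sqrt (by nlinarith)
  have hsg0 : 0 < √(r * tanh r) := Real.sqrt_pos.2 (mul_pos hr0 hT)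
  rw [profileDeriv, div_le_div_iff₀ (by positivity) (by positivity)]
  have h1 : 2 / 3 ≤ tanh r + r * (1 - tanh r ^ 2) := by nlinarith
  calc 1 * (2 * √(r * tanh r)) ≤ 2 / 3 * (3 * √r) := by linarith
    _ ≤ _ := mul_le_mul_of_nonneg_right h1 (by positivity)

theorem profileDeriv₂_le {r : ℝ} (hr : 1 ≤ r) : profileDeriv₂ r ≤ -(1 / (120 * (r * √r))) := by
  have hr0 : 0 < r := by linarith
  have hT := tanh_pos_of_pos hr0
  have hT1 := tanh_lt_one' r
  have hT2 := tanh_sq_lt_one' r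
  obtain ⟨hT59, hc⟩ := tanh_sq_ge hr
  have hc0 := Real.cosh_pos r
  -- `r (1 - T²) = r / cosh² r ≤ sinh r / cosh² r = T / cosh r`
  have hS : r * (1 - tanh r ^ 2) ≤ 5 / 7 * tanh r := by
    have h1 : r * (1 - tanh r ^ 2) = r / Real.cosh r ^ 2 := by
      rw [Real.tanh_eq_sinh_div_cosh, div_pow, Real.sinh_sq]
      field_simp
      ring
    rw [h1, Real.tanh_eq_sinh_div_cosh, div_le_iff₀ (by positivity)]
    have h2 : r ≤ Real.sinh r := Real.self_le_sinh_iff.2 hr0.le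
    calc r ≤ Real.sinh r := h2
      _ ≤ 5 / 7 * Real.cosh r * Real.sinh r := by nlinarith [Real.sinh_pos_iff.2 hr0]
      _ = _ := by field_simp
  have hnum : 1 / 30 ≤ (tanh r - r * (1 - tanh r ^ 2)) ^ 2 +
      4 * r ^ 2 * tanh r ^ 2 * (1 - tanh r ^ 2) := by
    have h1 : (2 / 7 * tanh r) ^ 2 ≤ (tanh r - r * (1 - tanh r ^ 2)) ^ 2 :=
      pow_le_pow_left₀ (by positivity) (by linarith) 2
    have h2 : 0 ≤ 4 * r ^ 2 * tanh r ^ 2 * (1 - tanh r ^ 2) :=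
      mul_nonneg (by positivity) (by linarith)
    nlinarith
  have hsr : 0 < √r := Real.sqrt_pos.2 hr0
  have hsg : √(r * tanh r) ≤ √r := Real.sqrt_le_sqrt (by nlinarith)
  have hsg0 : 0 < √(r * tanh r) := Real.sqrt_pos.2 (mul_pos hr0 hT)
  rw [profileDeriv₂, neg_div, neg_le_neg_iff, div_le_div_iff₀ (by positivity) (by positivity)]
  have h3 : r * tanh r * √(r * tanh r) ≤ r * √r :=
    mul_le_mul (by nlinarith) hsg hsg0.le hr0.le
  calc 1 * (4 * (r * tanh r) * √(r * tanh r)) ≤ 1 / 30 * (120 * (r * √r)) := by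
        have : 0 < r * √r := by positivity
        linarith
    _ ≤ _ := mul_le_mul_of_nonneg_right hnum (by positivity)

theorem mul_sqrt_tanh_div {r : ℝ} (hr : 0 ≤ r) : r * √(tanh r / r) = profile r := by
  rcases hr.eq_or_lt with rfl | h
  · simp [profile]
  · rw [profile, ← Real.sqrt_sq h.le, ← Real.sqrt_mul (sq_nonneg r), Real.sqrt_sq h.le]
    congr 1
    field_simp

theorem dispersion_one (ξ : Space 1) : dispersion 1 ξ = ξ 0 * √(tanh (ξ 0) / ξ 0) := rfl

theorem dispersion_two (ξ : Space 2) : dispersion 2 ξ = profile ‖ξ‖ :=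
  mul_sqrt_tanh_div (norm_nonneg ξ)

/-! ### One-dimensional oscillatory integrals with the dispersive phase -/

theorem continuous_profile : Continuous profile :=
  (continuous_id.mul continuous_tanh').sqrt

theorem hasDerivAt_phase (c t : ℝ) {s : ℝ} (hs : 0 < s) :
    HasDerivAt (fun s => c * s - t * profile s) (c - t * profileDeriv s) s := by
  refine (((hasDerivAt_id s).const_mul c).sub ((hasDerivAt_profile hs).const_mul t)).congr_deriv ?_
  rw [mul_one]

theorem hasDerivAt_phaseDeriv (c t : ℝ) {s : ℝ} (hs : 0 < s) :
    HasDerivAt (fun s => c - t * profileDeriv s) (-(t * profileDeriv₂ s)) s := by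
  simpa using ((hasDerivAt_profileDeriv hs).const_mul t).const_sub c

theorem continuous_exp_phase (c t : ℝ) :
    Continuous fun s : ℝ => Complex.exp (Complex.I * (c * s - t * profile s : ℝ)) := by
  have := continuous_profile
  fun_prop

theorem norm_integral_exp_phase_le {a b L t : ℝ} (c : ℝ) (ht : 0 < t) (ha : 1 ≤ a) (hab : a ≤ b)
    (hb : b ≤ 2 * L) :
    ‖∫ s in a..b, Complex.exp (Complex.I * (c * s - t * profile s : ℝ))‖ ≤
      200 * √(L * √L / t) := by
  have hL : 0 < L := by linarith
  have hsL : 0 < √L := Real.sqrt_pos.2 hL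
  set κ : ℝ := t / (400 * (L * √L)) with hκ
  have hκ0 : 0 < κ := by positivity
  refine (norm_integral_exp_le_of_deriv_deriv_ge hab hκ0
    (fun s hs => hasDerivAt_phase c t (by linarith [hs.1]))
    (fun s hs => hasDerivAt_phaseDeriv c t (by linarith [hs.1]))
    ((continuousOn_profileDeriv₂ (by linarith)).const_smul t).neg fun s hs => ?_).trans ?_
  · have h1s : 1 ≤ s := ha.trans hs.1
    have hs0 : 0 < s := by linarith
    have h := profileDeriv₂_le h1s
    have hss : 0 < √s := Real.sqrt_pos.2 hs0
    have hsb : √s ≤ 3 / 2 * √L := by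
      rw [show (3 / 2 : ℝ) = √((3 / 2) ^ 2) by rw [Real.sqrt_sq (by norm_num)],
        ← Real.sqrt_mul (by positivity)]
      exact Real.sqrt_le_sqrt (by nlinarith [hs.2])
    have h3 : 120 * (s * √s) ≤ 400 * (L * √L) := by
      have : s * √s ≤ 2 * L * (3 / 2 * √L) :=
        mul_le_mul (hs.2.trans hb) hsb hss.le (by positivity)
      nlinarith [mul_pos hL hsL]
    have h4 : 1 / (400 * (L * √L)) ≤ 1 / (120 * (s * √s)) :=
      one_div_le_one_div_of_le (by positivity) h3
    rw [hκ, div_eq_mul_one_div]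
    nlinarith
  · have h1 : L * √L / t = (400 * κ)⁻¹ := by
      rw [hκ]
      field_simp
    have hs : √((400 : ℝ)) = 20 := by
      rw [show (400 : ℝ) = 20 ^ 2 by norm_num, Real.sqrt_sq (by norm_num)]
    rw [h1, Real.sqrt_inv, Real.sqrt_mul (by norm_num), hs]
    have : 0 < √κ := Real.sqrt_pos.2 hκ0
    apply le_of_eq
    field_simp
    norm_num

/-- If the frequency `c` is too small to balance `t m'(s)`, the phase has no critical point. -/
theorem norm_integral_exp_phase_le_of_nonstationary {a b c L t : ℝ} (ht : 0 < t) (ha : 1 ≤ a)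
    (hab : a ≤ b) (hb : b ≤ 2 * L) (hc : |c| ≤ t / (8 * √L)) :
    ‖∫ s in a..b, Complex.exp (Complex.I * (c * s - t * profile s : ℝ))‖ ≤ 50 * √L / t := by
  have hL : 0 < L := by linarith
  have hsL : 0 < √L := Real.sqrt_pos.2 hL
  refine (norm_integral_exp_le_of_abs_deriv_ge (μ := t / (12 * √L)) hab (by positivity)
    (fun s hs => hasDerivAt_phase c t (by linarith [hs.1]))
    (fun s hs => hasDerivAt_phaseDeriv c t (by linarith [hs.1]))
    ((continuousOn_profileDeriv₂ (by linarith)).const_smul t).neg (fun s hs => ?_)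
    fun s hs => ?_).trans ?_
  · have h1s : 1 ≤ s := ha.trans hs.1
    have hs0 : 0 < s := by linarith
    have h := profileDeriv₂_le h1s
    have : 0 < 1 / (120 * (s * √s)) := by
      have hss : 0 < √s := Real.sqrt_pos.2 hs0
      positivity
    nlinarith
  · have h1s : 1 ≤ s := ha.trans hs.1
    have hs0 : 0 < s := by linarith
    have hss : 0 < √s := Real.sqrt_pos.2 hs0
    have hsb : √s ≤ 3 / 2 * √L := by
      rw [show (3 / 2 : ℝ) = √((3 / 2) ^ 2) by rw [Real.sqrt_sq (by norm_num)],
        ← Real.sqrt_mul (by positivity)]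
      exact Real.sqrt_le_sqrt (by nlinarith [hs.2])
    have h1 : 1 / (3 * (3 / 2 * √L)) ≤ profileDeriv s :=
      (one_div_le_one_div_of_le (by positivity) (by linarith)).trans (profileDeriv_ge h1s)
    have h2 : t * (1 / (3 * (3 / 2 * √L))) ≤ t * profileDeriv s :=
      mul_le_mul_of_nonneg_left h1 ht.le
    have h3 : t * (1 / (3 * (3 / 2 * √L))) = 2 / 9 * (t / √L) := by
      field_simp
      norm_num
    have h4 : t / (8 * √L) = 1 / 8 * (t / √L) := by field_simp
    have h5 : t / (12 * √L) = 1 / 12 * (t / √L) := by field_simp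
    have h6 : 0 < t / √L := by positivity
    rw [h4] at hc
    refine le_trans ?_ (neg_le_abs _)
    have := le_abs_self c
    linarith
  · rw [div_div_eq_mul_div, div_le_div_iff_of_pos_right ht]
    linarith

theorem norm_integral_mul_exp_phase_le {L t B c : ℝ} (hL : 2 ≤ L)
    (hB : ∀ b ∈ Set.Icc (L / 2) (2 * L),
      ‖∫ s in (L / 2)..b, Complex.exp (Complex.I * (c * s - t * profile s : ℝ))‖ ≤ B) :
    ‖∫ s in (L / 2)..(2 * L), (s : ℂ) * Complex.exp (Complex.I * (c * s - t * profile s : ℝ))‖ ≤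
      4 * L * B := by
  refine (norm_integral_mul_id_le (by linarith) (by linarith)
    (continuous_exp_phase c t).continuousOn hB).trans (le_of_eq ?_)
  ring

/-! ### The radial oscillatory integral in dimension two -/

/-- Integration by parts in the angle, away from the critical point `θ = 0` of `cos`. The boundary
terms and the new integrand carry the factor `1 / y`. -/
theorem integral_exp_cos_eq {y δ : ℝ} (hy : y ≠ 0) (hδ : 0 < δ) (hδ' : δ ≤ π / 2) :
    ∫ θ in δ..(π / 2), Complex.exp (Complex.I * (y * cos θ : ℝ)) =
      Complex.I / y * (1 - (sin δ : ℂ)⁻¹ * Complex.exp (Complex.I * (y * cos δ : ℝ)) +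
        ∫ θ in δ..(π / 2), ((cos θ / sin θ ^ 2 : ℝ) : ℂ) *
          Complex.exp (Complex.I * (y * cos θ : ℝ))) := by
  have huIcc : Set.uIcc δ (π / 2) = Set.Icc δ (π / 2) := Set.uIcc_of_le hδ'
  have hsin : ∀ θ ∈ Set.Icc δ (π / 2), sin θ ≠ 0 := fun θ hθ =>
    (Real.sin_pos_of_pos_of_lt_pi (hδ.trans_le hθ.1) (by linarith [hθ.2, Real.pi_pos])).ne'
  have hyC : (y : ℂ) ≠ 0 := by exact_mod_cast hy
  have hu : ∀ θ ∈ Set.Icc δ (π / 2),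
      HasDerivAt (fun θ => (((sin θ)⁻¹ : ℝ) : ℂ)) ((-cos θ / sin θ ^ 2 : ℝ) : ℂ) θ := by
    intro θ hθ
    have h : HasDerivAt (fun θ => (sin θ)⁻¹) (-cos θ / sin θ ^ 2) θ :=
      (Real.hasDerivAt_sin θ).fun_inv (hsin θ hθ)
    exact h.ofReal_comp
  have hv : ∀ θ, HasDerivAt (fun θ => Complex.I / y * Complex.exp (Complex.I * (y * cos θ : ℝ)))
      (Complex.I / y *
      (Complex.exp (Complex.I * (y * cos θ : ℝ)) * (Complex.I * (y * -sin θ : ℝ)))) θ := by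
    intro θ
    have h : HasDerivAt (fun θ => y * cos θ) (y * -sin θ) θ := (Real.hasDerivAt_cos θ).const_mul y
    exact (hasDerivAt_exp_I_mul (φ₁ := fun θ => y * -sin θ) h).const_mul (Complex.I / y)
  have hparts := intervalIntegral.integral_mul_deriv_eq_deriv_mul
    (u := fun θ => (((sin θ)⁻¹ : ℝ) : ℂ))
    (v := fun θ => Complex.I / y * Complex.exp (Complex.I * (y * cos θ : ℝ)))
    (u' := fun θ => ((-cos θ / sin θ ^ 2 : ℝ) : ℂ))
    (v' := fun θ => Complex.I / y *
      (Complex.exp (Complex.I * (y * cos θ : ℝ)) * (Complex.I * (y * -sin θ : ℝ))))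
    (a := δ) (b := π / 2)
    (fun θ hθ => hu θ (huIcc ▸ hθ)) (fun θ _ => hv θ)
    (by
      apply ContinuousOn.intervalIntegrable
      rw [huIcc]
      refine Complex.continuous_ofReal.comp_continuousOn ?_
      exact Real.continuous_cos.continuousOn.neg.div (Real.continuous_sin.continuousOn.pow 2)
        fun θ hθ => pow_ne_zero 2 (hsin θ hθ))
    (by
      apply Continuous.intervalIntegrable
      fun_prop)
  have hlhs : ∫ θ in δ..(π / 2), Complex.exp (Complex.I * (y * cos θ : ℝ)) =
      ∫ θ in δ..(π / 2), (((sin θ)⁻¹ : ℝ) : ℂ) * (Complex.I / y *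
        (Complex.exp (Complex.I * (y * cos θ : ℝ)) * (Complex.I * (y * -sin θ : ℝ)))) := by
    apply intervalIntegral.integral_congr
    intro θ hθ
    have : (sin θ : ℂ) ≠ 0 := by exact_mod_cast hsin θ (huIcc ▸ hθ)
    simp only [Complex.ofReal_inv, Complex.ofReal_mul, Complex.ofReal_neg]
    field_simp
    rw [Complex.I_sq]
    ring
  have hrhs : ∫ θ in δ..(π / 2), ((-cos θ / sin θ ^ 2 : ℝ) : ℂ) *
        (Complex.I / y * Complex.exp (Complex.I * (y * cos θ : ℝ))) =
      -(Complex.I / y * ∫ θ in δ..(π / 2), ((cos θ / sin θ ^ 2 : ℝ) : ℂ) *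
          Complex.exp (Complex.I * (y * cos θ : ℝ))) := by
    rw [← intervalIntegral.integral_const_mul, ← intervalIntegral.integral_neg]
    congr 1
    ext θ
    push_cast
    ring
  rw [hlhs, hparts, hrhs]
  simp only [Real.sin_pi_div_two, Real.cos_pi_div_two, mul_zero, Complex.ofReal_zero,
    Complex.exp_zero, Complex.ofReal_inv, Complex.ofReal_one, inv_one, one_mul, mul_one]
  ring

theorem integral_cos_div_sin_sq {δ : ℝ} (hδ : 0 < δ) (hδ' : δ ≤ π / 2) :
    IntervalIntegrable (fun θ => cos θ / sin θ ^ 2) volume δ (π / 2) ∧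
      ∫ θ in δ..(π / 2), cos θ / sin θ ^ 2 = (sin δ)⁻¹ - 1 := by
  have huIcc : Set.uIcc δ (π / 2) = Set.Icc δ (π / 2) := Set.uIcc_of_le hδ'
  have hsin : ∀ θ ∈ Set.Icc δ (π / 2), sin θ ≠ 0 := fun θ hθ =>
    (Real.sin_pos_of_pos_of_lt_pi (hδ.trans_le hθ.1) (by linarith [hθ.2, Real.pi_pos])).ne'
  have hint : IntervalIntegrable (fun θ => cos θ / sin θ ^ 2) volume δ (π / 2) := by
    apply ContinuousOn.intervalIntegrable
    rw [huIcc]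
    exact Real.continuous_cos.continuousOn.div (Real.continuous_sin.continuousOn.pow 2)
        fun θ hθ => pow_ne_zero 2 (hsin θ hθ)
  refine ⟨hint, ?_⟩
  rw [intervalIntegral.integral_eq_sub_of_hasDerivAt (f := fun θ => -(sin θ)⁻¹)
    (fun θ hθ => ?_) hint]
  · simp; ring
  · refine ((Real.hasDerivAt_sin θ).fun_inv (hsin θ (huIcc ▸ hθ))).neg.congr_deriv ?_
    ring

theorem intervalIntegral_swap_of_continuousOn {F : ℝ → ℝ → ℂ} {a b c d : ℝ} (hab : a ≤ b)
    (hcd : c ≤ d) (hF : ContinuousOn (Function.uncurry F) (Set.Icc a b ×ˢ Set.Icc c d)) :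
    ∫ x in a..b, ∫ y in c..d, F x y = ∫ y in c..d, ∫ x in a..b, F x y := by
  apply intervalIntegral_intervalIntegral_swap
  rw [Set.uIoc_of_le hab, Set.uIoc_of_le hcd]
  exact (hF.integrableOn_compact (isCompact_Icc.prod isCompact_Icc)).mono_set
    (Set.prod_mono Set.Ioc_subset_Icc_self Set.Ioc_subset_Icc_self)

theorem continuous_exp_phase_cos (c t : ℝ) : Continuous fun p : ℝ × ℝ =>
    Complex.exp (Complex.I * (c * cos p.2 * p.1 - t * profile p.1 : ℝ)) := by
  have := continuous_profile
  fun_prop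

/-- Angular integration estimated by the length of the interval. -/
theorem norm_integral_angle_le {c t L B α β : ℝ} (hL : 2 ≤ L) (hαβ : α ≤ β)
    (hB : ∀ θ ∈ Set.Icc α β, ∀ b ∈ Set.Icc (L / 2) (2 * L),
      ‖∫ s in (L / 2)..b, Complex.exp (Complex.I * (c * cos θ * s - t * profile s : ℝ))‖ ≤ B) :
    ‖∫ s in (L / 2)..(2 * L), ∫ θ in α..β,
      (s : ℂ) * Complex.exp (Complex.I * (c * cos θ * s - t * profile s : ℝ))‖ ≤
        4 * L * B * (β - α) := by
  rw [intervalIntegral_swap_of_continuousOn (by linarith) hαβ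
    (Continuous.continuousOn (by
      have := continuous_exp_phase_cos c t
      exact (Complex.continuous_ofReal.comp continuous_fst).mul this))]
  refine (intervalIntegral.norm_integral_le_of_norm_le_const fun θ hθ => ?_).trans_eq
    (by rw [abs_of_nonneg (sub_nonneg.2 hαβ)])
  rw [Set.uIoc_of_le hαβ] at hθ
  exact norm_integral_mul_exp_phase_le hL (hB θ (Set.Ioc_subset_Icc_self hθ))

/-- Angular integration by parts: the gain `1 / (c s)` cancels the radial weight `s`, so that the
radial integrals that remain carry no amplitude. -/
theorem norm_integral_angle_le_of_away {c t L B δ : ℝ} (hL : 2 ≤ L) (hc : 0 < |c|) (hδ : 0 < δ)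
    (hδ' : δ ≤ π / 2)
    (hB : ∀ c' : ℝ,
      ‖∫ s in (L / 2)..(2 * L), Complex.exp (Complex.I * (c' * s - t * profile s : ℝ))‖ ≤ B) :
    ‖∫ s in (L / 2)..(2 * L), ∫ θ in δ..(π / 2),
      (s : ℂ) * Complex.exp (Complex.I * (c * cos θ * s - t * profile s : ℝ))‖ ≤
        2 * B / (|c| * sin δ) := by
  have hc0 : c ≠ 0 := abs_pos.1 hc
  have hsin : 0 < sin δ := Real.sin_pos_of_pos_of_lt_pi hδ (by linarith [Real.pi_pos])
  have hLL : L / 2 ≤ 2 * L := by linarith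
  obtain ⟨hwi, hw⟩ := integral_cos_div_sin_sq hδ hδ'
  set E : ℝ → ℝ → ℂ := fun c' s => Complex.exp (Complex.I * (c' * s - t * profile s : ℝ)) with hE
  have hinner : ∀ s ∈ Set.uIcc (L / 2) (2 * L), ∫ θ in δ..(π / 2), (s : ℂ) * E (c * cos θ) s =
      Complex.I / c * (E 0 s - (sin δ : ℂ)⁻¹ * E (c * cos δ) s +
        ∫ θ in δ..(π / 2), ((cos θ / sin θ ^ 2 : ℝ) : ℂ) * E (c * cos θ) s) := by
    intro s hs
    rw [Set.uIcc_of_le hLL] at hs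
    have hs0 : s ≠ 0 := by
      have := hs.1
      intro h
      linarith
    have hsC : (s : ℂ) ≠ 0 := by exact_mod_cast hs0
    have hcC : (c : ℂ) ≠ 0 := by exact_mod_cast hc0
    have hsplit : ∀ θ, E (c * cos θ) s =
        Complex.exp (Complex.I * (-(t * profile s) : ℝ)) *
          Complex.exp (Complex.I * (c * s * cos θ : ℝ)) := fun θ => by
      rw [hE, ← Complex.exp_add]
      push_cast
      ring_nf
    have h0 : E 0 s = Complex.exp (Complex.I * (-(t * profile s) : ℝ)) := by
      simp [hE]
    simp_rw [hsplit, h0]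
    have h1 : ∀ θ : ℝ, (s : ℂ) * (Complex.exp (Complex.I * (-(t * profile s) : ℝ)) *
        Complex.exp (Complex.I * (c * s * cos θ : ℝ))) =
        (s * Complex.exp (Complex.I * (-(t * profile s) : ℝ))) *
        Complex.exp (Complex.I * (c * s * cos θ : ℝ)) := fun θ => by ring
    have h2 : ∀ θ : ℝ, ((cos θ / sin θ ^ 2 : ℝ) : ℂ) *
        (Complex.exp (Complex.I * (-(t * profile s) : ℝ)) *
        Complex.exp (Complex.I * (c * s * cos θ : ℝ))) =
        Complex.exp (Complex.I * (-(t * profile s) : ℝ)) *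
        (((cos θ / sin θ ^ 2 : ℝ) : ℂ) *
        Complex.exp (Complex.I * (c * s * cos θ : ℝ))) := fun θ => by ring
    simp_rw [h1, h2]
    rw [intervalIntegral.integral_const_mul, intervalIntegral.integral_const_mul,
      integral_exp_cos_eq (mul_ne_zero hc0 hs0) hδ hδ', Complex.ofReal_mul]
    field_simp
  have hEc : ∀ c', Continuous (E c') := fun c' => continuous_exp_phase c' t
  have hcont : ContinuousOn (Function.uncurry fun s θ =>
      ((cos θ / sin θ ^ 2 : ℝ) : ℂ) * E (c * cos θ) s)
      (Set.Icc (L / 2) (2 * L) ×ˢ Set.Icc δ (π / 2)) := by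
    refine ContinuousOn.mul ?_ (continuous_exp_phase_cos c t).continuousOn
    refine Complex.continuous_ofReal.comp_continuousOn ?_
    refine ContinuousOn.div (by fun_prop) (by fun_prop) fun p hp => ?_
    exact pow_ne_zero 2 (Real.sin_pos_of_pos_of_lt_pi (hδ.trans_le hp.2.1)
      (by linarith [hp.2.2, Real.pi_pos])).ne'
  have hint : IntervalIntegrable (fun s => ∫ θ in δ..(π / 2),
      ((cos θ / sin θ ^ 2 : ℝ) : ℂ) * E (c * cos θ) s) volume (L / 2) (2 * L) := by
    have h := (hcont.integrableOn_compact (μ := volume) (isCompact_Icc.prod isCompact_Icc)).mono_set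
      (Set.prod_mono Set.Ioc_subset_Icc_self Set.Ioc_subset_Icc_self)
    rw [IntegrableOn, Measure.volume_eq_prod, ← Measure.prod_restrict] at h
    rw [intervalIntegrable_iff_integrableOn_Ioc_of_le hLL]
    simp_rw [intervalIntegral.integral_of_le hδ']
    exact h.integral_prod_left
  rw [intervalIntegral.integral_congr hinner, intervalIntegral.integral_const_mul,
    intervalIntegral.integral_add (((hEc 0).intervalIntegrable _ _).sub
      (((hEc _).intervalIntegrable _ _).const_mul _)) hint,
    intervalIntegral.integral_sub ((hEc 0).intervalIntegrable _ _)
      (((hEc _).intervalIntegrable _ _).const_mul _),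
    intervalIntegral.integral_const_mul, intervalIntegral_swap_of_continuousOn hLL hδ' hcont]
  have hfin : ‖∫ θ in δ..(π / 2), ∫ s in (L / 2)..(2 * L),
      ((cos θ / sin θ ^ 2 : ℝ) : ℂ) * E (c * cos θ) s‖ ≤ ((sin δ)⁻¹ - 1) * B := by
    rw [← hw, ← intervalIntegral.integral_mul_const]
    refine intervalIntegral.norm_integral_le_of_norm_le hδ' ?_ (hwi.mul_const B)
    refine Filter.Eventually.of_forall fun θ hθ => ?_
    rw [intervalIntegral.integral_const_mul, norm_mul, Complex.norm_real, Real.norm_eq_abs,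
      abs_of_nonneg (div_nonneg (Real.cos_nonneg_of_mem_Icc
        ⟨by linarith [hθ.1, Real.pi_pos], hθ.2⟩) (sq_nonneg _))]
    exact mul_le_mul_of_nonneg_left (hB _) (div_nonneg (Real.cos_nonneg_of_mem_Icc
        ⟨by linarith [hθ.1, Real.pi_pos], hθ.2⟩) (sq_nonneg _))
  have hmid : ‖(sin δ : ℂ)⁻¹ * ∫ s in (L / 2)..(2 * L), E (c * cos δ) s‖ ≤ (sin δ)⁻¹ * B := by
    rw [norm_mul, norm_inv, Complex.norm_real, Real.norm_eq_abs, abs_of_pos hsin]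
    exact mul_le_mul_of_nonneg_left (hB _) (by positivity)
  rw [norm_mul, norm_div, Complex.norm_I, Complex.norm_real, Real.norm_eq_abs]
  calc _ ≤ 1 / |c| * (B + (sin δ)⁻¹ * B + ((sin δ)⁻¹ - 1) * B) := by
        refine mul_le_mul_of_nonneg_left ?_ (by positivity)
        exact (norm_add_le _ _).trans (add_le_add ((norm_sub_le _ _).trans
          (add_le_add (hB 0) hmid)) hfin)
    _ = _ := by
        field_simp
        ring

/-- The radial integral over a quarter of the angles decays like `1 / t`. If `c` is so small that
the phase has no radial critical point, the first-derivative test suffices. Otherwise the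
second-derivative test in `s` gives `t^{-1/2}`, and the other half power comes from the angle,
split at `δ = (L |c|)^{-1/2}`. -/
theorem norm_integral_quarter_le {c t L : ℝ} (hL : 2 ≤ L) (ht : 0 < t) :
    ‖∫ s in (L / 2)..(2 * L), ∫ θ in (0 : ℝ)..(π / 2),
      (s : ℂ) * Complex.exp (Complex.I * (c * cos θ * s - t * profile s : ℝ))‖ ≤
        10000 * (L * √L / t) := by
  have hL0 : 0 < L := by linarith
  have hsL : 0 < √L := Real.sqrt_pos.2 hL0
  have hπ := Real.pi_pos
  have hπ4 := Real.pi_le_four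
  set W := √(L * √L / t) with hW
  have hWW : W * W = L * √L / t := Real.mul_self_sqrt (by positivity)
  have hW0 : 0 < W := Real.sqrt_pos.2 (by positivity)
  have hB : ∀ c' : ℝ, ∀ b ∈ Set.Icc (L / 2) (2 * L),
      ‖∫ s in (L / 2)..b, Complex.exp (Complex.I * (c' * s - t * profile s : ℝ))‖ ≤ 200 * W :=
    fun c' b hb => norm_integral_exp_phase_le c' ht (by linarith) hb.1 hb.2
  by_cases hc : |c| ≤ t / (8 * √L)
  · refine (norm_integral_angle_le (B := 50 * √L / t) hL (by positivity)
      fun θ _ b hb => ?_).trans ?_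
    · refine norm_integral_exp_phase_le_of_nonstationary ht (by linarith) hb.1 hb.2 ?_
      rw [abs_mul]
      exact (mul_le_of_le_one_right (abs_nonneg _) (Real.abs_cos_le_one θ)).trans hc
    · have h1 : 4 * L * (50 * √L / t) * (π / 2 - 0) = 100 * π * (L * √L / t) := by ring
      rw [h1, ← hWW]
      nlinarith [mul_pos hW0 hW0]
  push Not at hc
  have hc0 : 0 < |c| := lt_trans (by positivity) hc
  set δ := 1 / √(L * |c|) with hδ
  have hLc : 0 < L * |c| := by positivity
  have hδ0 : 0 < δ := by positivity
  -- `L δ = √(L / |c|) ≤ √8 W`, by the lower bound on `|c|`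
  have hLδ : L * δ ≤ 3 * W := by
    rw [← Real.sqrt_sq (show (0 : ℝ) ≤ L * δ by positivity), hW,
      show (3 : ℝ) = √(3 ^ 2) by rw [Real.sqrt_sq (by norm_num)], ← Real.sqrt_mul (by norm_num)]
    apply Real.sqrt_le_sqrt
    have h1 : (L * δ) ^ 2 = L / |c| := by
      rw [hδ, mul_pow, div_pow, Real.sq_sqrt hLc.le]
      field_simp
    rw [h1, div_le_iff₀ hc0]
    calc L = 8 * (L * √L / t) * (t / (8 * √L)) := by field_simp
      _ ≤ 8 * (L * √L / t) * |c| := by gcongr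
      _ ≤ _ := by
        have : 0 ≤ L * √L / t * |c| := by positivity
        nlinarith
  have hcδ : |c| * δ * (L * δ) = 1 := by
    have : δ * δ = 1 / (L * |c|) := by
      rw [hδ, div_mul_div_comm, Real.mul_self_sqrt hLc.le, one_mul]
    calc |c| * δ * (L * δ) = |c| * L * (δ * δ) := by ring
      _ = 1 := by rw [this]; field_simp
  rw [← hWW]
  rcases le_total (π / 2) δ with h | h
  · refine (norm_integral_angle_le hL (by positivity) fun θ _ => hB _).trans ?_
    have : L * (π / 2 - 0) ≤ 3 * W := (mul_le_mul_of_nonneg_left (by linarith) hL0.le).trans hLδ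
    nlinarith
  · have hint : ∀ α β s : ℝ, IntervalIntegrable (fun θ =>
        (s : ℂ) * Complex.exp (Complex.I * (c * cos θ * s - t * profile s : ℝ))) volume α β :=
      fun α β s => Continuous.intervalIntegrable (by fun_prop) _ _
    have hint2 : ∀ α β : ℝ, IntervalIntegrable (fun s => ∫ θ in α..β,
        (s : ℂ) * Complex.exp (Complex.I * (c * cos θ * s - t * profile s : ℝ)))
        volume (L / 2) (2 * L) := fun α β => by
      refine Continuous.intervalIntegrable ?_ _ _
      refine intervalIntegral.continuous_parametric_intervalIntegral_of_continuous' ?_ _ _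
      exact (Complex.continuous_ofReal.comp continuous_fst).mul (continuous_exp_phase_cos c t)
    simp_rw [fun s : ℝ => (intervalIntegral.integral_add_adjacent_intervals
      (hint 0 δ s) (hint δ (π / 2) s)).symm]
    rw [intervalIntegral.integral_add (hint2 _ _) (hint2 _ _)]
    have h1 := norm_integral_angle_le (c := c) (t := t) hL hδ0.le fun θ _ => hB (c * cos θ)
    have h2 := norm_integral_angle_le_of_away (c := c) (t := t) hL hc0 hδ0 h
      fun c' => hB c' (2 * L) (Set.right_mem_Icc.2 (by linarith))
    have hsin : 2 / π * δ ≤ sin δ := Real.mul_le_sin hδ0.le h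
    have hsin' : δ / 2 ≤ sin δ := by
      refine le_trans ?_ hsin
      rw [div_mul_eq_mul_div, div_le_div_iff₀ two_pos hπ]
      nlinarith
    have h3 : 2 * (200 * W) / (|c| * sin δ) ≤ 800 * W * (L * δ) := by
      rw [div_le_iff₀ (mul_pos hc0 (by linarith))]
      calc 2 * (200 * W) = 800 * W * (|c| * δ * (L * δ)) / 2 := by rw [hcδ]; ring
        _ = 800 * W * (L * δ) * (|c| * (δ / 2)) := by ring
        _ ≤ _ := by gcongr
    refine (norm_add_le _ _).trans ((add_le_add h1 (h2.trans h3)).trans ?_)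
    nlinarith

/-! ### The dispersive estimate -/

/-- The frequency shell `L / 2 ≤ |η| ≤ 2 L`. -/
def shell (d : ℕ) (L : ℝ) : Set (Space d) := {η | L / 2 ≤ ‖η‖ ∧ ‖η‖ ≤ 2 * L}

/-- The frequency shell in the normalization in which `ξ` stands for the frequency `2πξ`. -/
def annulus (d : ℕ) (L : ℝ) : Set (Space d) := {ξ | (2 * π) • ξ ∈ shell d L}

theorem isClosed_shell (d : ℕ) (L : ℝ) : IsClosed (shell d L) :=
  (isClosed_le continuous_const continuous_norm).inter
    (isClosed_le continuous_norm continuous_const)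

theorem isClosed_annulus (d : ℕ) (L : ℝ) : IsClosed (annulus d L) :=
  (isClosed_shell d L).preimage (continuous_const_smul (2 * π))

/-- The convolution kernel of `e^{-i t m(D)}` sharply localized to the shell of radius `L`. -/
def kernel (d : ℕ) (L t : ℝ) (x : Space d) : ℂ :=
  ∫ ξ in annulus d L, Complex.exp
    (Complex.I * (2 * π * inner ℝ x ξ - t * dispersion d ((2 * π) • ξ) : ℝ))

/-- The size of the kernel to the power `1 / d`. -/
def decay (L t : ℝ) : ℝ := √(L * √L / |t|)

theorem norm_kernel_le_shell (d : ℕ) (L t : ℝ) (x : Space d) :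
    ‖kernel d L t x‖ ≤ ‖∫ η in shell d L, Complex.exp
      (Complex.I * (inner ℝ x η - t * dispersion d η : ℝ))‖ := by
  have h := Measure.integral_comp_smul (volume : Measure (Space d))
    ((shell d L).indicator fun η => Complex.exp
      (Complex.I * (inner ℝ x η - t * dispersion d η : ℝ))) (2 * π)
  have h1 : kernel d L t x = ∫ ξ, ((shell d L).indicator fun η => Complex.exp
      (Complex.I * (inner ℝ x η - t * dispersion d η : ℝ))) ((2 * π) • ξ) := by
    rw [kernel, ← integral_indicator (isClosed_annulus d L).measurableSet]
    congr 1
    ext ξ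
    by_cases hξ : ξ ∈ annulus d L
    · rw [Set.indicator_of_mem hξ, Set.indicator_of_mem (show (2 * π) • ξ ∈ shell d L from hξ),
        inner_smul_right]
    · rw [Set.indicator_of_notMem hξ, Set.indicator_of_notMem
        (show (2 * π) • ξ ∉ shell d L from hξ)]
  rw [h1, h, integral_indicator (isClosed_shell d L).measurableSet, norm_smul]
  refine mul_le_of_le_one_left (norm_nonneg _) ?_
  rw [norm_abs_eq_norm, norm_inv, norm_pow, Real.norm_eq_abs, abs_of_pos (by positivity)]
  refine inv_le_one_of_one_le₀ (one_le_pow₀ ?_)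
  linarith [Real.pi_gt_three]

theorem kernel_neg (d : ℕ) (L t : ℝ) (x : Space d) :
    kernel d L (-t) x = (starRingEnd ℂ) (kernel d L t (-x)) := by
  rw [kernel, kernel, ← integral_conj]
  congr 1
  ext ξ
  rw [← Complex.exp_conj, map_mul, Complex.conj_I, Complex.conj_ofReal, inner_neg_left]
  push_cast
  ring_nf

theorem norm_shell_integral_one_le {L t : ℝ} (hL : 2 ≤ L) (ht : 0 < t) (x : Space 1) :
    ‖∫ η in shell 1 L, Complex.exp (Complex.I * (inner ℝ x η - t * dispersion 1 η : ℝ))‖ ≤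
      400 * decay L t := by
  have hL0 : 0 < L := by linarith
  let e : Space 1 ≃ᵐ ℝ :=
    (MeasurableEquiv.toLp 2 (Fin 1 → ℝ)).symm.trans (MeasurableEquiv.funUnique (Fin 1) ℝ)
  have he : MeasurePreserving e volume volume :=
    (volume_preserving_funUnique (Fin 1) ℝ).comp (PiLp.volume_preserving_ofLp (Fin 1))
  have hee : ∀ η, e η = η 0 := fun η => rfl
  set F : ℝ → ℂ := fun s => Complex.exp (Complex.I * (x 0 * s - t * (s * √(tanh s / s)) : ℝ))
    with hF
  have h1 : ∫ η in shell 1 L, Complex.exp (Complex.I * (inner ℝ x η - t * dispersion 1 η : ℝ)) =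
      ∫ s in {s : ℝ | L / 2 ≤ |s| ∧ |s| ≤ 2 * L}, F s := by
    rw [← he.setIntegral_preimage_emb e.measurableEmbedding]
    have hset : e ⁻¹' {s : ℝ | L / 2 ≤ |s| ∧ |s| ≤ 2 * L} = shell 1 L := by
      ext η
      simp [shell, hee, EuclideanSpace.norm_eq, Real.sqrt_sq_eq_abs]
    rw [hset]
    congr 1
    ext η
    rw [hF, hee, dispersion_one]
    simp only [PiLp.inner_apply, Finset.univ_unique, Finset.sum_singleton]
    simp [mul_comm]
  have hset : {s : ℝ | L / 2 ≤ |s| ∧ |s| ≤ 2 * L} =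
      Set.Icc (-(2 * L)) (-(L / 2)) ∪ Set.Icc (L / 2) (2 * L) := by
    ext s
    simp only [Set.mem_ofPred_eq, Set.mem_union, Set.mem_Icc]
    rcases le_total 0 s with h | h
    · rw [abs_of_nonneg h]
      constructor
      · exact fun h => Or.inr h
      · rintro (h | h)
        · exact ⟨by linarith [h.2], by linarith [h.2]⟩
        · exact h
    · rw [abs_of_nonpos h]
      constructor
      · exact fun h => Or.inl ⟨by linarith [h.2], by linarith [h.1]⟩
      · rintro (h | h)
        · exact ⟨by linarith [h.2], by linarith [h.1]⟩
        · exact ⟨by linarith [h.1], by linarith [h.1]⟩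
  have hpos : ∀ s ∈ Set.Icc (L / 2) (2 * L),
      F s = Complex.exp (Complex.I * (x 0 * s - t * profile s : ℝ)) := fun s hs => by
    rw [hF]
    simp only
    rw [mul_sqrt_tanh_div (by linarith [hs.1])]
  have hneg : ∀ s ∈ Set.Icc (L / 2) (2 * L),
      F (-s) = (starRingEnd ℂ) (Complex.exp (Complex.I * (x 0 * s - t * profile s : ℝ))) :=
    fun s hs => by
    rw [hF]
    simp only
    rw [Real.tanh_neg, neg_div_neg_eq, ← Complex.exp_conj, map_mul, Complex.conj_I,
      Complex.conj_ofReal, ← mul_sqrt_tanh_div (show 0 ≤ s by linarith [hs.1])]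
    push_cast
    ring_nf
  have hLL : L / 2 ≤ 2 * L := by linarith
  have hc := continuous_exp_phase (x 0) t
  have hI1 : ∫ s in Set.Icc (L / 2) (2 * L), F s =
      ∫ s in (L / 2)..(2 * L), Complex.exp (Complex.I * (x 0 * s - t * profile s : ℝ)) := by
    rw [setIntegral_congr_fun measurableSet_Icc hpos, integral_Icc_eq_integral_Ioc,
      ← intervalIntegral.integral_of_le hLL]
  have hI2 : ∫ s in Set.Icc (-(2 * L)) (-(L / 2)), F s = (starRingEnd ℂ)
      (∫ s in (L / 2)..(2 * L), Complex.exp (Complex.I * (x 0 * s - t * profile s : ℝ))) := by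
    rw [integral_Icc_eq_integral_Ioc, ← intervalIntegral.integral_of_le (by linarith),
      ← intervalIntegral.integral_comp_neg, ← intervalIntegral.intervalIntegral_conj]
    refine intervalIntegral.integral_congr fun s hs => ?_
    rw [Set.uIcc_of_le hLL] at hs
    exact hneg s hs
  have hFi1 : IntegrableOn F (Set.Icc (L / 2) (2 * L)) :=
    (integrableOn_congr_fun hpos measurableSet_Icc).2 (hc.integrableOn_Icc)
  have hFi2 : IntegrableOn F (Set.Icc (-(2 * L)) (-(L / 2))) := by
    have h3 : IntegrableOn (fun s => F (-s)) (Set.Icc (L / 2) (2 * L)) :=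
      (integrableOn_congr_fun hneg measurableSet_Icc).2
        ((Complex.continuous_conj.comp hc).integrableOn_Icc)
    have := (Measure.measurePreserving_neg (volume : Measure ℝ)).integrableOn_comp_preimage
      (MeasurableEquiv.neg ℝ).measurableEmbedding (f := F) (s := Set.Icc (-(2 * L)) (-(L / 2)))
    refine this.1 ?_
    have hpre : Neg.neg ⁻¹' Set.Icc (-(2 * L)) (-(L / 2)) = Set.Icc (L / 2) (2 * L) := by
      ext s
      simp only [Set.mem_preimage, Set.mem_Icc]
      constructor <;> rintro ⟨h, h'⟩ <;> constructor <;> linarith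
    rw [hpre]
    exact h3
  have hdisj : Disjoint (Set.Icc (-(2 * L)) (-(L / 2))) (Set.Icc (L / 2) (2 * L)) := by
    rw [Set.disjoint_left]
    intro s hs hs'
    linarith [hs.2, hs'.1]
  have hJ := norm_integral_exp_phase_le (x 0) ht (show 1 ≤ L / 2 by linarith) hLL le_rfl
  rw [h1, hset, setIntegral_union hdisj measurableSet_Icc hFi2 hFi1, hI1, hI2]
  refine (norm_add_le _ _).trans ?_
  rw [Complex.norm_conj, decay, abs_of_pos ht]
  linarith

/-- Folding the circle onto the first quadrant. -/
theorem integral_circle_comp_cos {g : ℝ → ℂ} (hg : Continuous g) (α : ℝ) :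
    ∫ θ in (-π)..π, g (cos (θ - α)) =
      2 * ((∫ θ in (0 : ℝ)..(π / 2), g (cos θ)) + ∫ θ in (0 : ℝ)..(π / 2), g (-cos θ)) := by
  have hgc : Continuous fun θ => g (cos θ) := hg.comp Real.continuous_cos
  have hi : ∀ a b : ℝ, IntervalIntegrable (fun θ => g (cos θ)) volume a b :=
    fun a b => hgc.intervalIntegrable a b
  have hper : Function.Periodic (fun θ => g (cos θ)) (2 * π) := fun θ => by
    simp [Real.cos_add_two_pi]
  have h1 : ∫ θ in (-π)..π, g (cos (θ - α)) = ∫ θ in (-π)..π, g (cos θ) := by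
    rw [intervalIntegral.integral_comp_sub_right (fun θ => g (cos θ)) α]
    have := hper.intervalIntegral_add_eq (-π - α) (-π)
    rw [show -π - α + 2 * π = π - α by ring, show -π + 2 * π = π by ring] at this
    exact this
  have h2 : ∫ θ in (-π)..0, g (cos θ) = ∫ θ in (0 : ℝ)..π, g (cos θ) := by
    have := intervalIntegral.integral_comp_neg (a := 0) (b := π) (fun θ => g (cos θ))
    simp only [Real.cos_neg, neg_zero] at this
    exact this.symm
  have h3 : ∫ θ in (π / 2)..π, g (cos θ) = ∫ θ in (0 : ℝ)..(π / 2), g (-cos θ) := by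
    have := intervalIntegral.integral_comp_sub_left (a := 0) (b := π / 2) (fun θ => g (cos θ)) π
    simp only [Real.cos_pi_sub, sub_zero] at this
    rw [this]
    congr 1
    ring
  rw [h1, ← intervalIntegral.integral_add_adjacent_intervals (hi _ 0) (hi 0 _), h2,
    ← intervalIntegral.integral_add_adjacent_intervals (hi 0 (π / 2)) (hi (π / 2) π), h3]
  ring

theorem norm_shell_integral_two_le {L t : ℝ} (hL : 2 ≤ L) (ht : 0 < t) (x : Space 2) :
    ‖∫ η in shell 2 L, Complex.exp (Complex.I * (inner ℝ x η - t * dispersion 2 η : ℝ))‖ ≤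
      40000 * decay L t ^ 2 := by
  have hL0 : 0 < L := by linarith
  have hLL : L / 2 ≤ 2 * L := by linarith
  have hπ := Real.pi_pos
  set e := Complex.orthonormalBasisOneI.repr with he
  obtain ⟨w, rfl⟩ := e.surjective x
  set α := Complex.arg w with hα
  set c := ‖w‖ with hc
  set G : ℂ → ℂ := (e ⁻¹' shell 2 L).indicator fun z =>
    Complex.exp (Complex.I * (inner ℝ w z - t * profile ‖z‖ : ℝ)) with hG
  have hmeas : MeasurableSet (e ⁻¹' shell 2 L) :=
    ((isClosed_shell 2 L).preimage e.continuous).measurableSet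
  have h1 : ∫ η in shell 2 L, Complex.exp
      (Complex.I * (inner ℝ (e w) η - t * dispersion 2 η : ℝ)) = ∫ z, G z := by
    rw [hG, integral_indicator hmeas, ← e.measurePreserving.setIntegral_preimage_emb
      e.toHomeomorph.measurableEmbedding]
    congr 1
    ext z
    rw [dispersion_two, LinearIsometryEquiv.inner_map_map, LinearIsometryEquiv.norm_map]
  have hGpolar : ∀ p ∈ polarCoord.target, p.1 • G (Complex.polarCoord.symm p) =
      (Set.Icc (L / 2) (2 * L) ×ˢ Set.Ioo (-π) π).indicator (fun p : ℝ × ℝ => (p.1 : ℂ) *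
        Complex.exp (Complex.I * (c * p.1 * cos (p.2 - α) - t * profile p.1 : ℝ))) p := by
    intro p hp
    rw [polarCoord_target] at hp
    have hp1 : 0 < p.1 := hp.1
    have hn : ‖Complex.polarCoord.symm p‖ = p.1 := by
      rw [Complex.norm_polarCoord_symm, abs_of_pos hp1]
    have hmem : Complex.polarCoord.symm p ∈ e ⁻¹' shell 2 L ↔
        p ∈ Set.Icc (L / 2) (2 * L) ×ˢ Set.Ioo (-π) π := by
      rw [Set.mem_preimage, shell, Set.mem_ofPred_eq, LinearIsometryEquiv.norm_map, hn]
      exact ⟨fun h => ⟨h, hp.2⟩, fun h => h.1⟩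
    by_cases hpm : p ∈ Set.Icc (L / 2) (2 * L) ×ˢ Set.Ioo (-π) π
    · rw [hG, Set.indicator_of_mem (hmem.2 hpm), Set.indicator_of_mem hpm, hn, Complex.real_smul]
      congr 4
      have hw : w = c * (Real.cos α + Real.sin α * Complex.I) := by
        rw [hc, hα]
        push_cast
        exact (Complex.norm_mul_cos_add_sin_mul_I w).symm
      have hre : w.re = c * cos α := by
        rw [hw]
        simp [-Complex.ofReal_cos, -Complex.ofReal_sin]
      have him : w.im = c * sin α := by
        rw [hw]
        simp [-Complex.ofReal_cos, -Complex.ofReal_sin]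
      rw [Complex.inner, Complex.polarCoord_symm_apply, Complex.mul_re, Complex.conj_re,
        Complex.conj_im, hre, him, Real.cos_sub]
      simp [-Complex.ofReal_cos, -Complex.ofReal_sin]
      ring
    · rw [hG, Set.indicator_of_notMem (fun h => hpm (hmem.1 h)), Set.indicator_of_notMem hpm,
        smul_zero]
  have hcont : Continuous fun p : ℝ × ℝ => (p.1 : ℂ) *
      Complex.exp (Complex.I * (c * p.1 * cos (p.2 - α) - t * profile p.1 : ℝ)) := by
    have := continuous_profile
    fun_prop
  have h2 : ∫ z, G z = ∫ s in (L / 2)..(2 * L), ∫ θ in (-π)..π, (s : ℂ) *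
      Complex.exp (Complex.I * (c * s * cos (θ - α) - t * profile s : ℝ)) := by
    have hsub : Set.Icc (L / 2) (2 * L) ×ˢ Set.Ioo (-π) π ⊆ polarCoord.target := by
      rw [polarCoord_target]
      exact Set.prod_mono (fun s hs => lt_of_lt_of_le (by linarith : 0 < L / 2) hs.1) le_rfl
    rw [← Complex.integral_comp_polarCoord_symm,
      setIntegral_congr_fun polarCoord.open_target.measurableSet hGpolar,
      setIntegral_indicator (measurableSet_Icc.prod measurableSet_Ioo),
      Set.inter_eq_self_of_subset_right hsub, Measure.volume_eq_prod, setIntegral_prod,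
      intervalIntegral.integral_of_le hLL, ← integral_Icc_eq_integral_Ioc]
    · congr 1
      ext s
      rw [intervalIntegral.integral_of_le (by linarith), ← integral_Ioc_eq_integral_Ioo]
    · exact (hcont.continuousOn.integrableOn_compact (isCompact_Icc.prod isCompact_Icc)).mono_set
        (Set.prod_mono le_rfl Set.Ioo_subset_Icc_self)
  have h3 : ∀ s : ℝ, ∫ θ in (-π)..π, (s : ℂ) *
      Complex.exp (Complex.I * (c * s * cos (θ - α) - t * profile s : ℝ)) =
      2 * ((∫ θ in (0 : ℝ)..(π / 2), (s : ℂ) *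
        Complex.exp (Complex.I * (c * cos θ * s - t * profile s : ℝ))) +
        ∫ θ in (0 : ℝ)..(π / 2), (s : ℂ) *
        Complex.exp (Complex.I * (-c * cos θ * s - t * profile s : ℝ))) := fun s => by
    rw [integral_circle_comp_cos (g := fun y => (s : ℂ) *
      Complex.exp (Complex.I * (c * s * y - t * profile s : ℝ))) (by fun_prop)]
    congr 4
    · ext θ
      ring_nf
    · ext θ
      ring_nf
  have hint2 : ∀ c : ℝ, IntervalIntegrable (fun s => ∫ θ in (0 : ℝ)..(π / 2),
      (s : ℂ) * Complex.exp (Complex.I * (c * cos θ * s - t * profile s : ℝ)))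
      volume (L / 2) (2 * L) := fun c => by
    refine Continuous.intervalIntegrable ?_ _ _
    refine intervalIntegral.continuous_parametric_intervalIntegral_of_continuous' ?_ _ _
    exact (Complex.continuous_ofReal.comp continuous_fst).mul (continuous_exp_phase_cos c t)
  rw [h1, h2]
  simp_rw [h3]
  rw [intervalIntegral.integral_const_mul, intervalIntegral.integral_add (hint2 c) (hint2 (-c)),
    norm_mul, decay, Real.sq_sqrt (by positivity), abs_of_pos ht]
  have ha := norm_integral_quarter_le (c := c) hL ht
  have hb := norm_integral_quarter_le (c := -c) hL ht
  have := norm_add_le (∫ s in (L / 2)..(2 * L), ∫ θ in (0 : ℝ)..(π / 2),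
      (s : ℂ) * Complex.exp (Complex.I * (c * cos θ * s - t * profile s : ℝ)))
      (∫ s in (L / 2)..(2 * L), ∫ θ in (0 : ℝ)..(π / 2),
      (s : ℂ) * Complex.exp (Complex.I * (-c * cos θ * s - t * profile s : ℝ)))
  rw [Complex.norm_ofNat]
  linarith

/-- The dispersive estimate `|K_t(x)| ≲ (L^{3/4} |t|^{-1/2})^d`. -/
theorem norm_kernel_le {d : ℕ} (hd : d = 1 ∨ d = 2) {L t : ℝ} (hL : 2 ≤ L) (ht : t ≠ 0)
    (x : Space d) : ‖kernel d L t x‖ ≤ 40000 * decay L t ^ d := by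
  wlog ht0 : 0 < t generalizing t x
  · have h := this (neg_ne_zero.2 ht) (-x) (neg_pos.2 (lt_of_le_of_ne (not_lt.1 ht0) ht))
    rwa [kernel_neg, neg_neg, Complex.norm_conj, decay, abs_neg, ← decay] at h
  refine (norm_kernel_le_shell d L t x).trans ?_
  rcases hd with rfl | rfl
  · have := norm_shell_integral_one_le hL ht0 x
    have h0 : 0 ≤ decay L t := Real.sqrt_nonneg _
    rw [pow_one]
    linarith
  · exact norm_shell_integral_two_le hL ht0 x

/-! ### The Hardy-Littlewood-Sobolev inequality on the line -/

theorem lintegral_comp_abs (g : ℝ → ℝ≥0∞) : ∫⁻ s, g |s| = 2 * ∫⁻ s in Set.Ioi 0, g s := by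
  have h1 : ∫⁻ s in Set.Ioi 0, g |s| = ∫⁻ s in Set.Ioi 0, g s :=
    setLIntegral_congr_fun measurableSet_Ioi fun s hs => by
      rw [abs_of_pos hs]
  have h2 : ∫⁻ s in Set.Iio 0, g |s| = ∫⁻ s in Set.Ioi 0, g s := by
    rw [← h1, ← (Measure.measurePreserving_neg (volume : Measure ℝ)).setLIntegral_comp_preimage_emb
      (MeasurableEquiv.neg ℝ).measurableEmbedding]
    have : Neg.neg ⁻¹' Set.Iio (0 : ℝ) = Set.Ioi 0 := by
      ext s
      simp
    rw [this]
    simp only [abs_neg]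
  rw [← lintegral_add_compl _ (measurableSet_Ioi (a := (0 : ℝ))), h1, Set.compl_Ioi,
    setLIntegral_congr Iio_ae_eq_Iic.symm, h2, two_mul]

theorem lintegral_rpow_lt {a R : ℝ} (ha : -1 < a) (hR : 0 < R) :
    ∫⁻ s in Set.Ioo 0 R, ENNReal.ofReal (s ^ a) = ENNReal.ofReal (R ^ (a + 1) / (a + 1)) := by
  have hi : IntervalIntegrable (fun s : ℝ => s ^ a) volume 0 R :=
    intervalIntegral.intervalIntegrable_rpow' ha
  rw [setLIntegral_congr Ioo_ae_eq_Ioc, ← ofReal_integral_eq_lintegral_ofReal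
    ((intervalIntegrable_iff_integrableOn_Ioc_of_le hR.le).1 hi),
    ← intervalIntegral.integral_of_le hR.le, integral_rpow (Or.inl ha),
    Real.zero_rpow (by linarith), sub_zero]
  filter_upwards [ae_restrict_mem measurableSet_Ioc] with s hs
  exact Real.rpow_nonneg hs.1.le _

theorem lintegral_abs_rpow_lt {a R : ℝ} (ha : -1 < a) (hR : 0 < R) :
    ∫⁻ s in {s : ℝ | |s| < R}, ENNReal.ofReal (|s| ^ a) =
      ENNReal.ofReal (2 * R ^ (a + 1) / (a + 1)) := by
  have hm : MeasurableSet {s : ℝ | |s| < R} := measurableSet_lt continuous_abs.measurable (by simp)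
  have h := lintegral_comp_abs ((Set.Iio R).indicator fun s => ENNReal.ofReal (s ^ a))
  rw [lintegral_indicator measurableSet_Iio, Measure.restrict_restrict measurableSet_Iio,
    Set.Iio_inter_Ioi, lintegral_rpow_lt ha hR] at h
  rw [← lintegral_indicator hm, mul_div_assoc, ENNReal.ofReal_mul zero_le_two, ENNReal.ofReal_ofNat,
    ← h]
  rfl

theorem lintegral_abs_rpow_ge {a R : ℝ} (ha : a < -1) (hR : 0 < R) :
    ∫⁻ s in {s : ℝ | |s| < R}ᶜ, ENNReal.ofReal (|s| ^ a) =
      ENNReal.ofReal (2 * (-R ^ (a + 1) / (a + 1))) := by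
  have hm : MeasurableSet {s : ℝ | |s| < R} := measurableSet_lt continuous_abs.measurable (by simp)
  have h := lintegral_comp_abs ((Set.Ici R).indicator fun s => ENNReal.ofReal (s ^ a))
  have hsub : Set.Ici R ∩ Set.Ioi 0 = Set.Ici R :=
    Set.inter_eq_left.2 fun s hs => lt_of_lt_of_le hR hs
  have hcompl : {s : ℝ | |s| < R}ᶜ = {s : ℝ | R ≤ |s|} := by
    ext s
    simp
  have hnn : 0 ≤ᵐ[volume.restrict (Set.Ioi R)] fun s : ℝ => s ^ a := by
    filter_upwards [ae_restrict_mem measurableSet_Ioi] with s hs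
    exact Real.rpow_nonneg (hR.trans hs).le _
  rw [lintegral_indicator measurableSet_Ici, Measure.restrict_restrict measurableSet_Ici, hsub,
    setLIntegral_congr Ioi_ae_eq_Ici.symm,
    ← ofReal_integral_eq_lintegral_ofReal (integrableOn_Ioi_rpow_of_lt ha hR) hnn,
    integral_Ioi_rpow_of_lt ha hR] at h
  rw [← lintegral_indicator hm.compl, ENNReal.ofReal_mul zero_le_two, ENNReal.ofReal_ofNat,
    ← h, hcompl]
  rfl

/-- The constant in the Hardy-Littlewood-Sobolev inequality. -/
def hlsConst (q : ℝ) : ℝ := 2 * (2 / (1 - 2 / q) + 2 ^ (1 / q))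

/-- One half of the Hardy-Littlewood-Sobolev form: where `f s ≤ a`, the potential of `f` is at most
`a^{p-1}`, by the trivial bound near the singularity and Hölder's inequality away from it. -/
theorem lintegral_rpow_mul_le {q p : ℝ} (hq : 2 < q) (hpq : q.HolderConjugate p)
    {f : ℝ → NNReal} (hf : Measurable f) {N : ℝ} (hN : 0 < N)
    (hfN : ∫⁻ s, (f s : ℝ≥0∞) ^ p = ENNReal.ofReal N) (t : ℝ) {a : NNReal} (ha : 0 < a) :
    ∫⁻ s in {s | f s ≤ a}, ENNReal.ofReal (|t - s| ^ (-(2 / q))) * f s ≤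
      ENNReal.ofReal (hlsConst q / 2 * a ^ (p - 1) * N ^ (1 - 2 / q)) := by
  have hq0 : 0 < q := by linarith
  have hp0 : 0 < p := hpq.symm.pos
  have h2q : 2 / q < 1 := (div_lt_one hq0).2 hq
  have h2q0 : 0 < 2 / q := by positivity
  have ha' : (0 : ℝ) < a := ha
  set R : ℝ := N * (a : ℝ) ^ (-p) with hR
  have hR0 : 0 < R := by positivity
  have hK : Measurable fun u : ℝ => ENNReal.ofReal (|u| ^ (-(2 / q))) := by fun_prop
  have hKt : Measurable fun s : ℝ => ENNReal.ofReal (|t - s| ^ (-(2 / q))) := by fun_prop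
  have hm : MeasurableSet {s : ℝ | |t - s| < R} := by
    apply measurableSet_lt <;> fun_prop
  have hpre : {s : ℝ | |t - s| < R} = (fun s => t - s) ⁻¹' {u | |u| < R} := rfl
  have hmp : MeasurePreserving (fun s : ℝ => t - s) volume volume :=
    Measure.measurePreserving_sub_left volume t
  have hme : MeasurableEmbedding (fun s : ℝ => t - s) :=
    (MeasurableEquiv.subLeft t).measurableEmbedding
  have hSm : MeasurableSet {s | f s ≤ a} := measurableSet_le hf measurable_const
  have hnear : ∫⁻ s in {s : ℝ | |t - s| < R}, ENNReal.ofReal (|t - s| ^ (-(2 / q))) * a =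
      ENNReal.ofReal (2 / (1 - 2 / q) * a ^ (p - 1) * N ^ (1 - 2 / q)) := by
    rw [lintegral_mul_const _ hKt, hpre,
      hmp.setLIntegral_comp_preimage_emb hme (fun u => ENNReal.ofReal (|u| ^ (-(2 / q)))),
      lintegral_abs_rpow_lt (by linarith) hR0, ← ENNReal.ofReal_coe_nnreal,
      ← ENNReal.ofReal_mul (by
        have : 0 < -(2 / q) + 1 := by linarith
        positivity)]
    congr 1
    have h1 : -(2 / q) + 1 = 1 - 2 / q := by ring
    have h2 : R ^ (1 - 2 / q) * a = N ^ (1 - 2 / q) * (a : ℝ) ^ (p - 1) := by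
      rw [hR, Real.mul_rpow hN.le (by positivity), ← Real.rpow_mul ha'.le, mul_assoc]
      nth_rewrite 2 [← Real.rpow_one (a : ℝ)]
      rw [← Real.rpow_add ha']
      congr 2
      have := hpq.symm.mul_eq_add
      field_simp
      linarith
    rw [h1, mul_div_right_comm, mul_assoc, h2]
    ring
  have hfar : ∫⁻ s in {s : ℝ | |t - s| < R}ᶜ, ENNReal.ofReal (|t - s| ^ (-(2 / q))) * f s ≤
      ENNReal.ofReal (2 ^ (1 / q) * a ^ (p - 1) * N ^ (1 - 2 / q)) := by
    refine (ENNReal.lintegral_mul_le_Lp_mul_Lq _ hpq hKt.aemeasurable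
      hf.coe_nnreal_ennreal.aemeasurable).trans ?_
    have h1 : ∫⁻ s in {s : ℝ | |t - s| < R}ᶜ, ENNReal.ofReal (|t - s| ^ (-(2 / q))) ^ q =
        ENNReal.ofReal (2 * R ^ (-1 : ℝ)) := by
      have h3 : ∀ s : ℝ, ENNReal.ofReal (|t - s| ^ (-(2 / q))) ^ q =
          ENNReal.ofReal (|t - s| ^ (-2 : ℝ)) := fun s => by
        rw [ENNReal.ofReal_rpow_of_nonneg (by positivity) hq0.le, ← Real.rpow_mul (abs_nonneg _)]
        congr 2
        field_simp
      simp_rw [h3]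
      rw [hpre, ← Set.preimage_compl,
        hmp.setLIntegral_comp_preimage_emb hme (fun u => ENNReal.ofReal (|u| ^ (-2 : ℝ))),
        lintegral_abs_rpow_ge (by norm_num) hR0]
      norm_num
    have h2 : ∫⁻ s in {s : ℝ | |t - s| < R}ᶜ, (f s : ℝ≥0∞) ^ p ≤ ENNReal.ofReal N :=
      (setLIntegral_le_lintegral _ _).trans_eq hfN
    rw [h1]
    refine (mul_le_mul_right (ENNReal.rpow_le_rpow h2 (by positivity)) _).trans_eq ?_
    rw [ENNReal.ofReal_rpow_of_nonneg (by positivity) (by positivity),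
      ENNReal.ofReal_rpow_of_nonneg hN.le (by positivity), ← ENNReal.ofReal_mul (by positivity)]
    congr 1
    have hpq1 : 1 / p = 1 - 1 / q := by
      have := hpq.inv_add_inv_eq_one
      simp only [one_div]
      linarith
    have hR1 : R ^ (-1 : ℝ) = N ^ (-1 : ℝ) * (a : ℝ) ^ p := by
      rw [hR, Real.mul_rpow hN.le (by positivity), ← Real.rpow_mul ha'.le]
      ring_nf
    have hpq2 : p * (1 / q) = p - 1 := by
      have := hpq.symm.mul_eq_add
      field_simp
      linarith
    rw [hR1, Real.mul_rpow zero_le_two (by positivity), Real.mul_rpow (by positivity) (by positivity),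
      ← Real.rpow_mul ha'.le, hpq2, ← Real.rpow_mul hN.le,
      show 1 - 2 / q = -1 * (1 / q) + 1 / p by rw [hpq1]; ring, Real.rpow_add hN]
    ring
  calc ∫⁻ s in {s | f s ≤ a}, ENNReal.ofReal (|t - s| ^ (-(2 / q))) * f s
      ≤ (∫⁻ s in {s : ℝ | |t - s| < R}, ENNReal.ofReal (|t - s| ^ (-(2 / q))) * a) +
        ∫⁻ s in {s : ℝ | |t - s| < R}ᶜ, ENNReal.ofReal (|t - s| ^ (-(2 / q))) * f s := by
        rw [← lintegral_add_compl _ hm, Measure.restrict_restrict hm,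
          Measure.restrict_restrict hm.compl]
        gcongr ?_ + ?_
        · refine (setLIntegral_mono_ae (hKt.mul_const _).aemeasurable
            (Filter.Eventually.of_forall fun s hs => ?_)).trans
            (lintegral_mono_set Set.inter_subset_left)
          gcongr
          exact hs.2
        · exact lintegral_mono_set Set.inter_subset_left
    _ ≤ _ := by
        rw [hnear]
        refine (add_le_add_right hfar _).trans_eq ?_
        rw [← ENNReal.ofReal_add (by
          have : 0 < 1 - 2 / q := by linarith
          positivity) (by positivity), hlsConst]
        congr 1
        ring

/-- The Hardy-Littlewood-Sobolev inequality for the form `∫∫ f(t) f(s) |t - s|^{-2/q}`. By symmetry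
it suffices to integrate over `f s ≤ f t`. -/
theorem hardy_littlewood_sobolev {q p : ℝ} (hq : 2 < q) (hpq : q.HolderConjugate p)
    {f : ℝ → NNReal} (hf : Measurable f) :
    ∫⁻ t, ∫⁻ s, ENNReal.ofReal (|t - s| ^ (-(2 / q))) * (f t * f s) ≤
      ENNReal.ofReal (hlsConst q) * (∫⁻ s, (f s : ℝ≥0∞) ^ p) ^ (2 / p) := by
  have hq0 : 0 < q := by linarith
  have hp0 : 0 < p := hpq.symm.pos
  have h2q : 2 / q < 1 := (div_lt_one hq0).2 hq
  have hC : 0 < hlsConst q := by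
    have : 0 < 1 - 2 / q := by linarith
    rw [hlsConst]
    positivity
  have hfp : Measurable fun s => (f s : ℝ≥0∞) ^ p := hf.coe_nnreal_ennreal.pow_const p
  rcases eq_or_ne (∫⁻ s, (f s : ℝ≥0∞) ^ p) 0 with h0 | h0
  · rw [lintegral_eq_zero_iff hfp] at h0
    refine le_of_eq_of_le (lintegral_eq_zero_of_ae_eq_zero ?_) zero_le
    filter_upwards [h0] with t ht
    have : f t = 0 := by
      have := (ENNReal.rpow_eq_zero_iff_of_pos hp0).1 ht
      exact_mod_cast this
    simp [this]
  rcases eq_or_ne (∫⁻ s, (f s : ℝ≥0∞) ^ p) ⊤ with htop | htop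
  · rw [htop, ENNReal.top_rpow_of_pos (by positivity), ENNReal.mul_top (by simpa using hC)]
    exact le_top
  set N := (∫⁻ s, (f s : ℝ≥0∞) ^ p).toReal with hN
  have hN0 : 0 < N := ENNReal.toReal_pos h0 htop
  have hfN : ∫⁻ s, (f s : ℝ≥0∞) ^ p = ENNReal.ofReal N := (ENNReal.ofReal_toReal htop).symm
  set J : ℝ → ℝ → ℝ≥0∞ := fun t s =>
    {x : ℝ × ℝ | f x.2 ≤ f x.1}.indicator
      (fun x => ENNReal.ofReal (|x.1 - x.2| ^ (-(2 / q))) * (f x.1 * f x.2)) (t, s) with hJ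
  have hJm : Measurable (Function.uncurry J) := by
    have h1 : Measurable fun x : ℝ × ℝ => (f x.1 : ℝ≥0∞) :=
      (hf.comp measurable_fst).coe_nnreal_ennreal
    have h2 : Measurable fun x : ℝ × ℝ => (f x.2 : ℝ≥0∞) :=
      (hf.comp measurable_snd).coe_nnreal_ennreal
    refine Measurable.indicator (Measurable.mul (by fun_prop) (h1.mul h2)) ?_
    exact measurableSet_le (hf.comp measurable_snd) (hf.comp measurable_fst)
  have hhalf : ∫⁻ t, ∫⁻ s, J t s ≤
      ENNReal.ofReal (hlsConst q / 2) * (∫⁻ s, (f s : ℝ≥0∞) ^ p) ^ (2 / p) := by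
    calc ∫⁻ t, ∫⁻ s, J t s
        ≤ ∫⁻ t, ENNReal.ofReal (hlsConst q / 2 * N ^ (1 - 2 / q)) * (f t : ℝ≥0∞) ^ p := by
          refine lintegral_mono fun t => ?_
          rcases eq_or_ne (f t) 0 with hft | hft
          · refine le_of_eq_of_le ?_ zero_le
            simp [hJ, hft, Set.indicator]
          have hft0 : 0 < f t := pos_iff_ne_zero.2 hft
          have h1 : ∀ s, J t s = f t * ({s | f s ≤ f t}.indicator
              (fun s => ENNReal.ofReal (|t - s| ^ (-(2 / q))) * f s) s) := fun s => by
            by_cases hs : f s ≤ f t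
            · simp [hJ, Set.indicator, hs]
              ring
            · simp [hJ, Set.indicator, hs]
          simp_rw [h1]
          rw [lintegral_const_mul' _ _ ENNReal.coe_ne_top,
            lintegral_indicator (measurableSet_le hf measurable_const)]
          refine (mul_le_mul_right (lintegral_rpow_mul_le hq hpq hf hN0 hfN t hft0) _).trans_eq ?_
          have hft' : (0 : ℝ) < f t := hft0
          rw [← ENNReal.ofReal_coe_nnreal, ENNReal.ofReal_rpow_of_nonneg hft'.le hp0.le,
            ← ENNReal.ofReal_mul hft'.le, ← ENNReal.ofReal_mul (by positivity)]
          congr 1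
          have : (f t : ℝ) ^ p = f t * (f t : ℝ) ^ (p - 1) := by
            rw [Real.rpow_sub_one hft'.ne']
            field_simp
          rw [this]
          ring
      _ = _ := by
          rw [lintegral_const_mul _ hfp, hfN, ENNReal.ofReal_rpow_of_nonneg hN0.le (by positivity),
            ← ENNReal.ofReal_mul (by positivity), ← ENNReal.ofReal_mul (by positivity)]
          congr 1
          have h2 : 2 / p = 1 - 2 / q + 1 := by
            have := hpq.inv_add_inv_eq_one
            have h3 : p⁻¹ = 1 - q⁻¹ := by linarith
            rw [div_eq_mul_inv, h3]
            ring
          rw [h2, Real.rpow_add_one hN0.ne', mul_assoc]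
  calc ∫⁻ t, ∫⁻ s, ENNReal.ofReal (|t - s| ^ (-(2 / q))) * (f t * f s)
      ≤ ∫⁻ t, ∫⁻ s, (J t s + J s t) := by
        refine lintegral_mono fun t => lintegral_mono fun s => ?_
        rcases le_total (f s) (f t) with h | h
        · refine le_add_right (le_of_eq ?_)
          simp [hJ, Set.indicator, h]
        · refine le_add_left (le_of_eq ?_)
          simp only [hJ, Set.indicator, Set.mem_ofPred_eq, h, if_true]
          rw [abs_sub_comm, mul_comm (f t : ℝ≥0∞)]
    _ = (∫⁻ t, ∫⁻ s, J t s) + ∫⁻ t, ∫⁻ s, J t s := by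
        have h1 : ∀ t, ∫⁻ s, (J t s + J s t) = (∫⁻ s, J t s) + ∫⁻ s, J s t := fun t =>
          lintegral_add_left (hJm.comp measurable_prodMk_left) _
        simp_rw [h1]
        have hm1 : Measurable fun t => ∫⁻ s, J t s := hJm.lintegral_prod_right'
        rw [lintegral_add_left hm1]
        congr 1
        exact lintegral_lintegral_swap (hJm.comp measurable_swap).aemeasurable
    _ ≤ _ := by
        rw [← two_mul]
        refine (mul_le_mul_right hhalf _).trans_eq ?_
        rw [← mul_assoc, ← ENNReal.ofReal_ofNat, ← ENNReal.ofReal_mul (by norm_num)]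
        congr 2
        ring

/-! ### Interpolation between `L¹ → L^∞` and `L² → L²` -/

section Interpolation

variable {E : Type*} [MeasurableSpace E] {μ : Measure E}

/-- The class `L¹ ∩ L²` of genuine measurable functions. -/
structure IsNice (μ : Measure E) (f : E → ℂ) : Prop where
  measurable : Measurable f
  integrable : Integrable f μ
  memLp : MemLp f 2 μ

theorem IsNice.indicator {f : E → ℂ} (hf : IsNice μ f) {S : Set E} (hS : MeasurableSet S) :
    IsNice μ (S.indicator f) :=
  ⟨hf.measurable.indicator hS, hf.integrable.indicator hS, hf.memLp.indicator hS⟩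

theorem lintegral_enorm_rpow_lt_top {f : E → ℂ} (hf : IsNice μ f) {p : ℝ} (hp : 1 ≤ p)
    (hp2 : p ≤ 2) : ∫⁻ x, ‖f x‖ₑ ^ p ∂μ < ⊤ := by
  have h2 : ∫⁻ x, ‖f x‖ₑ ^ (2 : ℝ) ∂μ < ⊤ := by
    have := lintegral_rpow_enorm_lt_top_of_eLpNorm_lt_top two_ne_zero ENNReal.ofNat_ne_top hf.memLp.2
    simpa using this
  refine lt_of_le_of_lt (lintegral_mono fun x => ?_)
    ((lintegral_add_left hf.measurable.enorm (fun x => ‖f x‖ₑ ^ (2 : ℝ))).trans_lt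
      (ENNReal.add_lt_top.2 ⟨hf.integrable.2, h2⟩))
  rcases le_total ‖f x‖ₑ 1 with h | h
  · refine le_add_right ?_
    calc ‖f x‖ₑ ^ p ≤ ‖f x‖ₑ ^ (1 : ℝ) := ENNReal.rpow_le_rpow_of_exponent_ge h hp
      _ = ‖f x‖ₑ := ENNReal.rpow_one _
  · exact le_add_left (ENNReal.rpow_le_rpow_of_exponent_le h hp2)

/-- The constant lost in the interpolation. -/
def interpConst (r : ℝ) : ℝ := r * (4 * 2 ^ (r - 2) / (r - 2))

/-- Real interpolation on the line of duality. At height `s` the function is split where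
`s |f|^{p-1} = 2 A N`, with `N = ∫ |f|^p`: then the image of the large part is at most `s / 2`, and
the small part is controlled by Chebyshev's inequality. -/
theorem lintegral_rpow_le_of_interpolation [SFinite μ] {T : (E → ℂ) → E → ℂ} {A r p : ℝ}
    (hA : 0 < A) (hr : 2 < r) (hpr : r.HolderConjugate p)
    (hTm : ∀ g, IsNice μ g → Measurable (T g))
    (hadd : ∀ g h, IsNice μ g → IsNice μ h → ∀ x, T (g + h) x = T g x + T h x)
    (hinf : ∀ g, IsNice μ g → ∀ x, ‖T g x‖ₑ ≤ ENNReal.ofReal A * ∫⁻ y, ‖g y‖ₑ ∂μ)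
    (htwo : ∀ g, IsNice μ g → ∫⁻ x, ‖T g x‖ₑ ^ (2 : ℝ) ∂μ ≤ ∫⁻ y, ‖g y‖ₑ ^ (2 : ℝ) ∂μ)
    {f : E → ℂ} (hf : IsNice μ f) :
    ∫⁻ x, ‖T f x‖ₑ ^ r ∂μ ≤
      ENNReal.ofReal (interpConst r * A ^ (r - 2)) * (∫⁻ y, ‖f y‖ₑ ^ p ∂μ) ^ (r - 1) := by
  have hr0 : 0 < r := by linarith
  have hp0 : 0 < p := hpr.symm.pos
  have hp1 : 1 < p := hpr.symm.lt
  have hp1' : 0 < p - 1 := by linarith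
  have hpr' : p * (r - 1) = r := by
    have := hpr.mul_eq_add
    linarith
  have hp2 : p ≤ 2 := by nlinarith
  have hr2 : 0 < r - 2 := by linarith
  have hfp : Measurable fun y => ‖f y‖ₑ ^ p := hf.measurable.enorm.pow_const p
  have hNtop := lintegral_enorm_rpow_lt_top hf hp1.le hp2
  rcases eq_or_ne (∫⁻ y, ‖f y‖ₑ ^ p ∂μ) 0 with h0 | h0
  · have hf0 : f =ᵐ[μ] 0 := by
      rw [lintegral_eq_zero_iff hfp] at h0
      filter_upwards [h0] with y hy
      exact enorm_eq_zero.1 ((ENNReal.rpow_eq_zero_iff_of_pos hp0).1 hy)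
    have hf1 : ∫⁻ y, ‖f y‖ₑ ∂μ = 0 := by
      rw [lintegral_eq_zero_iff hf.measurable.enorm]
      filter_upwards [hf0] with y hy
      simp [hy]
    refine le_of_eq_of_le (lintegral_eq_zero_of_ae_eq_zero ?_) zero_le
    refine Filter.Eventually.of_forall fun x => ?_
    have h := hinf f hf x
    rw [hf1, mul_zero] at h
    have h2 : ‖T f x‖ₑ = 0 := le_antisymm h zero_le
    simp only [Pi.zero_apply]
    rw [h2, ENNReal.zero_rpow_of_pos hr0]
  set N := (∫⁻ y, ‖f y‖ₑ ^ p ∂μ).toReal with hN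
  have hN0 : 0 < N := ENNReal.toReal_pos h0 hNtop.ne
  have hfN : ∫⁻ y, ‖f y‖ₑ ^ p ∂μ = ENNReal.ofReal N := (ENNReal.ofReal_toReal hNtop.ne).symm
  have hnf : Measurable fun y => ‖f y‖ := hf.measurable.norm
  set S : ℝ → Set E := fun s => {y | s * ‖f y‖ ^ (p - 1) ≤ 2 * A * N} with hS
  have hSm : ∀ s, MeasurableSet (S s) := fun s =>
    measurableSet_le ((hnf.pow_const _).const_mul s) measurable_const
  have hlevel : ∀ s, 0 < s → μ {x | s < ‖T f x‖} ≤
      ENNReal.ofReal (4 * s ^ (-2 : ℝ)) * ∫⁻ y in S s, ‖f y‖ₑ ^ (2 : ℝ) ∂μ := by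
    intro s hs
    have hlarge : IsNice μ ((S s)ᶜ.indicator f) := hf.indicator (hSm s).compl
    have hsmall : IsNice μ ((S s).indicator f) := hf.indicator (hSm s)
    have hL1 : ENNReal.ofReal A * ∫⁻ y, ‖(S s)ᶜ.indicator f y‖ₑ ∂μ ≤ ENNReal.ofReal (s / 2) := by
      have h1 : ∀ y, ENNReal.ofReal (2 * A * N) * ‖(S s)ᶜ.indicator f y‖ₑ ≤
          ENNReal.ofReal s * ‖f y‖ₑ ^ p := by
        intro y
        by_cases hy : y ∈ S s
        · simp [hy]
        · rw [Set.indicator_of_mem (show y ∈ (S s)ᶜ from hy), ← ofReal_norm,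
            ENNReal.ofReal_rpow_of_nonneg (norm_nonneg _) hp0.le,
            ← ENNReal.ofReal_mul (by positivity), ← ENNReal.ofReal_mul hs.le]
          apply ENNReal.ofReal_le_ofReal
          have hy' : 2 * A * N < s * ‖f y‖ ^ (p - 1) := not_le.1 hy
          have hfy : ‖f y‖ ≠ 0 := fun h => by
            rw [h, Real.zero_rpow hp1'.ne', mul_zero] at hy'
            have : 0 < 2 * A * N := by positivity
            linarith
          have : ‖f y‖ ^ p = ‖f y‖ ^ (p - 1) * ‖f y‖ := by
            rw [Real.rpow_sub_one hfy]
            field_simp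
          rw [this, ← mul_assoc]
          exact mul_le_mul_of_nonneg_right hy'.le (norm_nonneg _)
      have h2 : ENNReal.ofReal (2 * A * N) * ∫⁻ y, ‖(S s)ᶜ.indicator f y‖ₑ ∂μ ≤
          ENNReal.ofReal (s * N) := by
        rw [← lintegral_const_mul' _ _ ENNReal.ofReal_ne_top]
        refine (lintegral_mono h1).trans_eq ?_
        rw [lintegral_const_mul _ hfp, hfN, ← ENNReal.ofReal_mul hs.le]
      have h3 : ENNReal.ofReal A * ∫⁻ y, ‖(S s)ᶜ.indicator f y‖ₑ ∂μ =
          ENNReal.ofReal (1 / (2 * N)) *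
            (ENNReal.ofReal (2 * A * N) * ∫⁻ y, ‖(S s)ᶜ.indicator f y‖ₑ ∂μ) := by
        rw [← mul_assoc, ← ENNReal.ofReal_mul (by positivity)]
        congr 2
        field_simp
      rw [h3]
      refine (mul_le_mul_right h2 _).trans_eq ?_
      rw [← ENNReal.ofReal_mul (by positivity)]
      congr 1
      field_simp
    have hsub : {x | s < ‖T f x‖} ⊆
        {x | ENNReal.ofReal ((s / 2) ^ (2 : ℝ)) ≤ ‖T ((S s).indicator f) x‖ₑ ^ (2 : ℝ)} := by
      intro x hx
      have hx' : s < ‖T f x‖ := hx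
      have h1 : T f x = T ((S s).indicator f) x + T ((S s)ᶜ.indicator f) x := by
        rw [← hadd _ _ hsmall hlarge, Set.indicator_self_add_compl]
      have h2 : ‖T ((S s)ᶜ.indicator f) x‖ ≤ s / 2 := by
        have := (hinf _ hlarge x).trans hL1
        rwa [← ofReal_norm, ENNReal.ofReal_le_ofReal_iff (by positivity)] at this
      have h3 : s / 2 ≤ ‖T ((S s).indicator f) x‖ := by
        rw [h1] at hx'
        have := norm_add_le (T ((S s).indicator f) x) (T ((S s)ᶜ.indicator f) x)
        linarith
      show ENNReal.ofReal ((s / 2) ^ (2 : ℝ)) ≤ ‖T ((S s).indicator f) x‖ₑ ^ (2 : ℝ)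
      rw [← ofReal_norm, ENNReal.ofReal_rpow_of_nonneg (norm_nonneg _) zero_le_two]
      exact ENNReal.ofReal_le_ofReal (Real.rpow_le_rpow (by positivity) h3 zero_le_two)
    have hcheb := mul_meas_ge_le_lintegral₀ (μ := μ)
      ((hTm _ hsmall).enorm.pow_const (2 : ℝ)).aemeasurable (ENNReal.ofReal ((s / 2) ^ (2 : ℝ)))
    have hind : ∫⁻ y, ‖(S s).indicator f y‖ₑ ^ (2 : ℝ) ∂μ = ∫⁻ y in S s, ‖f y‖ₑ ^ (2 : ℝ) ∂μ := by
      rw [← lintegral_indicator (hSm s)]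
      congr 1
      ext y
      by_cases hy : y ∈ S s <;> simp [hy]
    have hone : ENNReal.ofReal (4 * s ^ (-2 : ℝ)) * ENNReal.ofReal ((s / 2) ^ (2 : ℝ)) = 1 := by
      rw [← ENNReal.ofReal_mul (by positivity), Real.div_rpow hs.le zero_le_two, Real.rpow_neg hs.le,
        ← ENNReal.ofReal_one]
      congr 1
      have : s ^ (2 : ℝ) ≠ 0 := by positivity
      field_simp
      norm_num
    calc μ {x | s < ‖T f x‖}
        ≤ μ {x | ENNReal.ofReal ((s / 2) ^ (2 : ℝ)) ≤ ‖T ((S s).indicator f) x‖ₑ ^ (2 : ℝ)} :=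
          measure_mono hsub
      _ = ENNReal.ofReal (4 * s ^ (-2 : ℝ)) * (ENNReal.ofReal ((s / 2) ^ (2 : ℝ)) *
          μ {x | ENNReal.ofReal ((s / 2) ^ (2 : ℝ)) ≤ ‖T ((S s).indicator f) x‖ₑ ^ (2 : ℝ)}) := by
          rw [← mul_assoc, hone, one_mul]
      _ ≤ _ := by
          gcongr
          exact hcheb.trans ((htwo _ hsmall).trans_eq hind)
  -- the layer-cake integral of the level-set bound, by Tonelli's theorem
  set M : E → ℝ := fun y => 2 * A * N * ‖f y‖ ^ (-(p - 1)) with hM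
  have hinner : ∀ y, ∫⁻ s in Set.Ioi 0, ((S s).indicator (fun y => ‖f y‖ₑ ^ (2 : ℝ)) y) *
      ENNReal.ofReal (4 * s ^ (r - 3)) ≤
        ENNReal.ofReal (4 * (2 * A * N) ^ (r - 2) / (r - 2)) * ‖f y‖ₑ ^ p := by
    intro y
    rcases eq_or_ne (f y) 0 with hy | hy
    · refine le_of_eq_of_le ?_ zero_le
      have : ∀ s, (S s).indicator (fun y => ‖f y‖ₑ ^ (2 : ℝ)) y = 0 := fun s => by
        by_cases h : y ∈ S s <;> simp [h, hy]
      simp only [this, zero_mul, lintegral_zero]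
    have hfy : 0 < ‖f y‖ := norm_pos_iff.2 hy
    have hM0 : 0 < M y := by positivity
    have h1 : ∀ s ∈ Set.Ioi (0 : ℝ), ((S s).indicator (fun y => ‖f y‖ₑ ^ (2 : ℝ)) y) *
        ENNReal.ofReal (4 * s ^ (r - 3)) = (Set.Iic (M y)).indicator
          (fun s => (‖f y‖ₑ ^ (2 : ℝ) * 4) * ENNReal.ofReal (s ^ (r - 3))) s := by
      intro s _
      have hiff : y ∈ S s ↔ s ∈ Set.Iic (M y) := by
        simp only [hS, hM, Set.mem_ofPred_eq, Set.mem_Iic]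
        rw [Real.rpow_neg hfy.le, ← div_eq_mul_inv, le_div_iff₀ (by positivity)]
      by_cases h : y ∈ S s
      · rw [Set.indicator_of_mem h, Set.indicator_of_mem (hiff.1 h),
          ENNReal.ofReal_mul (by norm_num), ENNReal.ofReal_ofNat, mul_assoc]
      · rw [Set.indicator_of_notMem h, Set.indicator_of_notMem (fun h' => h (hiff.2 h')), zero_mul]
    rw [setLIntegral_congr_fun measurableSet_Ioi h1, lintegral_indicator measurableSet_Iic,
      Measure.restrict_restrict measurableSet_Iic, Set.inter_comm, Set.Ioi_inter_Iic,
      setLIntegral_congr Ioo_ae_eq_Ioc.symm, lintegral_const_mul' _ _ (by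
        refine ENNReal.mul_ne_top ?_ ENNReal.ofNat_ne_top
        exact ENNReal.rpow_ne_top_of_nonneg zero_le_two enorm_ne_top),
      lintegral_rpow_lt (by linarith) hM0, ← ofReal_norm,
      ENNReal.ofReal_rpow_of_nonneg hfy.le zero_le_two, ENNReal.ofReal_rpow_of_nonneg hfy.le hp0.le,
      ← ENNReal.ofReal_ofNat, ← ENNReal.ofReal_mul (by positivity),
      ← ENNReal.ofReal_mul (by positivity), ← ENNReal.ofReal_mul (by positivity)]
    refine ENNReal.ofReal_le_ofReal (le_of_eq ?_)
    have h2 : ‖f y‖ ^ (2 : ℝ) * (‖f y‖ ^ (-(p - 1))) ^ (r - 2) = ‖f y‖ ^ p := by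
      rw [← Real.rpow_mul hfy.le, ← Real.rpow_add hfy]
      congr 1
      linear_combination -hpr'
    rw [show r - 3 + 1 = r - 2 by ring, hM, Real.mul_rpow (by positivity) (by positivity), ← h2]
    ring
  have hjoint : Measurable (Function.uncurry fun (s : ℝ) (y : E) =>
      ((S s).indicator (fun y => ‖f y‖ₑ ^ (2 : ℝ)) y) * ENNReal.ofReal (4 * s ^ (r - 3))) := by
    have h1 : (Function.uncurry fun (s : ℝ) (y : E) =>
        ((S s).indicator (fun y => ‖f y‖ₑ ^ (2 : ℝ)) y) * ENNReal.ofReal (4 * s ^ (r - 3))) =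
        fun x : ℝ × E => {x : ℝ × E | x.1 * ‖f x.2‖ ^ (p - 1) ≤ 2 * A * N}.indicator
          (fun x => ‖f x.2‖ₑ ^ (2 : ℝ)) x * ENNReal.ofReal (4 * x.1 ^ (r - 3)) := rfl
    rw [h1]
    refine Measurable.mul (Measurable.indicator ?_ ?_) (by fun_prop)
    · exact (hf.measurable.comp measurable_snd).enorm.pow_const _
    · exact measurableSet_le (measurable_fst.mul ((hnf.comp measurable_snd).pow_const _))
        measurable_const
  have hlhs : ∫⁻ x, ‖T f x‖ₑ ^ r ∂μ = ∫⁻ x, ENNReal.ofReal (‖T f x‖ ^ r) ∂μ := by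
    congr 1
    ext x
    rw [← ofReal_norm, ENNReal.ofReal_rpow_of_nonneg (norm_nonneg _) hr0.le]
  rw [hlhs, lintegral_rpow_eq_lintegral_meas_lt_mul μ
    (Filter.Eventually.of_forall fun x => norm_nonneg _) (hTm f hf).norm.aemeasurable hr0]
  calc ENNReal.ofReal r * ∫⁻ s in Set.Ioi 0, μ {x | s < ‖T f x‖} * ENNReal.ofReal (s ^ (r - 1))
      ≤ ENNReal.ofReal r * ∫⁻ s in Set.Ioi 0, ∫⁻ y,
        ((S s).indicator (fun y => ‖f y‖ₑ ^ (2 : ℝ)) y) * ENNReal.ofReal (4 * s ^ (r - 3)) ∂μ := by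
        gcongr ENNReal.ofReal r * ?_
        refine setLIntegral_mono' measurableSet_Ioi fun s hs => ?_
        have hs0 : (0 : ℝ) < s := hs
        refine (mul_le_mul_left (hlevel s hs) _).trans_eq ?_
        rw [lintegral_mul_const' _ _ ENNReal.ofReal_ne_top, lintegral_indicator (hSm s), mul_right_comm,
          mul_comm, ← ENNReal.ofReal_mul (by positivity)]
        congr 2
        rw [mul_assoc, ← Real.rpow_add hs0]
        congr 2
        ring
    _ = ENNReal.ofReal r * ∫⁻ y, (∫⁻ s in Set.Ioi 0,
        ((S s).indicator (fun y => ‖f y‖ₑ ^ (2 : ℝ)) y) * ENNReal.ofReal (4 * s ^ (r - 3))) ∂μ := by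
        rw [lintegral_lintegral_swap hjoint.aemeasurable]
    _ ≤ ENNReal.ofReal r * ∫⁻ y,
        ENNReal.ofReal (4 * (2 * A * N) ^ (r - 2) / (r - 2)) * ‖f y‖ₑ ^ p ∂μ := by
        gcongr ENNReal.ofReal r * ?_
        exact lintegral_mono hinner
    _ = _ := by
        rw [lintegral_const_mul _ hfp, hfN, ENNReal.ofReal_rpow_of_nonneg hN0.le (by linarith),
          ← ENNReal.ofReal_mul (by positivity), ← ENNReal.ofReal_mul hr0.le,
          ← ENNReal.ofReal_mul (by rw [interpConst]; positivity), interpConst]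
        congr 1
        have h1 : N ^ (r - 1) = N ^ (r - 2) * N := by
          rw [← Real.rpow_add_one hN0.ne']
          congr 1
          ring
        rw [Real.mul_rpow (by positivity) hN0.le, Real.mul_rpow zero_le_two hA.le, h1]
        ring

end Interpolation

/-! ### Fourier integrals of functions in `L¹ ∩ L²` -/

section Fourier

variable {V : Type*} [NormedAddCommGroup V] [InnerProductSpace ℝ V] [FiniteDimensional ℝ V]
  [MeasurableSpace V] [BorelSpace V]

theorem continuous_fourier {f : V → ℂ} (hf : Integrable f) : Continuous (𝓕 f) :=
  VectorFourier.fourierIntegral_continuous Real.continuous_fourierChar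
    (by exact continuous_inner) hf

theorem fourierInv_eq_comp_neg (f : V → ℂ) : 𝓕⁻ f = fun x => 𝓕 f (-x) :=
  funext fun x => Real.fourierInv_eq_fourier_neg f x

theorem continuous_fourierInv {f : V → ℂ} (hf : Integrable f) : Continuous (𝓕⁻ f) := by
  rw [fourierInv_eq_comp_neg]
  exact (continuous_fourier hf).comp continuous_neg

theorem norm_fourier_le (f : V → ℂ) (x : V) : ‖𝓕 f x‖ ≤ ∫ y, ‖f y‖ :=
  VectorFourier.norm_fourierIntegral_le_integral_norm _ _ _ _ _

theorem norm_fourierInv_le (f : V → ℂ) (x : V) : ‖𝓕⁻ f x‖ ≤ ∫ y, ‖f y‖ := by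
  rw [Real.fourierInv_eq_fourier_neg]
  exact norm_fourier_le f _

theorem integral_fourier_mul_eq {f g : V → ℂ} (hf : Integrable f) (hg : Integrable g) :
    ∫ x, 𝓕 f x * g x = ∫ x, f x * 𝓕 g x := by
  have h := VectorFourier.integral_fourierIntegral_smul_eq_flip (L := innerₗ V)
    (μ := volume) (ν := volume) Real.continuous_fourierChar continuous_inner hf hg
  rw [flip_innerₗ] at h
  exact h

theorem integral_fourierInv_mul_eq {f g : V → ℂ} (hf : Integrable f) (hg : Integrable g) :
    ∫ x, 𝓕⁻ f x * g x = ∫ x, f x * 𝓕⁻ g x := by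
  rw [Real.fourierInv_eq_fourier_comp_neg f, integral_fourier_mul_eq hf.comp_neg hg,
    ← integral_neg_eq_self]
  simp_rw [neg_neg, fourierInv_eq_comp_neg g]

theorem ae_eq_of_toTemperedDistribution_apply_eq {g : Lp (α := V) ℂ 2 volume} {G : V → ℂ}
    (hG : Continuous G) (h : ∀ φ : 𝓢(V, ℂ), (g : 𝓢'(V, ℂ)) φ = ∫ x, φ x * G x) :
    g =ᵐ[volume] G := by
  refine ae_eq_of_integral_contDiff_smul_eq ((Lp.memLp g).locallyIntegrable (by norm_num))
    hG.locallyIntegrable fun ψ hψ hψc => ?_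
  have hg₁ : HasCompactSupport (Complex.ofRealCLM ∘ ψ) := hψc.comp_left rfl
  have hg₂ : ContDiff ℝ ∞ (Complex.ofRealCLM ∘ ψ) := by fun_prop
  have := h (hg₁.toSchwartzMap hg₂)
  rw [Lp.toTemperedDistribution_apply] at this
  simpa using this

/-- On `L¹ ∩ L²` the `L²` inverse Fourier transform is the inverse Fourier integral. -/
theorem fourierInv_toLp_ae_eq {h : V → ℂ} (h1 : Integrable h) (h2 : MemLp h 2) :
    (𝓕⁻ (h2.toLp) : Lp (α := V) ℂ 2 volume) =ᵐ[volume] 𝓕⁻ h := by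
  refine ae_eq_of_toTemperedDistribution_apply_eq (continuous_fourierInv h1) fun φ => ?_
  rw [← Lp.fourierInv_toTemperedDistribution_eq, TemperedDistribution.fourierInv_apply,
    Lp.toTemperedDistribution_apply, ← integral_fourierInv_mul_eq φ.integrable h1]
  refine integral_congr_ae ?_
  filter_upwards [h2.coeFn_toLp] with x hx
  rw [hx, smul_eq_mul, SchwartzMap.fourierInv_coe]

theorem eLpNorm_fourierInv_eq {h : V → ℂ} (h1 : Integrable h) (h2 : MemLp h 2) :
    eLpNorm (𝓕⁻ h) 2 volume = eLpNorm h 2 volume := by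
  rw [← eLpNorm_congr_ae (fourierInv_toLp_ae_eq h1 h2), ← eLpNorm_congr_ae h2.coeFn_toLp,
    ← Lp.enorm_def, ← Lp.enorm_def, enorm_eq_iff_norm_eq]
  have := Lp.norm_fourier_eq (𝓕⁻ (h2.toLp) : Lp (α := V) ℂ 2 volume)
  rw [FourierTransform.fourier_fourierInv_eq] at this
  exact this.symm

theorem eLpNorm_fourier_eq {h : V → ℂ} (h1 : Integrable h) (h2 : MemLp h 2) :
    eLpNorm (𝓕 h) 2 volume = eLpNorm h 2 volume := by
  rw [← eLpNorm_fourierInv_eq h1 h2, fourierInv_eq_comp_neg]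
  exact (eLpNorm_comp_measurePreserving (continuous_fourier h1).aestronglyMeasurable
    (Measure.measurePreserving_neg volume)).symm

theorem lintegral_enorm_sq_eq_eLpNorm (f : V → ℂ) :
    ∫⁻ x, ‖f x‖ₑ ^ (2 : ℝ) = eLpNorm f 2 volume ^ (2 : ℝ) := by
  rw [eLpNorm_eq_lintegral_rpow_enorm_toReal two_ne_zero ENNReal.ofNat_ne_top, ← ENNReal.rpow_mul]
  simp

end Fourier

/-! ### The localized propagator -/

theorem volume_annulus_lt_top (d : ℕ) (L : ℝ) : volume (annulus d L) < ⊤ := by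
  have hb : Bornology.IsBounded (annulus d L) := by
    refine (Metric.isBounded_closedBall (x := (0 : Space d)) (r := L / π)).subset fun ξ hξ => ?_
    have h : ‖(2 * π) • ξ‖ ≤ 2 * L := hξ.2
    rw [norm_smul, Real.norm_eq_abs, abs_of_pos (by positivity)] at h
    rw [mem_closedBall_zero_iff, le_div_iff₀ Real.pi_pos]
    linarith
  exact hb.measure_lt_top

/-- The Fourier symbol `1_A(ξ) e^{-i t m(2πξ)}`. -/
def symbol (d : ℕ) (L t : ℝ) : Space d → ℂ :=
  (annulus d L).indicator fun ξ => Complex.exp (Complex.I * (-(t * dispersion d ((2 * π) • ξ)) : ℝ))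

theorem measurable_symbol (d : ℕ) (L t : ℝ) : Measurable (symbol d L t) := by
  have h := (measurable_dispersion d).comp (measurable_const_smul (α := Space d) (2 * π))
  refine Measurable.indicator ?_ (isClosed_annulus d L).measurableSet
  exact Complex.measurable_exp.comp ((Complex.measurable_ofReal.comp (h.const_mul t).neg).const_mul _)

theorem norm_symbol_le (d : ℕ) (L t : ℝ) (ξ : Space d) : ‖symbol d L t ξ‖ ≤ 1 := by
  rw [symbol]
  by_cases h : ξ ∈ annulus d L
  · rw [Set.indicator_of_mem h, norm_exp_I_mul]
  · rw [Set.indicator_of_notMem h, norm_zero]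
    exact zero_le_one

theorem integrable_symbol (d : ℕ) (L t : ℝ) : Integrable (symbol d L t) := by
  rw [symbol, integrable_indicator_iff (isClosed_annulus d L).measurableSet]
  have h := (measurable_dispersion d).comp (measurable_const_smul (α := Space d) (2 * π))
  refine Measure.integrableOn_of_bounded (M := 1) (volume_annulus_lt_top d L).ne ?_ ?_
  · exact (Complex.measurable_exp.comp ((Complex.measurable_ofReal.comp
      (h.const_mul t).neg).const_mul _)).aestronglyMeasurable
  · exact Filter.Eventually.of_forall fun ξ => (norm_exp_I_mul _).le

/-- The frequency-localized group `1_A(D) e^{-i t m(D)}` on functions. The roles of `𝓕` and `𝓕⁻`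
are exchanged, which reflects the frequency; this is the form that occurs in `T T*`. -/
def propagator (d : ℕ) (L t : ℝ) (f : Space d → ℂ) : Space d → ℂ :=
  𝓕 fun ξ => symbol d L t ξ * 𝓕⁻ f ξ

theorem integrable_symbol_mul (d : ℕ) (L t : ℝ) {f : Space d → ℂ} (hf : Integrable f) :
    Integrable fun ξ => symbol d L t ξ * 𝓕⁻ f ξ :=
  (integrable_symbol d L t).mul_bdd (c := ∫ y, ‖f y‖)
    (continuous_fourierInv hf).aestronglyMeasurable
    (Filter.Eventually.of_forall (norm_fourierInv_le f))

theorem memLp_symbol_mul (d : ℕ) (L t : ℝ) {f : Space d → ℂ} (hf : Integrable f)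
    (hf2 : MemLp f 2) :
    MemLp (fun ξ => symbol d L t ξ * 𝓕⁻ f ξ) 2 ∧
      eLpNorm (fun ξ => symbol d L t ξ * 𝓕⁻ f ξ) 2 volume ≤ eLpNorm f 2 volume := by
  have hle : eLpNorm (fun ξ => symbol d L t ξ * 𝓕⁻ f ξ) 2 volume ≤ eLpNorm f 2 volume := by
    rw [← eLpNorm_fourierInv_eq hf hf2]
    refine eLpNorm_mono fun ξ => ?_
    rw [norm_mul]
    exact mul_le_of_le_one_left (norm_nonneg _) (norm_symbol_le d L t ξ)
  exact ⟨⟨(integrable_symbol_mul d L t hf).aestronglyMeasurable, hle.trans_lt hf2.2⟩, hle⟩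

theorem propagator_add (d : ℕ) (L t : ℝ) {f g : Space d → ℂ} (hf : Integrable f)
    (hg : Integrable g) (x : Space d) :
    propagator d L t (f + g) x = propagator d L t f x + propagator d L t g x := by
  have h1 : 𝓕⁻ (f + g) = 𝓕⁻ f + 𝓕⁻ g := by
    ext ξ
    simp only [fourierInv_eq_comp_neg, Pi.add_apply]
    exact congrFun (VectorFourier.fourierIntegral_add Real.continuous_fourierChar
      (by exact continuous_inner) hf hg) _
  have h2 : (fun ξ => symbol d L t ξ * 𝓕⁻ (f + g) ξ) =
      (fun ξ => symbol d L t ξ * 𝓕⁻ f ξ) + fun ξ => symbol d L t ξ * 𝓕⁻ g ξ := by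
    ext ξ
    rw [h1, Pi.add_apply, Pi.add_apply, mul_add]
  rw [propagator, h2]
  exact congrFun (VectorFourier.fourierIntegral_add Real.continuous_fourierChar
    (by exact continuous_inner) (integrable_symbol_mul d L t hf) (integrable_symbol_mul d L t hg)) _

theorem lintegral_propagator_sq_le (d : ℕ) (L t : ℝ) {f : Space d → ℂ} (hf : Integrable f)
    (hf2 : MemLp f 2) :
    ∫⁻ x, ‖propagator d L t f x‖ₑ ^ (2 : ℝ) ≤ ∫⁻ x, ‖f x‖ₑ ^ (2 : ℝ) := by
  obtain ⟨h2, hle⟩ := memLp_symbol_mul d L t hf hf2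
  rw [lintegral_enorm_sq_eq_eLpNorm, lintegral_enorm_sq_eq_eLpNorm, propagator,
    eLpNorm_fourier_eq (integrable_symbol_mul d L t hf) h2]
  exact ENNReal.rpow_le_rpow hle zero_le_two

theorem propagator_eq_integral_kernel (d : ℕ) (L t : ℝ) {f : Space d → ℂ} (hf : Integrable f)
    (y : Space d) : propagator d L t f y = ∫ x, f x * kernel d L t (x - y) := by
  have hphase : Integrable fun ξ : Space d =>
      Complex.exp (Complex.I * (-(2 * π * inner ℝ y ξ) : ℝ)) * symbol d L t ξ := by
    refine (integrable_symbol d L t).bdd_mul (c := 1) ?_ ?_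
    · exact Continuous.aestronglyMeasurable (by fun_prop)
    · exact Filter.Eventually.of_forall fun ξ => (norm_exp_I_mul _).le
  have h1 : propagator d L t f y = ∫ ξ, 𝓕⁻ f ξ *
      (Complex.exp (Complex.I * (-(2 * π * inner ℝ y ξ) : ℝ)) * symbol d L t ξ) := by
    rw [propagator, Real.fourier_eq']
    congr 1
    ext ξ
    rw [smul_eq_mul, real_inner_comm, mul_comm (_ : ℂ) Complex.I]
    ring_nf
  rw [h1, integral_fourierInv_mul_eq hf hphase]
  congr 1
  ext x
  congr 1
  rw [Real.fourierInv_eq', kernel, ← integral_indicator (isClosed_annulus d L).measurableSet]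
  congr 1
  ext ξ
  rw [symbol]
  by_cases h : ξ ∈ annulus d L
  · rw [Set.indicator_of_mem h, Set.indicator_of_mem h, smul_eq_mul, ← Complex.exp_add,
      ← Complex.exp_add, inner_sub_left, real_inner_comm x ξ]
    congr 1
    push_cast
    ring
  · rw [Set.indicator_of_notMem h, Set.indicator_of_notMem h, mul_zero, smul_zero]

theorem enorm_propagator_le {d : ℕ} {L t A : ℝ} (hA : ∀ x, ‖kernel d L t x‖ ≤ A)
    {f : Space d → ℂ} (hf : Integrable f) (y : Space d) :
    ‖propagator d L t f y‖ₑ ≤ ENNReal.ofReal A * ∫⁻ x, ‖f x‖ₑ := by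
  rw [propagator_eq_integral_kernel d L t hf, ← lintegral_const_mul' _ _ ENNReal.ofReal_ne_top]
  refine (enorm_integral_le_lintegral_enorm _).trans (lintegral_mono fun x => ?_)
  rw [enorm_mul, mul_comm]
  gcongr
  rw [← ofReal_norm]
  exact ENNReal.ofReal_le_ofReal (hA _)

/-- The interpolated dispersive estimate `L^{r'} → L^r`. -/
theorem lintegral_propagator_rpow_le {d : ℕ} {L t A r p : ℝ} (hA0 : 0 < A)
    (hA : ∀ x, ‖kernel d L t x‖ ≤ A) (hr : 2 < r) (hpr : r.HolderConjugate p)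
    {f : Space d → ℂ} (hf : IsNice volume f) :
    ∫⁻ x, ‖propagator d L t f x‖ₑ ^ r ≤
      ENNReal.ofReal (interpConst r * A ^ (r - 2)) * (∫⁻ y, ‖f y‖ₑ ^ p) ^ (r - 1) :=
  lintegral_rpow_le_of_interpolation hA0 hr hpr
    (fun _ hg => (continuous_fourier (integrable_symbol_mul d L t hg.integrable)).measurable)
    (fun _ _ hg hh x => propagator_add d L t hg.integrable hh.integrable x)
    (fun _ hg => enorm_propagator_le hA hg.integrable)
    (fun _ hg => lintegral_propagator_sq_le d L t hg.integrable hg.memLp) hf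

/-! ### The dual Strichartz estimate -/

theorem conj_fourierInv {d : ℕ} (g : Space d → ℂ) (ξ : Space d) :
    (starRingEnd ℂ) (𝓕⁻ g ξ) = 𝓕 (fun x => (starRingEnd ℂ) (g x)) ξ := by
  rw [Real.fourierInv_eq', Real.fourier_eq', ← integral_conj]
  congr 1
  ext x
  rw [smul_eq_mul, smul_eq_mul, map_mul, ← Complex.exp_conj, map_mul, Complex.conj_I,
    Complex.conj_ofReal]
  congr 2
  push_cast
  ring

theorem integral_symbol_mul_conj_eq {d : ℕ} (L t : ℝ) {f g : Space d → ℂ} (hf : Integrable f)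
    (hg : Integrable g) :
    ∫ ξ, symbol d L t ξ * 𝓕⁻ f ξ * (starRingEnd ℂ) (𝓕⁻ g ξ) =
      ∫ y, propagator d L t f y * (starRingEnd ℂ) (g y) := by
  simp_rw [conj_fourierInv]
  have hgc : Integrable fun x => (starRingEnd ℂ) (g x) :=
    (LinearIsometryEquiv.integrable_comp_iff Complex.conjLIE).2 hg
  rw [← integral_fourier_mul_eq (integrable_symbol_mul d L t hf) hgc]
  rfl

/-- The dispersive estimate for the bilinear form, with `p = r'`; for `p = 1` no interpolation is
needed. -/
theorem exists_enorm_form_le {p : ℝ} (hp : 1 ≤ p) (hp2 : p < 2) :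
    ∃ C : ℝ, 0 < C ∧ ∀ (d : ℕ) (L t A : ℝ), 0 < A → (∀ x, ‖kernel d L t x‖ ≤ A) →
      ∀ f g : Space d → ℂ, IsNice volume f → IsNice volume g →
        ‖∫ ξ, symbol d L t ξ * 𝓕⁻ f ξ * (starRingEnd ℂ) (𝓕⁻ g ξ)‖ₑ ≤
          ENNReal.ofReal (C * A ^ (2 / p - 1)) * ((∫⁻ x, ‖f x‖ₑ ^ p) ^ (1 / p) *
            (∫⁻ x, ‖g x‖ₑ ^ p) ^ (1 / p)) := by
  have key : ∀ (d : ℕ) (L t : ℝ) (f g : Space d → ℂ), IsNice volume f → IsNice volume g →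
      ‖∫ ξ, symbol d L t ξ * 𝓕⁻ f ξ * (starRingEnd ℂ) (𝓕⁻ g ξ)‖ₑ ≤
        ∫⁻ y, ‖propagator d L t f y‖ₑ * ‖g y‖ₑ := by
    intro d L t f g hf hg
    rw [integral_symbol_mul_conj_eq L t hf.integrable hg.integrable]
    refine (enorm_integral_le_lintegral_enorm _).trans_eq ?_
    congr 1
    ext y
    rw [enorm_mul, ← ofReal_norm ((starRingEnd ℂ) (g y)), Complex.norm_conj, ofReal_norm]
  rcases hp.eq_or_lt with rfl | hp1
  · refine ⟨1, one_pos, fun d L t A hA0 hA f g hf hg => (key d L t f g hf hg).trans ?_⟩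
    simp only [ENNReal.rpow_one, div_one, one_mul]
    norm_num
    rw [← mul_assoc, ← lintegral_const_mul _ hg.measurable.enorm]
    gcongr
    exact enorm_propagator_le hA hf.integrable _
  · have hp0 : 0 < p := by linarith
    set r := p / (p - 1) with hr
    have hpr : p.HolderConjugate r := Real.HolderConjugate.conjExponent hp1
    have hp1' : 0 < p - 1 := by linarith
    have hr2 : 2 < r := by
      rw [hr, lt_div_iff₀ hp1']
      linarith
    have hr0 : 0 < r := by linarith
    have hC : 0 < interpConst r := by
      have : 0 < r - 2 := by linarith
      rw [interpConst]
      positivity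
    have hir : 1 / r = 1 - 1 / p := by
      have := hpr.inv_add_inv_eq_one
      simp only [one_div]
      linarith
    refine ⟨interpConst r ^ (1 / r), by positivity, fun d L t A hA0 hA f g hf hg =>
      (key d L t f g hf hg).trans ?_⟩
    refine (ENNReal.lintegral_mul_le_Lp_mul_Lq _ hpr.symm
      (continuous_fourier (integrable_symbol_mul d L t hf.integrable)).measurable.enorm.aemeasurable
      hg.measurable.enorm.aemeasurable).trans ?_
    rw [← mul_assoc]
    gcongr
    refine (ENNReal.rpow_le_rpow (lintegral_propagator_rpow_le hA0 hA hr2 hpr.symm hf)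
      (by positivity)).trans_eq ?_
    rw [ENNReal.mul_rpow_of_nonneg _ _ (by positivity),
      ENNReal.ofReal_rpow_of_nonneg (by positivity) (by positivity), ← ENNReal.rpow_mul,
      Real.mul_rpow hC.le (by positivity), ← Real.rpow_mul hA0.le]
    have h1 : (r - 2) * (1 / r) = 2 / p - 1 := by
      have : (r - 2) * (1 / r) = 1 - 2 * (1 / r) := by field_simp
      rw [this, hir]
      ring
    have h2 : (r - 1) * (1 / r) = 1 / p := by
      have : (r - 1) * (1 / r) = 1 - 1 / r := by field_simp
      rw [this, hir]
      ring
    rw [h1, h2]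

/-- Bounded measurable functions of `(t, x)` with bounded support, the test functions for the
duality argument. -/
structure IsTest {d : ℕ} (F : ℝ → Space d → ℂ) : Prop where
  measurable : Measurable (Function.uncurry F)
  bounded : ∃ M, ∀ t x, ‖F t x‖ ≤ M
  support : ∃ R, ∀ t x, R < |t| ∨ R < ‖x‖ → F t x = 0

namespace IsTest

variable {d : ℕ} {F : ℝ → Space d → ℂ}

/-- A test function is dominated by a multiple of the indicator of a product of balls. -/
theorem exists_bound (hF : IsTest F) : ∃ M R : ℝ, 0 ≤ M ∧ ∀ t x,
    ‖F t x‖ ≤ (Set.Icc (-R) R).indicator (fun _ => M) t *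
      (Metric.closedBall (0 : Space d) R).indicator (fun _ => 1) x := by
  obtain ⟨M, hM⟩ := hF.bounded
  obtain ⟨R, hR⟩ := hF.support
  refine ⟨max M 0, R, le_max_right _ _, fun t x => ?_⟩
  by_cases ht : t ∈ Set.Icc (-R) R
  · by_cases hx : x ∈ Metric.closedBall (0 : Space d) R
    · rw [Set.indicator_of_mem ht, Set.indicator_of_mem hx, mul_one]
      exact (hM t x).trans (le_max_left _ _)
    · rw [Set.indicator_of_notMem hx, hR t x (Or.inr (by simpa using hx)), norm_zero, mul_zero]
  · rw [Set.indicator_of_notMem ht, hR t x (Or.inl (by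
      rw [← not_le, abs_le]
      exact ht)), norm_zero, zero_mul]

theorem measurable_right (hF : IsTest F) (t : ℝ) : Measurable (F t) :=
  hF.measurable.comp measurable_prodMk_left

theorem isNice (hF : IsTest F) (t : ℝ) : IsNice volume (F t) := by
  obtain ⟨M, R, hM, h⟩ := hF.exists_bound
  have hm := hF.measurable_right t
  have hb : ∀ x, ‖F t x‖ ≤ ‖(Metric.closedBall (0 : Space d) R).indicator (fun _ => M) x‖ := by
    intro x
    refine (h t x).trans ?_
    by_cases hx : x ∈ Metric.closedBall (0 : Space d) R
    · rw [Set.indicator_of_mem hx, Set.indicator_of_mem hx, mul_one, Real.norm_of_nonneg hM]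
      exact Set.indicator_le_self' (fun _ _ => hM) t
    · rw [Set.indicator_of_notMem hx, Set.indicator_of_notMem hx, mul_zero, norm_zero]
  have hfin : volume (Metric.closedBall (0 : Space d) R) ≠ ⊤ := measure_closedBall_lt_top.ne
  refine ⟨hm, ?_, ?_⟩
  · exact Integrable.mono ((integrable_indicator_iff measurableSet_closedBall).2
      (integrableOn_const hfin)) hm.aestronglyMeasurable (Filter.Eventually.of_forall hb)
  · exact MemLp.of_le (memLp_indicator_const 2 measurableSet_closedBall M (Or.inr hfin))
      hm.aestronglyMeasurable (Filter.Eventually.of_forall hb)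

/-- The spatial norm of a test function at a given time. -/
def slice (F : ℝ → Space d → ℂ) (p : ℝ) (t : ℝ) : ℝ≥0∞ := (∫⁻ x, ‖F t x‖ₑ ^ p) ^ (1 / p)

theorem measurable_slice (hF : IsTest F) (p : ℝ) : Measurable (slice F p) := by
  have : Measurable (Function.uncurry fun t x => ‖F t x‖ₑ ^ p) := hF.measurable.enorm.pow_const p
  exact (Measurable.lintegral_prod_right' this).pow_const _

theorem slice_ne_top (hF : IsTest F) {p : ℝ} (hp : 1 ≤ p) (hp2 : p ≤ 2) (t : ℝ) :
    slice F p t ≠ ⊤ :=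
  ENNReal.rpow_ne_top_of_nonneg (by positivity)
    (lintegral_enorm_rpow_lt_top (hF.isNice t) hp hp2).ne

theorem measurable_fourierInv (hF : IsTest F) :
    Measurable (Function.uncurry fun (t : ℝ) (ξ : Space d) => 𝓕⁻ (F t) ξ) := by
  have h1 : (Function.uncurry fun (t : ℝ) (ξ : Space d) => 𝓕⁻ (F t) ξ) = fun z : ℝ × Space d =>
      ∫ x, Complex.exp ((2 * π * inner ℝ x z.2 : ℝ) * Complex.I) • F z.1 x := by
    ext z
    rw [Function.uncurry, Real.fourierInv_eq']
  rw [h1]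
  refine StronglyMeasurable.measurable ?_
  refine StronglyMeasurable.integral_prod_right' (f := fun w : (ℝ × Space d) × Space d =>
    Complex.exp ((2 * π * inner ℝ w.2 w.1.2 : ℝ) * Complex.I) • F w.1.1 w.2) ?_
  refine Measurable.stronglyMeasurable (Measurable.fun_smul ?_ ?_)
  · exact Continuous.measurable (by fun_prop)
  · exact hF.measurable.comp ((measurable_fst.comp measurable_fst).prodMk measurable_snd)

end IsTest

/-- The adjoint of the localized group applied to a test function, on the Fourier side. -/
def adjoint {d : ℕ} (L σ : ℝ) (F : ℝ → Space d → ℂ) (ξ : Space d) : ℂ :=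
  ∫ t, symbol d L (σ * t) ξ * 𝓕⁻ (F t) ξ

theorem symbol_mul_conj (d : ℕ) (L s t : ℝ) (ξ : Space d) :
    symbol d L t ξ * (starRingEnd ℂ) (symbol d L s ξ) = symbol d L (t - s) ξ := by
  rw [symbol, symbol, symbol]
  by_cases h : ξ ∈ annulus d L
  · rw [Set.indicator_of_mem h, Set.indicator_of_mem h, Set.indicator_of_mem h,
      ← Complex.exp_conj, map_mul, Complex.conj_I, Complex.conj_ofReal, ← Complex.exp_add]
    congr 1
    push_cast
    ring
  · simp only [Set.indicator_of_notMem h, zero_mul]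

theorem measurable_symbol_uncurry (d : ℕ) (L σ : ℝ) :
    Measurable fun z : ℝ × Space d => symbol d L (σ * z.1) z.2 := by
  have h := (measurable_dispersion d).comp (measurable_const_smul (α := Space d) (2 * π))
  have h1 : (fun z : ℝ × Space d => symbol d L (σ * z.1) z.2) =
      (Prod.snd ⁻¹' annulus d L).indicator fun z => Complex.exp
        (Complex.I * (-(σ * z.1 * dispersion d ((2 * π) • z.2)) : ℝ)) := by
    ext z
    rw [symbol]
    by_cases hz : z.2 ∈ annulus d L
    · rw [Set.indicator_of_mem hz, Set.indicator_of_mem (show z ∈ Prod.snd ⁻¹' annulus d L from hz)]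
    · rw [Set.indicator_of_notMem hz,
        Set.indicator_of_notMem (show z ∉ Prod.snd ⁻¹' annulus d L from hz)]
  rw [h1]
  refine Measurable.indicator ?_ (measurable_snd (isClosed_annulus d L).measurableSet)
  refine Complex.measurable_exp.comp ((Complex.measurable_ofReal.comp ?_).const_mul _)
  exact (((measurable_fst.const_mul σ).mul (h.comp measurable_snd))).neg

namespace IsTest

variable {d : ℕ} {F : ℝ → Space d → ℂ}

theorem measurable_integrand (hF : IsTest F) (L σ : ℝ) :
    Measurable fun z : ℝ × Space d => symbol d L (σ * z.1) z.2 * 𝓕⁻ (F z.1) z.2 :=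
  (measurable_symbol_uncurry d L σ).mul hF.measurable_fourierInv

/-- The integrand of `adjoint` is dominated by a multiple of the indicator of a bounded set. -/
theorem exists_integrand_bound (hF : IsTest F) (L σ : ℝ) : ∃ R M : ℝ, 0 ≤ M ∧ ∀ t ξ,
    ‖symbol d L (σ * t) ξ * 𝓕⁻ (F t) ξ‖ ≤
      (Set.Icc (-R) R).indicator (fun _ => M) t * (annulus d L).indicator (fun _ => 1) ξ := by
  obtain ⟨M, R, hM, h⟩ := hF.exists_bound
  have hfin : volume (Metric.closedBall (0 : Space d) R) ≠ ⊤ := measure_closedBall_lt_top.ne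
  refine ⟨R, M * volume.real (Metric.closedBall (0 : Space d) R), by positivity, fun t ξ => ?_⟩
  by_cases hξ : ξ ∈ annulus d L
  · rw [Set.indicator_of_mem hξ, mul_one, norm_mul]
    refine (mul_le_of_le_one_left (norm_nonneg _) (norm_symbol_le _ _ _ _)).trans
      ((norm_fourierInv_le _ _).trans ?_)
    refine (integral_mono (hF.isNice t).integrable.norm ?_ (h t)).trans_eq ?_
    · exact ((integrable_indicator_iff measurableSet_closedBall).2
        (integrableOn_const hfin)).const_mul _
    · rw [integral_const_mul, integral_indicator measurableSet_closedBall, setIntegral_const,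
        smul_eq_mul, mul_one]
      by_cases ht : t ∈ Set.Icc (-R) R
      · rw [Set.indicator_of_mem ht, Set.indicator_of_mem ht]
      · rw [Set.indicator_of_notMem ht, Set.indicator_of_notMem ht, zero_mul]
  · rw [symbol, Set.indicator_of_notMem hξ, Set.indicator_of_notMem hξ, mul_zero, zero_mul,
      norm_zero]

theorem measurable_adjoint (hF : IsTest F) (L σ : ℝ) : Measurable (adjoint L σ F) :=
  (StronglyMeasurable.integral_prod_left'
    (f := fun z : ℝ × Space d => symbol d L (σ * z.1) z.2 * 𝓕⁻ (F z.1) z.2)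
    (hF.measurable_integrand L σ).stronglyMeasurable).measurable

theorem integrable_dominating_prod (d : ℕ) (L R M : ℝ) :
    Integrable (fun w : Space d × (ℝ × ℝ) => (annulus d L).indicator (fun _ => (1 : ℝ)) w.1 *
      ((Set.Icc (-R) R).indicator (fun _ => M) w.2.1 *
        (Set.Icc (-R) R).indicator (fun _ => M) w.2.2)) (volume.prod volume) := by
  have hI : Integrable ((Set.Icc (-R) R).indicator fun _ => M) (volume : Measure ℝ) :=
    (integrable_indicator_iff measurableSet_Icc).2
      (integrableOn_const isCompact_Icc.measure_lt_top.ne)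
  have hA : Integrable ((annulus d L).indicator fun _ => (1 : ℝ)) volume :=
    (integrable_indicator_iff (isClosed_annulus d L).measurableSet).2
      (integrableOn_const (volume_annulus_lt_top d L).ne)
  have hII : Integrable (fun w : ℝ × ℝ => (Set.Icc (-R) R).indicator (fun _ => M) w.1 *
      (Set.Icc (-R) R).indicator (fun _ => M) w.2) volume := hI.mul_prod hI
  exact hA.mul_prod hII

theorem integrable_mul_conj {L R M : ℝ} {H : ℝ → Space d → ℂ}
    (hHm : Measurable fun z : ℝ × Space d => H z.1 z.2)
    (h : ∀ t ξ, ‖H t ξ‖ ≤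
      (Set.Icc (-R) R).indicator (fun _ => M) t * (annulus d L).indicator (fun _ => 1) ξ) :
    Integrable (fun w : Space d × (ℝ × ℝ) => H w.2.1 w.1 * (starRingEnd ℂ) (H w.2.2 w.1))
      (volume.prod volume) := by
  have m1 : Measurable fun w : Space d × (ℝ × ℝ) => H w.2.1 w.1 :=
    hHm.comp ((measurable_fst.comp measurable_snd).prodMk measurable_fst)
  have m2 : Measurable fun w : Space d × (ℝ × ℝ) => H w.2.2 w.1 :=
    hHm.comp ((measurable_snd.comp measurable_snd).prodMk measurable_fst)
  have m3 : Measurable fun w : Space d × (ℝ × ℝ) => (starRingEnd ℂ) (H w.2.2 w.1) :=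
    Complex.continuous_conj.measurable.comp m2
  refine (integrable_dominating_prod d L R M).mono' (m1.mul m3).aestronglyMeasurable
    (Filter.Eventually.of_forall fun w => ?_)
  rw [norm_mul, Complex.norm_conj]
  have h1 := h w.2.1 w.1
  have h2 := h w.2.2 w.1
  by_cases hξ : w.1 ∈ annulus d L
  · rw [Set.indicator_of_mem hξ, mul_one] at h1 h2
    rw [Set.indicator_of_mem hξ, one_mul]
    exact mul_le_mul h1 h2 (norm_nonneg _) ((norm_nonneg _).trans h1)
  · rw [Set.indicator_of_notMem hξ, mul_zero] at h1 h2
    rw [Set.indicator_of_notMem hξ, zero_mul]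
    exact mul_nonpos_of_nonneg_of_nonpos (norm_nonneg _) h2

theorem lintegral_enorm_integral_sq_eq {H : ℝ → Space d → ℂ}
    (hH : Integrable (fun w : Space d × (ℝ × ℝ) => H w.2.1 w.1 * (starRingEnd ℂ) (H w.2.2 w.1))
      (volume.prod volume)) :
    ∫⁻ ξ, ‖∫ t, H t ξ‖ₑ ^ (2 : ℝ) =
      ‖∫ z : ℝ × ℝ, ∫ ξ, H z.1 ξ * (starRingEnd ℂ) (H z.2 ξ)‖ₑ := by
  have hsq : ∀ ξ, ∫ z : ℝ × ℝ, H z.1 ξ * (starRingEnd ℂ) (H z.2 ξ) =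
      ((‖∫ t, H t ξ‖ ^ 2 : ℝ) : ℂ) := by
    intro ξ
    rw [Measure.volume_eq_prod, integral_prod_mul (fun t => H t ξ)
      (fun t => (starRingEnd ℂ) (H t ξ)), integral_conj, Complex.mul_conj, Complex.normSq_eq_norm_sq]
  have hint : Integrable fun ξ => ‖∫ t, H t ξ‖ ^ 2 := by
    have := hH.integral_prod_left
    simp_rw [hsq] at this
    exact this.re
  have hswap := integral_integral_swap
    (f := fun ξ (z : ℝ × ℝ) => H z.1 ξ * (starRingEnd ℂ) (H z.2 ξ)) hH
  rw [← hswap]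
  simp_rw [hsq]
  rw [integral_complex_ofReal, ← ofReal_norm, Complex.norm_real, Real.norm_of_nonneg
    (integral_nonneg fun ξ => by positivity), ofReal_integral_eq_lintegral_ofReal hint
    (Filter.Eventually.of_forall fun ξ => by positivity)]
  congr 1
  ext ξ
  rw [← ofReal_norm, ENNReal.ofReal_rpow_of_nonneg (norm_nonneg _) zero_le_two]
  norm_num

/-- The `T T*` identity: the square of the `L²` norm of `adjoint` is a double time integral of the
dispersive form. -/
theorem lintegral_adjoint_sq_eq (hF : IsTest F) (L σ : ℝ) :
    ∫⁻ ξ, ‖adjoint L σ F ξ‖ₑ ^ (2 : ℝ) = ‖∫ z : ℝ × ℝ, ∫ ξ, symbol d L (σ * (z.1 - z.2)) ξ *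
      𝓕⁻ (F z.1) ξ * (starRingEnd ℂ) (𝓕⁻ (F z.2) ξ)‖ₑ := by
  obtain ⟨R, M, hM, h⟩ := hF.exists_integrand_bound L σ
  have h1 := lintegral_enorm_integral_sq_eq (H := fun t ξ => symbol d L (σ * t) ξ * 𝓕⁻ (F t) ξ)
    (integrable_mul_conj (hF.measurable_integrand L σ) h)
  refine h1.trans ?_
  congr 2
  ext z
  congr 1
  ext ξ
  rw [mul_sub, ← symbol_mul_conj, map_mul]
  ring

end IsTest

/-- The dual Strichartz estimate. The admissibility condition reads `2 / q = d (1 / p - 1 / 2)`, where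
`p` and `q` are the dual spatial exponent and the temporal exponent. -/
theorem exists_lintegral_adjoint_sq_le {d : ℕ} (hd : d = 1 ∨ d = 2) {p q q' : ℝ} (hp : 1 ≤ p)
    (hp2 : p < 2) (hq : 2 < q) (hqq : q.HolderConjugate q')
    (hpq : 2 / q = d / 2 * (2 / p - 1)) :
    ∃ C : ℝ, 0 < C ∧ ∀ L : ℝ, 2 ≤ L → ∀ σ ∈ ({1, -1} : Set ℝ), ∀ F : ℝ → Space d → ℂ, IsTest F →
      ∫⁻ ξ, ‖adjoint L σ F ξ‖ₑ ^ (2 : ℝ) ≤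
        ENNReal.ofReal (C * L ^ (3 / q)) * (∫⁻ t, IsTest.slice F p t ^ q') ^ (2 / q') := by
  obtain ⟨C, hC, hform⟩ := exists_enorm_form_le hp hp2
  have hq0 : 0 < q := by linarith
  have hp0 : 0 < p := by linarith
  have hH : 0 < hlsConst q := by
    have : 0 < 1 - 2 / q := by
      rw [sub_pos, div_lt_one hq0]
      exact hq
    rw [hlsConst]
    positivity
  refine ⟨C * 40000 ^ (2 / p - 1) * hlsConst q, by positivity, fun L hL σ hσ F hF => ?_⟩
  have hL0 : 0 < L := by linarith
  have hσ1 : |σ| = 1 := by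
    rcases hσ with rfl | hσ
    · simp
    · rw [Set.mem_singleton_iff.1 hσ]
      simp
  set f : ℝ → NNReal := fun t => (IsTest.slice F p t).toNNReal with hf
  have hfm : Measurable f := (hF.measurable_slice p).ennreal_toNNReal
  have hfs : ∀ t, (f t : ℝ≥0∞) = IsTest.slice F p t := fun t =>
    ENNReal.coe_toNNReal (hF.slice_ne_top hp hp2.le t)
  have hbound : ∀ t s : ℝ, t ≠ s → ‖∫ ξ, symbol d L (σ * (t - s)) ξ *
      𝓕⁻ (F t) ξ * (starRingEnd ℂ) (𝓕⁻ (F s) ξ)‖ₑ ≤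
      ENNReal.ofReal (C * 40000 ^ (2 / p - 1) * L ^ (3 / q)) *
        (ENNReal.ofReal (|t - s| ^ (-(2 / q))) * (f t * f s)) := by
    intro t s hts
    have hts0 : t - s ≠ 0 := sub_ne_zero.2 hts
    have hτ : σ * (t - s) ≠ 0 := mul_ne_zero (fun h => by simp [h] at hσ1) hts0
    have habs : 0 < |t - s| := abs_pos.2 hts0
    have hdec : 0 < decay L (σ * (t - s)) := by
      have := abs_pos.2 hτ
      have := Real.sqrt_pos.2 hL0
      rw [decay]
      positivity
    have h := hform d L (σ * (t - s)) (40000 * decay L (σ * (t - s)) ^ d) (by positivity)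
      (norm_kernel_le hd hL hτ) (F t) (F s) (hF.isNice t) (hF.isNice s)
    refine h.trans_eq ?_
    rw [hfs, hfs, IsTest.slice, IsTest.slice, ← mul_assoc (ENNReal.ofReal _) (ENNReal.ofReal _),
      ← ENNReal.ofReal_mul (by positivity)]
    congr 2
    -- `decay = (L^{3/2} / |t - s|)^{1/2}`
    have h1 : (decay L (σ * (t - s)) ^ d) ^ (2 / p - 1) = L ^ (3 / q) * |t - s| ^ (-(2 / q)) := by
      rw [decay, abs_mul, hσ1, one_mul, ← Real.rpow_natCast, ← Real.rpow_mul (Real.sqrt_nonneg _),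
        Real.sqrt_eq_rpow, Real.sqrt_eq_rpow, ← Real.rpow_mul (by positivity),
        show (1 / 2 : ℝ) * (d * (2 / p - 1)) = 2 / q by rw [hpq]; ring,
        Real.div_rpow (by positivity) habs.le, Real.rpow_neg habs.le, ← Real.rpow_one_add' hL0.le
        (by norm_num), ← Real.rpow_mul hL0.le, div_eq_mul_inv]
      congr 2
      ring
    rw [Real.mul_rpow (by norm_num) (by positivity), h1]
    ring
  rw [hF.lintegral_adjoint_sq_eq L σ]
  refine (enorm_integral_le_lintegral_enorm _).trans ?_
  calc ∫⁻ z : ℝ × ℝ, ‖∫ ξ, symbol d L (σ * (z.1 - z.2)) ξ *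
        𝓕⁻ (F z.1) ξ * (starRingEnd ℂ) (𝓕⁻ (F z.2) ξ)‖ₑ
      ≤ ∫⁻ z : ℝ × ℝ, ENNReal.ofReal (C * 40000 ^ (2 / p - 1) * L ^ (3 / q)) *
        (ENNReal.ofReal (|z.1 - z.2| ^ (-(2 / q))) * (f z.1 * f z.2)) := by
        refine lintegral_mono_ae ?_
        have hdiag : ∀ᵐ z : ℝ × ℝ, z.1 ≠ z.2 := by
          rw [Measure.volume_eq_prod]
          have hm : MeasurableSet {z : ℝ × ℝ | z.1 ≠ z.2} :=
            (measurableSet_eq_fun measurable_fst measurable_snd).compl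
          refine (Measure.ae_prod_iff_ae_ae hm).2 (Filter.Eventually.of_forall fun t => ?_)
          filter_upwards [compl_mem_ae_iff.2 (measure_singleton t)] with s hs
          exact fun h => hs h.symm
        filter_upwards [hdiag] with z hz
        exact hbound z.1 z.2 hz
    _ = ENNReal.ofReal (C * 40000 ^ (2 / p - 1) * L ^ (3 / q)) *
        ∫⁻ t, ∫⁻ s, ENNReal.ofReal (|t - s| ^ (-(2 / q))) * (f t * f s) := by
        have hm : Measurable fun z : ℝ × ℝ =>
            ENNReal.ofReal (|z.1 - z.2| ^ (-(2 / q))) * ((f z.1 : ℝ≥0∞) * f z.2) := by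
          have h1 : Measurable fun z : ℝ × ℝ => |z.1 - z.2| := by fun_prop
          refine Measurable.mul (h1.pow_const (-(2 / q))).ennreal_ofReal ?_
          exact (hfm.comp measurable_fst).coe_nnreal_ennreal.mul
            (hfm.comp measurable_snd).coe_nnreal_ennreal
        rw [lintegral_const_mul _ hm, Measure.volume_eq_prod, lintegral_prod _ hm.aemeasurable]
    _ ≤ ENNReal.ofReal (C * 40000 ^ (2 / p - 1) * L ^ (3 / q)) *
        (ENNReal.ofReal (hlsConst q) * (∫⁻ s, (f s : ℝ≥0∞) ^ q') ^ (2 / q')) := by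
        gcongr
        exact hardy_littlewood_sobolev hq hqq hfm
    _ = _ := by
        simp_rw [hfs]
        rw [← mul_assoc, ← ENNReal.ofReal_mul (by positivity)]
        congr 2
        ring

/-! ### Duality for mixed norms -/

namespace IsTest

variable {d : ℕ} {F : ℝ → Space d → ℂ}

theorem integrable (hF : IsTest F) :
    Integrable (fun z : ℝ × Space d => F z.1 z.2) (volume.prod volume) := by
  obtain ⟨M, R, hM, h⟩ := hF.exists_bound
  have h1 : Integrable ((Set.Icc (-R) R).indicator fun _ => M) (volume : Measure ℝ) :=
    (integrable_indicator_iff measurableSet_Icc).2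
      (integrableOn_const isCompact_Icc.measure_lt_top.ne)
  have h2 : Integrable ((Metric.closedBall (0 : Space d) R).indicator fun _ => (1 : ℝ)) volume :=
    (integrable_indicator_iff measurableSet_closedBall).2
      (integrableOn_const measure_closedBall_lt_top.ne)
  exact (h1.mul_prod h2).mono' hF.measurable.aestronglyMeasurable
    (Filter.Eventually.of_forall fun z => h z.1 z.2)

end IsTest

/-- The mixed norm of a nonnegative function of `(t, x)`, with real exponents. -/
def mixedLintegral {d : ℕ} (p q : ℝ) (w : ℝ → Space d → ℝ≥0∞) : ℝ≥0∞ :=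
  (∫⁻ t, ((∫⁻ x, w t x ^ p) ^ (1 / p)) ^ q) ^ (1 / q)

theorem mixedLintegral_mono {d : ℕ} {p q : ℝ} (hp : 0 ≤ p) (hq : 0 ≤ q) {w v : ℝ → Space d → ℝ≥0∞}
    (h : ∀ t x, w t x ≤ v t x) : mixedLintegral p q w ≤ mixedLintegral p q v := by
  unfold mixedLintegral
  gcongr with t x
  exact h t x

/-- A functional that is bounded on test functions is bounded on all nonnegative measurable
functions: remove the phase of `G`, and truncate. -/
theorem lintegral_enorm_mul_le_of_isTest {d : ℕ} {p q : ℝ} (hp : 0 ≤ p) (hq : 0 ≤ q) {M : ℝ≥0∞}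
    {G : ℝ → Space d → ℂ} (hG : Measurable (Function.uncurry G)) (hGb : ∃ B, ∀ t x, ‖G t x‖ ≤ B)
    (h : ∀ F : ℝ → Space d → ℂ, IsTest F → ‖∫ z : ℝ × Space d, G z.1 z.2 * F z.1 z.2‖ₑ ≤
      M * mixedLintegral p q fun t x => ‖F t x‖ₑ)
    {w : ℝ → Space d → ℝ≥0∞} (hw : Measurable (Function.uncurry w)) :
    ∫⁻ t, ∫⁻ x, ‖G t x‖ₑ * w t x ≤ M * mixedLintegral p q w := by
  set S : ℕ → Set (ℝ × Space d) := fun n => {z | |z.1| ≤ n ∧ ‖z.2‖ ≤ n} with hS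
  have hSm : ∀ n, MeasurableSet (S n) := fun n =>
    MeasurableSet.inter
      (measurableSet_le (f := fun z : ℝ × Space d => |z.1|) (by fun_prop) measurable_const)
      (measurableSet_le (f := fun z : ℝ × Space d => ‖z.2‖) (by fun_prop) measurable_const)
  set W : ℕ → ℝ × Space d → ℝ≥0∞ := fun n => (S n).indicator fun z => min (w z.1 z.2) n with hW
  have hWm : ∀ n, Measurable (W n) := fun n => (hw.min measurable_const).indicator (hSm n)
  have hWn : ∀ n z, W n z ≤ n := fun n z => by
    by_cases hz : z ∈ S n
    · rw [hW]
      simp only [Set.indicator_of_mem hz]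
      exact min_le_right _ _
    · rw [hW]
      simp only [Set.indicator_of_notMem hz]
      exact zero_le
  have hWw : ∀ n z, W n z ≤ w z.1 z.2 := fun n z => by
    by_cases hz : z ∈ S n
    · rw [hW]
      simp only [Set.indicator_of_mem hz]
      exact min_le_left _ _
    · rw [hW]
      simp only [Set.indicator_of_notMem hz]
      exact zero_le
  have hWmono : Monotone W := by
    intro m n hmn z
    have hmn' : (m : ℝ) ≤ n := by exact_mod_cast hmn
    by_cases hz : z ∈ S m
    · have hz' : z ∈ S n := ⟨hz.1.trans hmn', hz.2.trans hmn'⟩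
      rw [hW]
      simp only [Set.indicator_of_mem hz, Set.indicator_of_mem hz']
      gcongr
    · rw [hW]
      simp only [Set.indicator_of_notMem hz]
      exact zero_le
  have hWsup : ∀ z, ⨆ n, W n z = w z.1 z.2 := by
    intro z
    refine le_antisymm (iSup_le fun n => hWw n z) (le_of_forall_lt fun a ha => ?_)
    obtain ⟨n, hn⟩ := exists_nat_gt (max a.toReal (max |z.1| ‖z.2‖))
    have hz : z ∈ S n := ⟨((le_max_left _ _).trans (le_max_right _ _)).trans hn.le,
      ((le_max_right _ _).trans (le_max_right _ _)).trans hn.le⟩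
    refine lt_of_lt_of_le ?_ (le_iSup _ n)
    rw [hW]
    simp only [Set.indicator_of_mem hz]
    refine lt_min ha ?_
    rw [← ENNReal.ofReal_toReal ha.ne_top, ← ENNReal.ofReal_natCast]
    exact (ENNReal.ofReal_lt_ofReal_iff_of_nonneg ENNReal.toReal_nonneg).2
      ((le_max_left _ _).trans_lt hn)
  have hGm : Measurable fun z : ℝ × Space d => ‖G z.1 z.2‖ₑ := hG.enorm
  have hn : ∀ n, ∫⁻ z : ℝ × Space d, ‖G z.1 z.2‖ₑ * W n z ≤ M * mixedLintegral p q w := by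
    intro n
    set F : ℝ → Space d → ℂ := fun t x =>
      ((W n (t, x)).toReal : ℂ) * ((starRingEnd ℂ) (G t x) / ‖G t x‖) with hF
    have hphase : ∀ z : ℂ, ‖(starRingEnd ℂ) z / (‖z‖ : ℂ)‖ ≤ 1 := by
      intro z
      rw [norm_div, Complex.norm_conj, Complex.norm_real, norm_norm]
      exact div_self_le_one _
    have hFW : ∀ t x, ‖F t x‖ ≤ (W n (t, x)).toReal := fun t x => by
      rw [hF]
      simp only [norm_mul, Complex.norm_real]
      rw [Real.norm_of_nonneg ENNReal.toReal_nonneg]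
      exact mul_le_of_le_one_right ENNReal.toReal_nonneg (hphase _)
    have hFt : IsTest F := by
      refine ⟨?_, ⟨n, ?_⟩, ⟨n, ?_⟩⟩
      · refine Measurable.mul (Complex.measurable_ofReal.comp (hWm n).ennreal_toReal) ?_
        exact (Complex.continuous_conj.measurable.comp hG).div
          (Complex.measurable_ofReal.comp hG.norm)
      · intro t x
        refine (hFW t x).trans ?_
        exact ENNReal.toReal_le_of_le_ofReal (Nat.cast_nonneg n) (by simpa using hWn n (t, x))
      · intro t x htx
        have : (t, x) ∉ S n := by
          rintro ⟨h1, h2⟩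
          rcases htx with h | h
          · exact absurd h1 (not_le.2 h)
          · exact absurd h2 (not_le.2 h)
        rw [hF, hW]
        simp [Set.indicator_of_notMem this]
    have hmul : ∀ z : ℝ × Space d,
        G z.1 z.2 * F z.1 z.2 = ((‖G z.1 z.2‖ * (W n z).toReal : ℝ) : ℂ) := by
      intro z
      rw [hF]
      by_cases h0 : G z.1 z.2 = 0
      · simp [h0]
      · have h1 : (‖G z.1 z.2‖ : ℂ) ≠ 0 := by simpa using h0
        have h2 : G z.1 z.2 * (starRingEnd ℂ) (G z.1 z.2) = (‖G z.1 z.2‖ : ℂ) ^ 2 :=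
          Complex.mul_conj' _
        simp only [Prod.mk.eta]
        push_cast
        field_simp
        linear_combination ((W n z).toReal : ℂ) * h2
    obtain ⟨B, hB⟩ := hGb
    have hint : Integrable (fun z : ℝ × Space d => G z.1 z.2 * F z.1 z.2) (volume.prod volume) :=
      hFt.integrable.bdd_mul hG.aestronglyMeasurable
        (Filter.Eventually.of_forall fun z => hB z.1 z.2)
    have hval : ‖∫ z : ℝ × Space d, G z.1 z.2 * F z.1 z.2‖ₑ =
        ∫⁻ z : ℝ × Space d, ‖G z.1 z.2‖ₑ * W n z := by
      have hnorm : ∀ z : ℝ × Space d,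
          ‖G z.1 z.2 * F z.1 z.2‖ = ‖G z.1 z.2‖ * (W n z).toReal := by
        intro z
        rw [hmul, Complex.norm_real, Real.norm_of_nonneg
          (mul_nonneg (norm_nonneg _) ENNReal.toReal_nonneg)]
      have h1 : ∫ z : ℝ × Space d, G z.1 z.2 * F z.1 z.2 =
          ((∫ z : ℝ × Space d, ‖G z.1 z.2 * F z.1 z.2‖ : ℝ) : ℂ) := by
        rw [← integral_complex_ofReal]
        congr 1
        ext z
        rw [hnorm, hmul]
      rw [h1, ← ofReal_norm, Complex.norm_real, Real.norm_of_nonneg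
        (integral_nonneg fun z => norm_nonneg _), Measure.volume_eq_prod,
        ofReal_integral_norm_eq_lintegral_enorm hint]
      congr 1
      ext z
      rw [← ofReal_norm, hnorm, ENNReal.ofReal_mul (norm_nonneg _), ofReal_norm,
        ENNReal.ofReal_toReal ((hWn n z).trans_lt (ENNReal.natCast_lt_top n)).ne]
    rw [← hval]
    refine (h F hFt).trans ?_
    gcongr
    refine mixedLintegral_mono hp hq fun t x => ?_
    refine le_trans ?_ (hWw n (t, x))
    rw [← ofReal_norm]
    exact ENNReal.ofReal_le_of_le_toReal (hFW t x)
  have hprod : ∫⁻ t, ∫⁻ x, ‖G t x‖ₑ * w t x = ∫⁻ z : ℝ × Space d, ‖G z.1 z.2‖ₑ * w z.1 z.2 := by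
    rw [Measure.volume_eq_prod, lintegral_prod]
    exact (hGm.mul hw).aemeasurable
  rw [hprod]
  have hsup : ∀ z : ℝ × Space d,
      ‖G z.1 z.2‖ₑ * w z.1 z.2 = ⨆ n, ‖G z.1 z.2‖ₑ * W n z := by
    intro z
    rw [← ENNReal.mul_iSup, hWsup]
  simp_rw [hsup]
  rw [lintegral_iSup (f := fun n (z : ℝ × Space d) => ‖G z.1 z.2‖ₑ * W n z)
    (fun n => hGm.mul (hWm n)) (fun m n hmn z => mul_le_mul_right (hWmono hmn z) _)]
  exact iSup_le hn

/-- If `J ≤ M J^{1/q'}` with `J` finite, then `J^{1/q} ≤ M`. -/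
theorem rpow_one_div_le_of_le_mul_rpow {q q' : ℝ} (hqq : q.HolderConjugate q') {J M : ℝ≥0∞}
    (hJ : J ≠ ⊤) (h : J ≤ M * J ^ (1 / q')) : J ^ (1 / q) ≤ M := by
  rcases eq_or_ne J 0 with rfl | h0
  · rw [ENNReal.zero_rpow_of_pos (one_div_pos.2 hqq.pos)]
    exact zero_le
  · have hne : J ^ (1 / q') ≠ 0 := by simp [ENNReal.rpow_eq_zero_iff, h0, hJ]
    have hnt : J ^ (1 / q') ≠ ⊤ := by simp [ENNReal.rpow_eq_top_iff, h0, hJ]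
    have h1 : J ^ (1 / q) * J ^ (1 / q') = J := by
      rw [← ENNReal.rpow_add _ _ h0 hJ]
      have := hqq.inv_add_inv_eq_one
      rw [one_div, one_div, this, ENNReal.rpow_one]
    refine (ENNReal.mul_le_mul_iff_left hne hnt).1 ?_
    rw [h1]
    exact h

/-- The extremizer in Hölder's inequality is `g^{r-1} N^{q/r-1}` with `N(t) = ∫ g(t, x)^r dx`. It can be
inserted if all norms are known to be finite. Where `N` vanishes its negative powers are infinite,
but they are multiplied by `0`. -/
theorem mixedLintegral_le_of_forall_lintegral_mul_le_aux {d : ℕ} {p q q' r : ℝ}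
    (hpr : p.HolderConjugate r) (hqq : q.HolderConjugate q') {M : ℝ≥0∞}
    {g : ℝ → Space d → ℝ≥0∞} (hg : Measurable (Function.uncurry g))
    (hN : ∀ t, ∫⁻ x, g t x ^ r ≠ ⊤) (hJ : ∫⁻ t, (∫⁻ x, g t x ^ r) ^ (q / r) ≠ ⊤)
    (h : ∀ w : ℝ → Space d → ℝ≥0∞, Measurable (Function.uncurry w) →
      ∫⁻ t, ∫⁻ x, g t x * w t x ≤ M * mixedLintegral p q' w) :
    mixedLintegral r q g ≤ M := by
  set N : ℝ → ℝ≥0∞ := fun t => ∫⁻ x, g t x ^ r with hNdef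
  have hr0 := hpr.symm.pos
  have hp0 := hpr.pos
  have hq0 := hqq.pos
  have hr1 : 0 < r - 1 := by linarith [hpr.symm.lt]
  have hs0 : 0 < q / r := div_pos hq0 hr0
  have hNm : Measurable N := Measurable.lintegral_prod_right' (hg.pow_const r)
  have hw : Measurable (Function.uncurry fun t x => g t x ^ (r - 1) * N t ^ (q / r - 1)) :=
    (hg.pow_const _).mul ((hNm.comp measurable_fst).pow_const _)
  have hgt : ∀ t, Measurable (g t) := fun t => hg.comp measurable_prodMk_left
  have hpow : ∀ t, N t ^ (q / r - 1) * N t = N t ^ (q / r) := by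
    intro t
    rcases eq_or_ne (N t) 0 with h0 | h0
    · rw [h0, mul_zero, ENNReal.zero_rpow_of_pos hs0]
    · nth_rewrite 2 [← ENNReal.rpow_one (N t)]
      rw [← ENNReal.rpow_add _ _ h0 (hN t), sub_add_cancel]
  have hleft : ∀ t, ∫⁻ x, g t x * (g t x ^ (r - 1) * N t ^ (q / r - 1)) = N t ^ (q / r) := by
    intro t
    have : ∀ x, g t x * (g t x ^ (r - 1) * N t ^ (q / r - 1)) = N t ^ (q / r - 1) * g t x ^ r := by
      intro x
      rw [← mul_assoc, mul_comm]
      congr 1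
      nth_rewrite 1 [← ENNReal.rpow_one (g t x)]
      rw [← ENNReal.rpow_add_of_nonneg _ _ zero_le_one hr1.le]
      congr 1
      ring
    simp_rw [this]
    rw [lintegral_const_mul _ ((hgt t).pow_const r), hpow]
  have hright : ∀ t, ((∫⁻ x, (g t x ^ (r - 1) * N t ^ (q / r - 1)) ^ p) ^ (1 / p)) ^ q' =
      N t ^ (q / r) := by
    intro t
    have h1 : ∀ x, (g t x ^ (r - 1) * N t ^ (q / r - 1)) ^ p =
        (N t ^ (q / r - 1)) ^ p * g t x ^ r := by
      intro x
      rw [ENNReal.mul_rpow_of_nonneg _ _ hp0.le, mul_comm, ← ENNReal.rpow_mul (g t x),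
        show (r - 1) * p = r by linarith [hpr.mul_eq_add]]
    simp_rw [h1]
    rw [lintegral_const_mul _ ((hgt t).pow_const r)]
    change (((N t ^ (q / r - 1)) ^ p * N t) ^ (1 / p)) ^ q' = N t ^ (q / r)
    rcases eq_or_ne (N t) 0 with h0 | h0
    · rw [h0, mul_zero, ENNReal.zero_rpow_of_pos (one_div_pos.2 hp0),
        ENNReal.zero_rpow_of_pos hqq.symm.pos, ENNReal.zero_rpow_of_pos hs0]
    · have h2 : (N t ^ (q / r - 1)) ^ p * N t = N t ^ ((q / r - 1) * p + 1) := by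
        rw [ENNReal.rpow_add _ _ h0 (hN t), ENNReal.rpow_one, ENNReal.rpow_mul]
      rw [h2, ← ENNReal.rpow_mul, ← ENNReal.rpow_mul, ← mul_assoc]
      congr 1
      have e1 : 1 / p = 1 - 1 / r := by
        have := hpr.inv_add_inv_eq_one
        simp only [one_div]
        linarith
      have e2 : q * q' - q' = q := by linarith [hqq.mul_eq_add]
      have e3 : ((q / r - 1) * p + 1) * (1 / p) = q / r - 1 + 1 / p := by field_simp
      rw [e3, e1]
      calc (q / r - 1 + (1 - 1 / r)) * q' = (q * q' - q') / r := by ring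
        _ = q / r := by rw [e2]
  have key := h _ hw
  simp_rw [hleft] at key
  rw [mixedLintegral] at key
  simp_rw [hright] at key
  have hfin := rpow_one_div_le_of_le_mul_rpow hqq hJ key
  rw [mixedLintegral]
  have : ∀ t, ((∫⁻ x, g t x ^ r) ^ (1 / r)) ^ q = N t ^ (q / r) := by
    intro t
    rw [← ENNReal.rpow_mul]
    congr 1
    ring
  simp_rw [this]
  exact hfin

/-- The converse of Hölder's inequality in mixed norms, for finite exponents, by truncation and
monotone convergence. -/
theorem mixedLintegral_le_of_forall_lintegral_mul_le {d : ℕ} {p q q' r : ℝ}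
    (hpr : p.HolderConjugate r) (hqq : q.HolderConjugate q') {M : ℝ≥0∞}
    {G : ℝ → Space d → ℂ} (hG : Measurable (Function.uncurry G)) (hGb : ∃ B, ∀ t x, ‖G t x‖ ≤ B)
    (h : ∀ w : ℝ → Space d → ℝ≥0∞, Measurable (Function.uncurry w) →
      ∫⁻ t, ∫⁻ x, ‖G t x‖ₑ * w t x ≤ M * mixedLintegral p q' w) :
    mixedLintegral r q (fun t x => ‖G t x‖ₑ) ≤ M := by
  have hr0 := hpr.symm.pos
  have hq0 := hqq.pos
  have hs0 : 0 < q / r := div_pos hq0 hr0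
  set g : ℕ → ℝ → Space d → ℝ≥0∞ := fun n t x => (Metric.closedBall (0 : ℝ) n).indicator
    (fun _ => (Metric.closedBall (0 : Space d) n).indicator (fun _ => ‖G t x‖ₑ) x) t with hg
  have hgval : ∀ (n : ℕ) (t : ℝ) (x : Space d), t ∈ Metric.closedBall (0 : ℝ) n → x ∈ Metric.closedBall (0 : Space d) n →
      g n t x = ‖G t x‖ₑ := by
    intro n t x ht hx
    rw [hg]
    simp only [Set.indicator_of_mem ht, Set.indicator_of_mem hx]
  have hgzero : ∀ (n : ℕ) (t : ℝ) (x : Space d), ¬ (t ∈ Metric.closedBall (0 : ℝ) n ∧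
      x ∈ Metric.closedBall (0 : Space d) n) → g n t x = 0 := by
    intro n t x htx
    rw [hg]
    by_cases ht : t ∈ Metric.closedBall (0 : ℝ) n
    · have hx : x ∉ Metric.closedBall (0 : Space d) n := fun hx => htx ⟨ht, hx⟩
      simp only [Set.indicator_of_mem ht, Set.indicator_of_notMem hx]
    · simp only [Set.indicator_of_notMem ht]
  have hgle : ∀ n t x, g n t x ≤ ‖G t x‖ₑ := by
    intro n t x
    by_cases htx : t ∈ Metric.closedBall (0 : ℝ) n ∧ x ∈ Metric.closedBall (0 : Space d) n
    · exact (hgval n t x htx.1 htx.2).le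
    · rw [hgzero n t x htx]
      exact zero_le
  have hgm : ∀ n, Measurable (Function.uncurry (g n)) := by
    intro n
    have : Function.uncurry (g n) = (Metric.closedBall (0 : ℝ) n ×ˢ
        Metric.closedBall (0 : Space d) n).indicator fun z => ‖G z.1 z.2‖ₑ := by
      ext z
      by_cases hz : z ∈ Metric.closedBall (0 : ℝ) n ×ˢ Metric.closedBall (0 : Space d) n
      · rw [Set.indicator_of_mem hz]
        exact hgval n z.1 z.2 hz.1 hz.2
      · rw [Set.indicator_of_notMem hz]
        exact hgzero n z.1 z.2 hz
    rw [this]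
    exact hG.enorm.indicator (measurableSet_closedBall.prod measurableSet_closedBall)
  have hgmono : ∀ t x, Monotone fun n => g n t x := by
    intro t x m n hmn
    have hmn' : (m : ℝ) ≤ n := by exact_mod_cast hmn
    by_cases htx : t ∈ Metric.closedBall (0 : ℝ) m ∧ x ∈ Metric.closedBall (0 : Space d) m
    · simp only
      rw [hgval m t x htx.1 htx.2, hgval n t x (Metric.closedBall_subset_closedBall hmn' htx.1)
        (Metric.closedBall_subset_closedBall hmn' htx.2)]
    · change g m t x ≤ g n t x
      rw [hgzero m t x htx]
      exact zero_le
  have hgsup : ∀ t x, ⨆ n, g n t x = ‖G t x‖ₑ := by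
    intro t x
    refine le_antisymm (iSup_le fun n => hgle n t x) ?_
    obtain ⟨n, hn⟩ := exists_nat_ge (max |t| ‖x‖)
    rw [← hgval n t x (by simpa using (le_max_left _ _).trans hn)
      (by simpa using (le_max_right _ _).trans hn)]
    exact le_iSup (fun n => g n t x) n
  obtain ⟨B, hB⟩ := hGb
  -- the truncated norms are bounded, and supported in a bounded interval
  have hNle : ∀ n t, ∫⁻ x, g n t x ^ r ≤ (Metric.closedBall (0 : ℝ) n).indicator
      (fun _ => ENNReal.ofReal B ^ r * volume (Metric.closedBall (0 : Space d) n)) t := by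
    intro n t
    by_cases ht : t ∈ Metric.closedBall (0 : ℝ) n
    · rw [Set.indicator_of_mem ht, ← setLIntegral_const, ← lintegral_indicator
        measurableSet_closedBall]
      refine lintegral_mono fun x => ?_
      by_cases hx : x ∈ Metric.closedBall (0 : Space d) n
      · rw [Set.indicator_of_mem hx, hgval n t x ht hx, ← ofReal_norm]
        gcongr
        exact hB t x
      · rw [hgzero n t x fun h => hx h.2, ENNReal.zero_rpow_of_pos hr0]
        exact zero_le
    · rw [Set.indicator_of_notMem ht]
      have h0 : ∀ x, g n t x ^ r = 0 := fun x => by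
        rw [hgzero n t x fun h => ht h.1, ENNReal.zero_rpow_of_pos hr0]
      simp [h0]
  have hAtop : ∀ n : ℕ, ENNReal.ofReal B ^ r * volume (Metric.closedBall (0 : Space d) n) ≠ ⊤ :=
    fun n => ENNReal.mul_ne_top (ENNReal.rpow_ne_top_of_nonneg hr0.le ENNReal.ofReal_ne_top)
      measure_closedBall_lt_top.ne
  have hn : ∀ n, ∫⁻ t, (∫⁻ x, g n t x ^ r) ^ (q / r) ≤ M ^ q := by
    intro n
    have h1 := mixedLintegral_le_of_forall_lintegral_mul_le_aux hpr hqq (hgm n) (M := M) ?_ ?_ ?_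
    · have h2 := ENNReal.rpow_le_rpow h1 hq0.le
      rw [mixedLintegral, ← ENNReal.rpow_mul, one_div_mul_cancel hq0.ne', ENNReal.rpow_one] at h2
      refine le_trans (le_of_eq ?_) h2
      congr 1
      ext t
      rw [← ENNReal.rpow_mul]
      congr 1
      ring
    · intro t
      refine ((hNle n t).trans (Set.indicator_le_self _ _ _)).trans_lt (hAtop n).lt_top |>.ne
    · have h3 : ∫⁻ t, (∫⁻ x, g n t x ^ r) ^ (q / r) ≤ ∫⁻ t, (Metric.closedBall (0 : ℝ) n).indicator
          (fun _ => (ENNReal.ofReal B ^ r *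
            volume (Metric.closedBall (0 : Space d) n)) ^ (q / r)) t := by
        refine lintegral_mono fun t => ?_
        refine (ENNReal.rpow_le_rpow (hNle n t) hs0.le).trans_eq ?_
        by_cases ht : t ∈ Metric.closedBall (0 : ℝ) n
        · rw [Set.indicator_of_mem ht, Set.indicator_of_mem ht]
        · rw [Set.indicator_of_notMem ht, Set.indicator_of_notMem ht,
            ENNReal.zero_rpow_of_pos hs0]
      refine (h3.trans_lt ?_).ne
      rw [lintegral_indicator measurableSet_closedBall, setLIntegral_const]
      exact ENNReal.mul_lt_top (ENNReal.rpow_lt_top_of_nonneg hs0.le (hAtop n))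
        measure_closedBall_lt_top
    · intro w hw
      refine le_trans ?_ (h w hw)
      gcongr with t x
      exact hgle n t x
  have hsup : ∀ t, (∫⁻ x, ‖G t x‖ₑ ^ r) ^ (q / r) = ⨆ n, (∫⁻ x, g n t x ^ r) ^ (q / r) := by
    intro t
    have hrsup : ∀ {s : ℝ}, 0 < s → ∀ f : ℕ → ℝ≥0∞, (⨆ n, f n) ^ s = ⨆ n, f n ^ s := fun hs f =>
      (ENNReal.orderIsoRpow _ hs).map_iSup f
    rw [← hrsup hs0, ← lintegral_iSup (f := fun n x => g n t x ^ r)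
      (fun n => ((hgm n).comp measurable_prodMk_left).pow_const r)]
    · congr 2
      ext x
      rw [← hrsup hr0, hgsup]
    · intro m n hmn x
      exact ENNReal.rpow_le_rpow (hgmono t x hmn) hr0.le
  rw [mixedLintegral, ← ENNReal.rpow_le_rpow_iff hq0, ← ENNReal.rpow_mul,
    one_div_mul_cancel hq0.ne', ENNReal.rpow_one]
  have : ∀ t, ((∫⁻ x, ‖G t x‖ₑ ^ r) ^ (1 / r)) ^ q = ⨆ n, (∫⁻ x, g n t x ^ r) ^ (q / r) := by
    intro t
    rw [← hsup, ← ENNReal.rpow_mul]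
    congr 1
    ring
  simp_rw [this]
  rw [lintegral_iSup]
  · exact iSup_le hn
  · intro n
    exact (Measurable.lintegral_prod_right' ((hgm n).pow_const r)).pow_const _
  · intro m n hmn t
    refine ENNReal.rpow_le_rpow (lintegral_mono fun x => ?_) hs0.le
    exact ENNReal.rpow_le_rpow (hgmono t x hmn) hr0.le

/-- Point evaluations are limits of averages over small balls: the functional controls the values
of `G` along a measurable curve. -/
theorem lintegral_mul_enorm_curve_le {d : ℕ} {q' : ℝ} {M : ℝ≥0∞}
    {G : ℝ → Space d → ℂ} (hG : Continuous (Function.uncurry G))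
    (h : ∀ w : ℝ → Space d → ℝ≥0∞, Measurable (Function.uncurry w) →
      ∫⁻ t, ∫⁻ x, ‖G t x‖ₑ * w t x ≤ M * mixedLintegral 1 q' w)
    {X : ℝ → Space d} (hX : Measurable X) {a : ℝ → ℝ≥0∞} (ha : Measurable a) :
    ∫⁻ t, a t * ‖G t (X t)‖ₑ ≤ M * (∫⁻ t, a t ^ q') ^ (1 / q') := by
  set δ : ℕ → ℝ := fun k => 1 / ((k : ℝ) + 1) with hδ
  have hδ0 : ∀ k, 0 < δ k := fun k => Nat.one_div_pos_of_nat
  set c : ℕ → ℝ≥0∞ := fun k => volume (Metric.ball (0 : Space d) (δ k)) with hc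
  have hc0 : ∀ k, c k ≠ 0 := fun k => (Metric.measure_ball_pos _ _ (hδ0 k)).ne'
  have hct : ∀ k, c k ≠ ⊤ := fun k => measure_ball_lt_top.ne
  set w : ℕ → ℝ → Space d → ℝ≥0∞ := fun k t x =>
    a t * (Metric.ball (X t) (δ k)).indicator (fun _ => (c k)⁻¹) x with hw
  have hwm : ∀ k, Measurable (Function.uncurry (w k)) := by
    intro k
    refine (ha.comp measurable_fst).mul ?_
    have : (fun z : ℝ × Space d => (Metric.ball (X z.1) (δ k)).indicator (fun _ => (c k)⁻¹) z.2) =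
        {z : ℝ × Space d | dist z.2 (X z.1) < δ k}.indicator fun _ => (c k)⁻¹ := by
      ext z
      by_cases hz : dist z.2 (X z.1) < δ k
      · rw [Set.indicator_of_mem (show z.2 ∈ Metric.ball (X z.1) (δ k) from hz),
          Set.indicator_of_mem (show z ∈ {z : ℝ × Space d | dist z.2 (X z.1) < δ k} from hz)]
      · rw [Set.indicator_of_notMem (show z.2 ∉ Metric.ball (X z.1) (δ k) from hz),
          Set.indicator_of_notMem (show z ∉ {z : ℝ × Space d | dist z.2 (X z.1) < δ k} from hz)]
    rw [this]
    exact measurable_const.indicator (measurableSet_lt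
      (measurable_snd.dist (hX.comp measurable_fst)) measurable_const)
  have hwint : ∀ k t, ∫⁻ x, w k t x = a t := by
    intro k t
    rw [hw]
    simp only
    rw [lintegral_const_mul _ (measurable_const.indicator measurableSet_ball),
      lintegral_indicator measurableSet_ball, setLIntegral_const,
      Measure.addHaar_ball_center volume (X t), ENNReal.inv_mul_cancel (hc0 k) (hct k), mul_one]
  have hk : ∀ k, ∫⁻ t, ∫⁻ x, ‖G t x‖ₑ * w k t x ≤ M * (∫⁻ t, a t ^ q') ^ (1 / q') := by
    intro k
    refine (h (w k) (hwm k)).trans_eq ?_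
    rw [mixedLintegral]
    simp only [ENNReal.rpow_one, div_one, hwint]
  have hpt : ∀ t, a t * ‖G t (X t)‖ₑ ≤
      Filter.liminf (fun k => ∫⁻ x, ‖G t x‖ₑ * w k t x) Filter.atTop := by
    intro t
    refine ENNReal.mul_le_of_forall_lt fun a' ha' b hb => ?_
    have hcont : Continuous fun x => ‖G t x‖ₑ :=
      (hG.comp (continuous_const.prodMk continuous_id)).enorm
    obtain ⟨ε, hε, hball⟩ := Metric.isOpen_iff.1 (isOpen_lt continuous_const hcont) (X t) hb
    refine Filter.le_liminf_of_le (by isBoundedDefault) ?_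
    have hev : ∀ᶠ k in Filter.atTop, δ k < ε :=
      (tendsto_one_div_add_atTop_nhds_zero_nat).eventually_lt_const hε
    filter_upwards [hev] with k hk
    calc a' * b ≤ b * a t := by
          rw [mul_comm]
          gcongr
      _ = ∫⁻ x, b * w k t x := by
          rw [lintegral_const_mul (f := w k t) _ ((hwm k).comp measurable_prodMk_left), hwint]
      _ ≤ _ := by
          refine lintegral_mono fun x => ?_
          by_cases hx : x ∈ Metric.ball (X t) (δ k)
          · have : b < ‖G t x‖ₑ := hball (Metric.ball_subset_ball hk.le hx)
            gcongr
          · rw [hw]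
            simp only [Set.indicator_of_notMem hx, mul_zero, le_refl]
  calc ∫⁻ t, a t * ‖G t (X t)‖ₑ
      ≤ ∫⁻ t, Filter.liminf (fun k => ∫⁻ x, ‖G t x‖ₑ * w k t x) Filter.atTop :=
        lintegral_mono hpt
    _ ≤ Filter.liminf (fun k => ∫⁻ t, ∫⁻ x, ‖G t x‖ₑ * w k t x) Filter.atTop :=
        lintegral_liminf_le fun k =>
          Measurable.lintegral_prod_right' (hG.measurable.enorm.mul (hwm k))
    _ ≤ _ := by
        refine (Filter.liminf_le_liminf (Filter.Eventually.of_forall hk)).trans_eq ?_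
        exact Filter.liminf_const _

theorem enorm_le_enorm_of_norm_le {a b : ℂ} (h : ‖a‖ ≤ ‖b‖) : ‖a‖ₑ ≤ ‖b‖ₑ := by
  rw [← ofReal_norm, ← ofReal_norm]
  exact ENNReal.ofReal_le_ofReal h

/-- The first `n` terms of a dense sequence contain a point where `‖G t ·‖` is maximal among them;
`argmax G t n` is such a point, chosen measurably in `t`. -/
def argmax {d : ℕ} (G : ℝ → Space d → ℂ) (t : ℝ) : ℕ → Space d
  | 0 => TopologicalSpace.denseSeq (Space d) 0
  | n + 1 => if ‖G t (argmax G t n)‖ < ‖G t (TopologicalSpace.denseSeq (Space d) (n + 1))‖ then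
      TopologicalSpace.denseSeq (Space d) (n + 1) else argmax G t n

theorem measurable_argmax {d : ℕ} {G : ℝ → Space d → ℂ} (hG : Measurable (Function.uncurry G))
    (n : ℕ) : Measurable fun t => argmax G t n := by
  induction n with
  | zero => exact measurable_const
  | succ n ih =>
    refine Measurable.ite (measurableSet_lt ?_ ?_) measurable_const ih
    · exact (hG.comp (measurable_id.prodMk ih)).norm
    · exact (hG.comp (measurable_id.prodMk measurable_const)).norm

theorem norm_argmax_le_succ {d : ℕ} (G : ℝ → Space d → ℂ) (t : ℝ) (n : ℕ) :
    ‖G t (argmax G t n)‖ ≤ ‖G t (argmax G t (n + 1))‖ := by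
  rw [argmax]
  split_ifs with h
  · exact h.le
  · exact le_rfl

theorem norm_denseSeq_le_argmax {d : ℕ} (G : ℝ → Space d → ℂ) (t : ℝ) (n : ℕ) :
    ‖G t (TopologicalSpace.denseSeq (Space d) n)‖ ≤ ‖G t (argmax G t n)‖ := by
  cases n with
  | zero => exact le_rfl
  | succ n =>
    rw [argmax]
    split_ifs with h
    · exact le_rfl
    · exact not_lt.1 h

/-- The converse of Hölder's inequality in mixed norms, for the spatial exponent `∞`. -/
theorem lintegral_eLpNormEssSup_rpow_le_of_forall_lintegral_mul_le {d : ℕ} {q q' : ℝ}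
    (hqq : q.HolderConjugate q') {M : ℝ≥0∞}
    {G : ℝ → Space d → ℂ} (hG : Continuous (Function.uncurry G)) (hGb : ∃ B, ∀ t x, ‖G t x‖ ≤ B)
    (h : ∀ w : ℝ → Space d → ℝ≥0∞, Measurable (Function.uncurry w) →
      ∫⁻ t, ∫⁻ x, ‖G t x‖ₑ * w t x ≤ M * mixedLintegral 1 q' w) :
    (∫⁻ t, eLpNormEssSup (G t) volume ^ q) ^ (1 / q) ≤ M := by
  have hq0 := hqq.pos
  have hq1 : 0 < q - 1 := by linarith [hqq.lt]
  obtain ⟨B, hB⟩ := hGb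
  set S : ℕ → ℝ → ℝ≥0∞ := fun n =>
    (Metric.closedBall (0 : ℝ) n).indicator fun t => ‖G t (argmax G t n)‖ₑ with hS
  have hSm : ∀ n, Measurable (S n) := fun n =>
    (hG.measurable.comp (measurable_id.prodMk (measurable_argmax hG.measurable n))).enorm.indicator
      measurableSet_closedBall
  have hSle : ∀ n t, S n t ≤ ‖G t (argmax G t n)‖ₑ := fun n t => Set.indicator_le_self _ _ _
  have hnorm : ∀ t, Monotone fun n => ‖G t (argmax G t n)‖ₑ := fun t =>
    monotone_nat_of_le_succ fun n => enorm_le_enorm_of_norm_le (norm_argmax_le_succ G t n)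
  have hSmono : Monotone S := by
    intro m n hmn t
    have hmn' : (m : ℝ) ≤ n := by exact_mod_cast hmn
    by_cases ht : t ∈ Metric.closedBall (0 : ℝ) m
    · rw [hS]
      simp only [Set.indicator_of_mem ht,
        Set.indicator_of_mem (Metric.closedBall_subset_closedBall hmn' ht)]
      exact hnorm t hmn
    · rw [hS]
      simp only [Set.indicator_of_notMem ht]
      exact zero_le
  have hSsup : ∀ t x, ‖G t x‖ₑ ≤ ⨆ n, S n t := by
    intro t x
    have hclosed : IsClosed {x | ‖G t x‖ₑ ≤ ⨆ n, S n t} :=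
      isClosed_le (hG.comp (continuous_const.prodMk continuous_id)).enorm continuous_const
    refine (TopologicalSpace.denseRange_denseSeq (Space d)).induction_on x hclosed fun n => ?_
    obtain ⟨m, hm⟩ := exists_nat_ge |t|
    have ht : t ∈ Metric.closedBall (0 : ℝ) (max n m : ℕ) := by
      rw [mem_closedBall_zero_iff, Real.norm_eq_abs]
      refine hm.trans ?_
      exact_mod_cast le_max_right n m
    refine le_trans ?_ (le_iSup _ (max n m))
    rw [hS]
    simp only [Set.indicator_of_mem ht]
    exact (enorm_le_enorm_of_norm_le (norm_denseSeq_le_argmax G t n)).trans (hnorm t (le_max_left n m))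
  have hn : ∀ n, ∫⁻ t, S n t ^ q ≤ M ^ q := by
    intro n
    have h1 := lintegral_mul_enorm_curve_le hG h (measurable_argmax hG.measurable n)
      (a := fun t => S n t ^ (q - 1)) ((hSm n).pow_const _)
    have h2 : ∀ t, S n t ^ (q - 1) * ‖G t (argmax G t n)‖ₑ = S n t ^ q := by
      intro t
      by_cases ht : t ∈ Metric.closedBall (0 : ℝ) n
      · have : S n t = ‖G t (argmax G t n)‖ₑ := by
          rw [hS]
          simp only [Set.indicator_of_mem ht]
        rw [← this]
        nth_rewrite 2 [← ENNReal.rpow_one (S n t)]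
        rw [← ENNReal.rpow_add_of_nonneg _ _ hq1.le zero_le_one, sub_add_cancel]
      · have : S n t = 0 := by
          rw [hS]
          simp only [Set.indicator_of_notMem ht]
        rw [this, ENNReal.zero_rpow_of_pos hq1, ENNReal.zero_rpow_of_pos hq0, zero_mul]
    have h3 : ∀ t, (S n t ^ (q - 1)) ^ q' = S n t ^ q := by
      intro t
      rw [← ENNReal.rpow_mul]
      congr 1
      linarith [hqq.mul_eq_add]
    simp_rw [h2, h3] at h1
    have hfin : ∫⁻ t, S n t ^ q ≠ ⊤ := by
      have h4 : ∫⁻ t, S n t ^ q ≤ ∫⁻ t, (Metric.closedBall (0 : ℝ) n).indicator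
          (fun _ => ENNReal.ofReal B ^ q) t := by
        refine lintegral_mono fun t => ?_
        by_cases ht : t ∈ Metric.closedBall (0 : ℝ) n
        · rw [Set.indicator_of_mem ht]
          refine ENNReal.rpow_le_rpow ((hSle n t).trans ?_) hq0.le
          rw [← ofReal_norm]
          exact ENNReal.ofReal_le_ofReal (hB _ _)
        · rw [Set.indicator_of_notMem ht, hS]
          simp only [Set.indicator_of_notMem ht]
          rw [ENNReal.zero_rpow_of_pos hq0]
      refine (h4.trans_lt ?_).ne
      rw [lintegral_indicator measurableSet_closedBall, setLIntegral_const]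
      exact ENNReal.mul_lt_top (ENNReal.rpow_lt_top_of_nonneg hq0.le ENNReal.ofReal_ne_top)
        measure_closedBall_lt_top
    have h5 := ENNReal.rpow_le_rpow (rpow_one_div_le_of_le_mul_rpow hqq hfin h1) hq0.le
    rwa [← ENNReal.rpow_mul, one_div_mul_cancel hq0.ne', ENNReal.rpow_one] at h5
  rw [← ENNReal.rpow_le_rpow_iff hq0, ← ENNReal.rpow_mul, one_div_mul_cancel hq0.ne',
    ENNReal.rpow_one]
  calc ∫⁻ t, eLpNormEssSup (G t) volume ^ q ≤ ∫⁻ t, ⨆ n, S n t ^ q := by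
        refine lintegral_mono fun t => ?_
        refine (ENNReal.rpow_le_rpow (eLpNormEssSup_le_of_ae_enorm_bound
          (Filter.Eventually.of_forall (hSsup t))) hq0.le).trans_eq ?_
        exact (ENNReal.orderIsoRpow _ hq0).map_iSup fun n => S n t
    _ ≤ M ^ q := by
        rw [lintegral_iSup (fun n => (hSm n).pow_const q)
          (fun m n hmn t => ENNReal.rpow_le_rpow (hSmono hmn t) hq0.le)]
        exact iSup_le hn

/-- The exponent dual to `r`; it is `1` for `r = ∞`. -/
def dualExponent (r : ℝ≥0∞) : ℝ := 1 / (1 - (r⁻¹).toReal)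

/-- To bound a mixed norm it is enough to test against bounded functions of bounded support. -/
theorem mixedNorm_le_of_isTest {d : ℕ} {q r : ℝ≥0∞} {q' : ℝ} (hq_top : q < ⊤) (hr : 2 < r)
    (hqq : q.toReal.HolderConjugate q') {M : ℝ≥0∞} {G : ℝ → Space d → ℂ}
    (hG : Continuous (Function.uncurry G)) (hGb : ∃ B, ∀ t x, ‖G t x‖ ≤ B)
    (h : ∀ F : ℝ → Space d → ℂ, IsTest F → ‖∫ z : ℝ × Space d, G z.1 z.2 * F z.1 z.2‖ₑ ≤
      M * mixedLintegral (dualExponent r) q' fun t x => ‖F t x‖ₑ) :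
    mixedNorm d q r G ≤ M := by
  have hq0 := hqq.pos
  have hq'0 := hqq.symm.pos
  have hqne : q ≠ 0 := by
    rintro rfl
    simp at hq0
  rw [mixedNorm, eLpNorm_eq_lintegral_rpow_enorm_toReal hqne hq_top.ne]
  simp only [enorm_eq_self]
  rcases eq_or_ne r ⊤ with rfl | hrt
  · have hp : dualExponent ⊤ = 1 := by simp [dualExponent]
    rw [hp] at h
    simp only [eLpNorm_exponent_top]
    exact lintegral_eLpNormEssSup_rpow_le_of_forall_lintegral_mul_le hqq hG hGb fun w hw =>
      lintegral_enorm_mul_le_of_isTest zero_le_one hq'0.le hG.measurable hGb h hw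
  · have hr0 : r ≠ 0 := (zero_le.trans_lt hr).ne'
    have hr2 : 2 < r.toReal := by
      rw [← ENNReal.toReal_ofNat]
      exact (ENNReal.toReal_lt_toReal (by simp) hrt).2 hr
    have hr0' : 0 < r.toReal := by linarith
    have hp0 : 0 < 1 - r.toReal⁻¹ := by
      rw [sub_pos]
      exact inv_lt_one_of_one_lt₀ (by linarith)
    have hpr : (dualExponent r).HolderConjugate r.toReal := by
      rw [Real.holderConjugate_iff, dualExponent, ENNReal.toReal_inv]
      refine ⟨?_, ?_⟩
      · rw [lt_div_iff₀ hp0]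
        have : 0 < r.toReal⁻¹ := by positivity
        linarith
      · rw [one_div, inv_inv]
        ring
    simp only [eLpNorm_eq_lintegral_rpow_enorm_toReal hr0 hrt]
    exact mixedLintegral_le_of_forall_lintegral_mul_le hpr hqq hG.measurable hGb fun w hw =>
      lintegral_enorm_mul_le_of_isTest hpr.pos.le hq'0.le hG.measurable hGb h hw

/-! ### The Strichartz estimate for frequency-localized waves -/

/-- The free wave with sign `σ` whose Fourier coefficients at time `0` are `h`, localized to the
shell of radius `L`, as an inverse Fourier integral. -/
def wave (d : ℕ) (L σ : ℝ) (h : Space d → ℂ) (t : ℝ) (x : Space d) : ℂ :=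
  𝓕⁻ (fun ξ => symbol d L (σ * t) ξ * h ξ) x

theorem continuous_symbol_time (d : ℕ) (L σ : ℝ) (ξ : Space d) :
    Continuous fun t => symbol d L (σ * t) ξ := by
  by_cases hξ : ξ ∈ annulus d L
  · simp only [symbol, Set.indicator_of_mem hξ]
    fun_prop
  · simp only [symbol, Set.indicator_of_notMem hξ]
    exact continuous_const

theorem integrable_symbol_mul_of_integrable {d : ℕ} (L t : ℝ) {h : Space d → ℂ} (hh : Integrable h) :
    Integrable fun ξ => symbol d L t ξ * h ξ :=
  hh.bdd_mul (measurable_symbol d L t).aestronglyMeasurable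
    (Filter.Eventually.of_forall fun ξ => norm_symbol_le d L t ξ)

theorem norm_symbol_mul_le {d : ℕ} (L t : ℝ) (h : Space d → ℂ) (ξ : Space d) :
    ‖symbol d L t ξ * h ξ‖ ≤ ‖h ξ‖ := by
  rw [norm_mul]
  exact mul_le_of_le_one_left (norm_nonneg _) (norm_symbol_le d L t ξ)

theorem norm_wave_le {d : ℕ} (L σ : ℝ) {h : Space d → ℂ} (hh : Integrable h) (t : ℝ)
    (x : Space d) : ‖wave d L σ h t x‖ ≤ ∫ ξ, ‖h ξ‖ :=
  (norm_fourierInv_le _ _).trans (integral_mono (integrable_symbol_mul_of_integrable L _ hh).norm hh.norm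
    fun ξ => norm_symbol_mul_le L _ h ξ)

theorem continuous_wave {d : ℕ} (L σ : ℝ) {h : Space d → ℂ} (hh : Integrable h) :
    Continuous (Function.uncurry (wave d L σ h)) := by
  have h1 : Function.uncurry (wave d L σ h) = fun z : ℝ × Space d =>
      ∫ ξ, Complex.exp ((2 * π * inner ℝ ξ z.2 : ℝ) * Complex.I) •
        (symbol d L (σ * z.1) ξ * h ξ) := by
    ext z
    rw [Function.uncurry, wave, Real.fourierInv_eq']
  rw [h1]
  refine continuous_of_dominated (bound := fun ξ => ‖h ξ‖) (fun z => ?_) (fun z => ?_) hh.norm ?_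
  · have h3 : Continuous fun ξ : Space d =>
        Complex.exp ((2 * π * inner ℝ ξ z.2 : ℝ) * Complex.I) := by fun_prop
    exact h3.aestronglyMeasurable.smul (integrable_symbol_mul_of_integrable L _ hh).aestronglyMeasurable
  · refine Filter.Eventually.of_forall fun ξ => ?_
    rw [norm_smul, Complex.norm_exp_ofReal_mul_I, one_mul]
    exact norm_symbol_mul_le L _ h ξ
  · refine Filter.Eventually.of_forall fun ξ => ?_
    have h2 : Continuous fun z : ℝ × Space d => symbol d L (σ * z.1) ξ :=
      (continuous_symbol_time d L σ ξ).comp continuous_fst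
    have h3 : Continuous fun z : ℝ × Space d =>
        Complex.exp ((2 * π * inner ℝ ξ z.2 : ℝ) * Complex.I) := by fun_prop
    exact h3.smul (h2.mul continuous_const)

/-- Pairing a wave with a test function is pairing its Fourier coefficients with `adjoint`. -/
theorem integral_wave_mul_eq {d : ℕ} (L σ : ℝ) {h : Space d → ℂ} (hh : Integrable h)
    {F : ℝ → Space d → ℂ} (hF : IsTest F) :
    ∫ z : ℝ × Space d, wave d L σ h z.1 z.2 * F z.1 z.2 = ∫ ξ, h ξ * adjoint L σ F ξ := by
  have hint : Integrable (fun z : ℝ × Space d => wave d L σ h z.1 z.2 * F z.1 z.2)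
      (volume.prod volume) :=
    hF.integrable.bdd_mul (continuous_wave L σ hh).aestronglyMeasurable
      (Filter.Eventually.of_forall fun z => norm_wave_le L σ hh z.1 z.2)
  obtain ⟨R, M, hM, hbound⟩ := hF.exists_integrand_bound L σ
  have hR : Integrable ((Set.Icc (-R) R).indicator fun _ => M) (volume : Measure ℝ) :=
    (integrable_indicator_iff measurableSet_Icc).2
      (integrableOn_const isCompact_Icc.measure_lt_top.ne)
  have hint2 : Integrable (fun z : ℝ × Space d =>
      h z.2 * (symbol d L (σ * z.1) z.2 * 𝓕⁻ (F z.1) z.2)) (volume.prod volume) := by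
    have hdom : Integrable (fun z : ℝ × Space d =>
      (Set.Icc (-R) R).indicator (fun _ => M) z.1 * ‖h z.2‖) (volume.prod volume) :=
      hR.mul_prod hh.norm
    refine hdom.mono' (hh.aestronglyMeasurable.comp_snd.mul
      (hF.measurable_integrand L σ).aestronglyMeasurable) (Filter.Eventually.of_forall fun z => ?_)
    rw [norm_mul, mul_comm]
    refine mul_le_mul_of_nonneg_right ((hbound z.1 z.2).trans ?_) (norm_nonneg _)
    refine mul_le_of_le_one_right (Set.indicator_nonneg (fun _ _ => hM) _) ?_
    exact Set.indicator_le_self' (fun _ _ => zero_le_one) _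
  rw [Measure.volume_eq_prod, integral_prod _ hint]
  have hslice : ∀ t, ∫ x, wave d L σ h t x * F t x =
      ∫ ξ, h ξ * (symbol d L (σ * t) ξ * 𝓕⁻ (F t) ξ) := by
    intro t
    refine (integral_fourierInv_mul_eq (integrable_symbol_mul_of_integrable L (σ * t) hh)
      (hF.isNice t).integrable).trans ?_
    congr 1
    ext ξ
    ring
  simp_rw [hslice]
  rw [integral_integral_swap (f := fun t ξ => h ξ * (symbol d L (σ * t) ξ * 𝓕⁻ (F t) ξ)) hint2]
  simp_rw [integral_const_mul]
  rfl

theorem lintegral_enorm_mul_le_eLpNorm_mul {d : ℕ} {f g : Space d → ℂ}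
    (hf : AEStronglyMeasurable f volume) (hg : AEStronglyMeasurable g volume) :
    ∫⁻ ξ, ‖f ξ‖ₑ * ‖g ξ‖ₑ ≤ eLpNorm f 2 volume * eLpNorm g 2 volume := by
  have h := ENNReal.lintegral_mul_le_Lp_mul_Lq volume Real.HolderConjugate.two_two hf.enorm hg.enorm
  rw [lintegral_enorm_sq_eq_eLpNorm, lintegral_enorm_sq_eq_eLpNorm, ← ENNReal.rpow_mul,
    ← ENNReal.rpow_mul] at h
  simpa using h

theorem two_lt_of_admissible {d : ℕ} {q r : ℝ≥0∞} (hq : 2 < q) (hq_top : q < ⊤) (hr : 2 ≤ r)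
    (hqr : 2 / q.toReal = (d / 2 : ℝ) * (1 - 2 * (r⁻¹).toReal)) : 2 < r := by
  refine lt_of_le_of_ne hr ?_
  rintro rfl
  have hq0 : 0 < q.toReal := ENNReal.toReal_pos (zero_le.trans_lt hq).ne' hq_top.ne
  have : 0 < 2 / q.toReal := by positivity
  rw [hqr] at this
  simp at this

/-- The dual Strichartz estimate in terms of `q` and `r`: the power of `L` is `3 / (2 q)`. -/
theorem exists_eLpNorm_adjoint_le {d : ℕ} (hd : d = 1 ∨ d = 2)
    {q r : ℝ≥0∞} (hq : 2 < q) (hq_top : q < ⊤) (hr : 2 ≤ r)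
    (hqr : 2 / q.toReal = (d / 2 : ℝ) * (1 - 2 * (r⁻¹).toReal)) :
    ∃ C : ℝ, 0 < C ∧ ∀ L : ℝ, 2 ≤ L → ∀ σ ∈ ({1, -1} : Set ℝ), ∀ F : ℝ → Space d → ℂ, IsTest F →
      eLpNorm (adjoint L σ F) 2 volume ≤
        ENNReal.ofReal (C * L ^ ((3 * d / 8 : ℝ) * (1 - 2 * (r⁻¹).toReal))) *
          mixedLintegral (dualExponent r) (q.toReal.conjExponent) fun t x => ‖F t x‖ₑ := by
  have hr2 := two_lt_of_admissible hq hq_top hr hqr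
  have hq2 : 2 < q.toReal := by
    rw [← ENNReal.toReal_ofNat]
    exact (ENNReal.toReal_lt_toReal (by simp) hq_top.ne).2 hq
  have hqq : q.toReal.HolderConjugate q.toReal.conjExponent :=
    Real.HolderConjugate.conjExponent (by linarith)
  have hρ0 : 0 ≤ (r⁻¹).toReal := ENNReal.toReal_nonneg
  have hρ : (r⁻¹).toReal < 1 / 2 := by
    have : (r⁻¹).toReal < ((2 : ℝ≥0∞)⁻¹).toReal :=
      (ENNReal.toReal_lt_toReal (ENNReal.inv_ne_top.2 (zero_le.trans_lt hr2).ne')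
        (by simp)).2 (ENNReal.inv_lt_inv.2 hr2)
    simpa using this
  have hpos : 0 < 1 - (r⁻¹).toReal := by linarith
  have hp1 : 1 ≤ dualExponent r := by
    rw [dualExponent, le_div_iff₀ hpos]
    linarith
  have hp2 : dualExponent r < 2 := by
    rw [dualExponent, div_lt_iff₀ hpos]
    linarith
  have hpq : 2 / q.toReal = d / 2 * (2 / dualExponent r - 1) := by
    rw [hqr, dualExponent, div_div_eq_mul_div, div_one]
    ring
  obtain ⟨C, hC, h⟩ := exists_lintegral_adjoint_sq_le hd hp1 hp2 hq2 hqq hpq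
  refine ⟨√C, Real.sqrt_pos.2 hC, fun L hL σ hσ F hF => ?_⟩
  have hL0 : 0 < L := by linarith
  have h1 := h L hL σ hσ F hF
  rw [lintegral_enorm_sq_eq_eLpNorm] at h1
  have h2 := ENNReal.rpow_le_rpow h1 (show (0 : ℝ) ≤ 1 / 2 by norm_num)
  rw [← ENNReal.rpow_mul, ENNReal.mul_rpow_of_nonneg _ _ (by norm_num), ← ENNReal.rpow_mul,
    ENNReal.ofReal_rpow_of_nonneg (by positivity) (by norm_num),
    Real.mul_rpow hC.le (by positivity), ← Real.rpow_mul hL0.le, ← Real.sqrt_eq_rpow] at h2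
  have e1 : 3 / q.toReal * (1 / 2) = (3 * d / 8 : ℝ) * (1 - 2 * (r⁻¹).toReal) := by
    have : 3 / q.toReal * (1 / 2) = 3 / 4 * (2 / q.toReal) := by ring
    rw [this, hqr]
    ring
  have e2 : 2 / q.toReal.conjExponent * (1 / 2) = 1 / q.toReal.conjExponent := by ring
  rw [e1, e2, show (2 : ℝ) * (1 / 2) = 1 by norm_num, ENNReal.rpow_one] at h2
  exact h2

theorem mixedNorm_le_of_enorm_integral_le {d : ℕ}
    {q r : ℝ≥0∞} (hq : 2 < q) (hq_top : q < ⊤) (hr : 2 ≤ r)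
    (hqr : 2 / q.toReal = (d / 2 : ℝ) * (1 - 2 * (r⁻¹).toReal)) {M : ℝ≥0∞} {G : ℝ → Space d → ℂ}
    (hG : Continuous (Function.uncurry G)) (hGb : ∃ B, ∀ t x, ‖G t x‖ ≤ B)
    (h : ∀ F : ℝ → Space d → ℂ, IsTest F → ‖∫ z : ℝ × Space d, G z.1 z.2 * F z.1 z.2‖ₑ ≤
      M * mixedLintegral (dualExponent r) (q.toReal.conjExponent) fun t x => ‖F t x‖ₑ) :
    mixedNorm d q r G ≤ M := by
  have hq2 : 2 < q.toReal := by
    rw [← ENNReal.toReal_ofNat]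
    exact (ENNReal.toReal_lt_toReal (by simp) hq_top.ne).2 hq
  exact mixedNorm_le_of_isTest hq_top (two_lt_of_admissible hq hq_top hr hqr)
    (Real.HolderConjugate.conjExponent (by linarith)) hG hGb h

/-- The Strichartz estimate for waves with frequencies in the shell of radius `L`. -/
theorem exists_mixedNorm_wave_le {d : ℕ} (hd : d = 1 ∨ d = 2)
    {q r : ℝ≥0∞} (hq : 2 < q) (hq_top : q < ⊤) (hr : 2 ≤ r)
    (hqr : 2 / q.toReal = (d / 2 : ℝ) * (1 - 2 * (r⁻¹).toReal)) :
    ∃ C : ℝ, 0 < C ∧ ∀ L : ℝ, 2 ≤ L → ∀ σ ∈ ({1, -1} : Set ℝ), ∀ h : Space d → ℂ, Integrable h →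
      mixedNorm d q r (wave d L σ h) ≤
        ENNReal.ofReal (C * L ^ ((3 * d / 8 : ℝ) * (1 - 2 * (r⁻¹).toReal))) *
          eLpNorm h 2 volume := by
  obtain ⟨C, hC, hadj⟩ := exists_eLpNorm_adjoint_le hd hq hq_top hr hqr
  refine ⟨C, hC, fun L hL σ hσ h hh => ?_⟩
  refine mixedNorm_le_of_enorm_integral_le hq hq_top hr hqr (continuous_wave L σ hh)
    ⟨_, norm_wave_le L σ hh⟩ fun F hF => ?_
  rw [integral_wave_mul_eq L σ hh hF]
  refine (enorm_integral_le_lintegral_enorm _).trans ?_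
  simp_rw [enorm_mul]
  refine (lintegral_enorm_mul_le_eLpNorm_mul hh.aestronglyMeasurable
    (hF.measurable_adjoint L σ).aestronglyMeasurable).trans ?_
  rw [mul_comm (ENNReal.ofReal _), mul_assoc]
  gcongr
  exact hadj L hL σ hσ F hF

/-! ### Frequency support of Littlewood-Paley pieces -/

section Support

variable {V : Type*} [NormedAddCommGroup V] [InnerProductSpace ℝ V] [FiniteDimensional ℝ V]
  [MeasurableSpace V] [BorelSpace V]

/-- A Fourier multiplier whose symbol vanishes off a closed set produces distributions whose Fourier
transform vanishes off that set. -/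
theorem ae_eq_zero_of_fourierMultiplier {s : V → ℂ} {K : Set V} (hK : IsClosed K)
    (hs : ∀ ξ ∉ K, s ξ = 0) (T : 𝓢'(V, ℂ)) {g : V → ℂ} (hg : LocallyIntegrable g volume)
    (hTg : ∀ φ : 𝓢(V, ℂ),
      (𝓕 (TemperedDistribution.fourierMultiplierCLM ℂ s T)) φ = ∫ x, φ x * g x) :
    ∀ᵐ ξ, ξ ∉ K → g ξ = 0 := by
  refine hK.isOpen_compl.ae_eq_zero_of_integral_contDiff_smul_eq_zero
    (hg.locallyIntegrableOn _) fun ψ hψ hψc hψK => ?_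
  have hg₁ : HasCompactSupport (Complex.ofRealCLM ∘ ψ) := hψc.comp_left rfl
  have hg₂ : ContDiff ℝ ∞ (Complex.ofRealCLM ∘ ψ) := by fun_prop
  have h := hTg (hg₁.toSchwartzMap hg₂)
  rw [TemperedDistribution.fourierMultiplierCLM_apply, FourierTransform.fourier_fourierInv_eq,
    TemperedDistribution.smulLeftCLM_apply_apply] at h
  have hzero : SchwartzMap.smulLeftCLM ℂ s (hg₁.toSchwartzMap hg₂) = 0 := by
    by_cases hst : s.HasTemperateGrowth
    · ext ξ
      rw [SchwartzMap.smulLeftCLM_apply_apply hst]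
      by_cases hξ : ξ ∈ K
      · have : ψ ξ = 0 := by
          by_contra h0
          exact hψK (subset_tsupport _ h0) hξ
        simp [this]
      · simp [hs ξ hξ]
    · simp [SchwartzMap.smulLeftCLM, hst]
  rw [hzero, map_zero] at h
  simpa using h.symm

end Support

theorem IsDyadic.two_le {L : ℝ} (hL : IsDyadic L) (h1 : 1 < L) : 2 ≤ L := by
  obtain ⟨k, rfl⟩ := hL
  have hk : 0 < k := by
    by_contra hk
    push Not at hk
    exact absurd (zpow_le_one_of_nonpos₀ (one_le_two (α := ℝ)) hk) (not_le.2 h1)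
  calc (2 : ℝ) = 2 ^ (1 : ℤ) := by norm_num
    _ ≤ 2 ^ k := zpow_le_zpow_right₀ one_le_two hk

theorem lpProfile_eq_zero {χ : ℝ → ℝ} (hχ : IsCutoff χ) {L ρ : ℝ} (hL : 2 ≤ L) (hρ : 0 ≤ ρ)
    (h : ¬ (L / 2 ≤ ρ ∧ ρ ≤ 2 * L)) : lpProfile χ L ρ = 0 := by
  have hL0 : 0 < L := by linarith
  rw [lpProfile, if_neg (by linarith)]
  have hρL : 0 ≤ ρ / L := by positivity
  rcases lt_or_ge ρ (L / 2) with h1 | h1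
  · have h2 : 2 * (ρ / L) ≤ 1 := by
      rw [← mul_div_assoc, div_le_one hL0]
      linarith
    rw [hχ.eq_one _ (by rw [abs_of_nonneg hρL]; linarith),
      hχ.eq_one _ (by rw [abs_of_nonneg (by positivity)]; exact h2), sub_self]
  · have h3 : 2 * L < ρ := not_le.1 fun h3 => h ⟨h1, h3⟩
    have h4 : 2 < ρ / L := by
      rw [lt_div_iff₀ hL0]
      exact h3
    have hz : ∀ s, 2 < s → χ s = 0 := fun s hs => by
      refine image_eq_zero_of_notMem_tsupport fun hmem => ?_
      exact absurd (hχ.tsupport_subset hmem).2 (by linarith)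
    rw [hz _ h4, hz _ (by linarith), sub_self]

theorem lpProfile_norm_eq_zero {χ : ℝ → ℝ} (hχ : IsCutoff χ) {d : ℕ} {L : ℝ} (hL : 2 ≤ L)
    {ξ : Space d} (hξ : ξ ∉ annulus d L) : (lpProfile χ L ‖(2 * π) • ξ‖ : ℂ) = 0 := by
  rw [lpProfile_eq_zero hχ hL (norm_nonneg _) hξ, Complex.ofReal_zero]

/-- A free wave with data in the range of `P_L` is an absolutely convergent inverse Fourier
integral over the shell of radius `L`. -/
theorem exists_freeWave_ae_eq_wave {d : ℕ} {χ : ℝ → ℝ} (hχ : IsCutoff χ) {L : ℝ} (hL : 2 ≤ L)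
    (f : 𝓢'(Space d, ℂ)) (fL : Lp (α := Space d) ℂ 2 volume)
    (hf : (fL : 𝓢'(Space d, ℂ)) = lpProj d χ L f) :
    ∃ h : Space d → ℂ, Integrable h ∧ eLpNorm h 2 volume = eLpNorm fL 2 volume ∧
      ∀ σ t, freeWave d (σ * t) fL =ᵐ[volume] wave d L σ h t := by
  set g : Lp (α := Space d) ℂ 2 volume := 𝓕 fL with hg
  have hsupp : ∀ᵐ ξ, ξ ∉ annulus d L → g ξ = 0 := by
    refine ae_eq_zero_of_fourierMultiplier (isClosed_annulus d L)
      (s := fun ξ : Space d => (lpProfile χ L ‖(2 * π) • ξ‖ : ℂ))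
      (fun ξ hξ => lpProfile_norm_eq_zero hχ hL hξ) f
      ((Lp.memLp g).locallyIntegrable (by norm_num)) fun φ => ?_
    rw [lpProj] at hf
    rw [← hf, Lp.fourier_toTemperedDistribution_eq, Lp.toTemperedDistribution_apply]
    rfl
  set h : Space d → ℂ := (annulus d L).indicator g with hh
  have hgh : h =ᵐ[volume] g := by
    filter_upwards [hsupp] with ξ hξ
    by_cases hmem : ξ ∈ annulus d L
    · rw [hh, Set.indicator_of_mem hmem]
    · rw [hh, Set.indicator_of_notMem hmem, hξ hmem]
  have hh2 : MemLp h 2 volume := (memLp_congr_ae hgh).2 (Lp.memLp g)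
  have hh1 : Integrable h := by
    rw [hh, integrable_indicator_iff (isClosed_annulus d L).measurableSet]
    have : Fact (volume (annulus d L) < ⊤) := ⟨volume_annulus_lt_top d L⟩
    exact ((Lp.memLp g).restrict (annulus d L)).integrable (by norm_num)
  refine ⟨h, hh1, ?_, fun σ t => ?_⟩
  · rw [eLpNorm_congr_ae hgh, ← Lp.enorm_def, ← Lp.enorm_def, enorm_eq_iff_norm_eq]
    exact Lp.norm_fourier_eq fL
  · have hmem : MemLp (fun ξ => symbol d L (σ * t) ξ * h ξ) 2 volume :=
      hh2.of_le (integrable_symbol_mul_of_integrable L (σ * t) hh1).aestronglyMeasurable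
        (Filter.Eventually.of_forall fun ξ => norm_symbol_mul_le L _ h ξ)
    have heq : (memLp_freeWave d (σ * t) fL).toLp = hmem.toLp := by
      refine MemLp.toLp_congr _ _ ?_
      filter_upwards [hsupp] with ξ hξ
      by_cases hA : ξ ∈ annulus d L
      · rw [hh, symbol, Set.indicator_of_mem hA, Set.indicator_of_mem hA]
        congr 2
        push_cast
        ring
      · have h0 : (𝓕 fL : Lp (α := Space d) ℂ 2 volume) ξ = 0 := hξ hA
        rw [symbol, Set.indicator_of_notMem hA, h0, zero_mul, mul_zero]
    rw [freeWave, heq]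
    exact fourierInv_toLp_ae_eq (integrable_symbol_mul_of_integrable L (σ * t) hh1) hmem

/-- The Strichartz estimate for free waves with data in the range of `P_L`. -/
theorem exists_mixedNorm_freeWave_le {d : ℕ} (hd : d = 1 ∨ d = 2) {χ : ℝ → ℝ} (hχ : IsCutoff χ)
    {q r : ℝ≥0∞} (hq : 2 < q) (hq_top : q < ⊤) (hr : 2 ≤ r)
    (hqr : 2 / q.toReal = (d / 2 : ℝ) * (1 - 2 * (r⁻¹).toReal)) :
    ∃ C : ℝ, 0 < C ∧ ∀ L : ℝ, IsDyadic L → 1 < L →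
      ∀ σ ∈ ({1, -1} : Set ℝ), ∀ (f : 𝓢'(Space d, ℂ)) (fL : Lp (α := Space d) ℂ 2 volume),
        (fL : 𝓢'(Space d, ℂ)) = lpProj d χ L f →
        mixedNorm d q r (fun t x => freeWave d (σ * t) fL x) ≤
          ENNReal.ofReal (C * L ^ ((3 * d / 8 : ℝ) * (1 - 2 * (r⁻¹).toReal))) *
            eLpNorm fL 2 volume := by
  obtain ⟨C, hC, hw⟩ := exists_mixedNorm_wave_le hd hq hq_top hr hqr
  refine ⟨C, hC, fun L hLd hL1 σ hσ f fL hf => ?_⟩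
  have hL := hLd.two_le hL1
  obtain ⟨h, hh, hnorm, hae⟩ := exists_freeWave_ae_eq_wave hχ hL f fL hf
  have : mixedNorm d q r (fun t x => freeWave d (σ * t) fL x) = mixedNorm d q r (wave d L σ h) := by
    rw [mixedNorm, mixedNorm]
    congr 1
    ext t
    exact eLpNorm_congr_ae (hae σ t)
  rw [this, ← hnorm]
  exact hw L hL σ hσ h hh

/-! ### Space-time integrals and the shear `τ ↦ τ + σ m(ξ)` -/

theorem measurePreserving_toLp (d : ℕ) :
    MeasurePreserving (MeasurableEquiv.toLp 2 (ℝ × Space d)) :=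
  WithLp.volume_preserving_toLp ℝ (Space d)

theorem lintegral_spaceTime {d : ℕ} {f : SpaceTime d → ℝ≥0∞} (hf : Measurable f) :
    ∫⁻ ζ, f ζ = ∫⁻ τ : ℝ, ∫⁻ ξ : Space d, f (WithLp.toLp 2 (τ, ξ)) := by
  rw [← (measurePreserving_toLp d).lintegral_comp hf, Measure.volume_eq_prod, lintegral_prod]
  · rfl
  · exact (hf.comp (MeasurableEquiv.toLp 2 (ℝ × Space d)).measurable).aemeasurable

theorem integral_spaceTime {d : ℕ} (f : SpaceTime d → ℂ) :
    ∫ ζ, f ζ = ∫ z : ℝ × Space d, f (WithLp.toLp 2 z) :=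
  ((measurePreserving_toLp d).integral_comp' f).symm

/-- The height of the characteristic surface over `ξ`, in Mathlib's normalization of frequencies. -/
def shift (d : ℕ) (σ : ℝ) (ξ : Space d) : ℝ := σ * dispersion d ((2 * π) • ξ) / (2 * π)

theorem measurable_shift (d : ℕ) (σ : ℝ) : Measurable (shift d σ) :=
  (((measurable_dispersion d).comp (measurable_const_smul (α := Space d) (2 * π))).const_mul
    σ).div_const _

/-- Shearing in the time frequency preserves the integral. -/
theorem lintegral_shift {d : ℕ} (σ : ℝ) {f : ℝ × Space d → ℝ≥0∞} (hf : Measurable f) :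
    ∫⁻ τ, ∫⁻ ξ, f (τ, ξ) = ∫⁻ τ, ∫⁻ ξ, f (τ - shift d σ ξ, ξ) := by
  have hm : Measurable fun z : ℝ × Space d => f (z.1 - shift d σ z.2, z.2) :=
    hf.comp ((measurable_fst.sub ((measurable_shift d σ).comp measurable_snd)).prodMk
      measurable_snd)
  rw [lintegral_lintegral_swap (f := fun τ ξ => f (τ, ξ)) hf.aemeasurable,
    lintegral_lintegral_swap (f := fun τ ξ => f (τ - shift d σ ξ, ξ)) hm.aemeasurable]
  congr 1
  ext ξ
  exact (lintegral_sub_right_eq_self (fun τ => f (τ, ξ)) (shift d σ ξ)).symm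

theorem measurable_sheared {d : ℕ} (σ : ℝ) {g : ℝ × Space d → ℂ} (hg : Measurable g) :
    Measurable fun z : ℝ × Space d => g (z.1 - shift d σ z.2, z.2) :=
  hg.comp ((measurable_fst.sub ((measurable_shift d σ).comp measurable_snd)).prodMk measurable_snd)

theorem measurable_sheared_slice {d : ℕ} (σ : ℝ) {g : ℝ × Space d → ℂ} (hg : Measurable g)
    (τ : ℝ) : Measurable fun ξ => g (τ - shift d σ ξ, ξ) :=
  (measurable_sheared σ hg).comp (measurable_prodMk_left (x := τ))

theorem measurable_eLpNorm_sheared {d : ℕ} (σ : ℝ) {g : ℝ × Space d → ℂ} (hg : Measurable g) :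
    Measurable fun τ => eLpNorm (fun ξ => g (τ - shift d σ ξ, ξ)) 2 volume := by
  simp_rw [eLpNorm_eq_lintegral_rpow_enorm_toReal two_ne_zero ENNReal.ofNat_ne_top]
  exact (Measurable.lintegral_prod_right' (f := fun z : ℝ × Space d =>
    ‖g (z.1 - shift d σ z.2, z.2)‖ₑ ^ (2 : ℝ≥0∞).toReal)
    ((measurable_sheared σ hg).enorm.pow_const _)).pow_const _

/-- Cauchy-Schwarz in `ξ`, in sheared coordinates. -/
theorem lintegral_enorm_mul_le_of_sheared {d : ℕ} {L σ : ℝ} {g Φ : ℝ × Space d → ℂ}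
    (hg : Measurable g) (hΦ : Measurable Φ)
    (hsupp : ∀ z : ℝ × Space d, z.2 ∉ annulus d L → g z = 0) {A : ℝ≥0∞} {a : ℝ → Space d → ℂ}
    (ha : ∀ τ, Measurable (a τ)) (haΦ : ∀ τ, ∀ ξ ∈ annulus d L, Φ (τ - shift d σ ξ, ξ) = a τ ξ)
    (hA : ∀ τ, eLpNorm (a τ) 2 volume ≤ A) :
    ∫⁻ z : ℝ × Space d, ‖g z * Φ z‖ₑ ≤
      (∫⁻ τ, eLpNorm (fun ξ => g (τ - shift d σ ξ, ξ)) 2 volume) * A := by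
  have hprod : Measurable fun z => ‖g z * Φ z‖ₑ := (hg.mul hΦ).enorm
  rw [Measure.volume_eq_prod, lintegral_prod _ hprod.aemeasurable, lintegral_shift σ hprod,
    ← lintegral_mul_const'' _ (measurable_eLpNorm_sheared σ hg).aemeasurable]
  refine lintegral_mono fun τ => ?_
  have hpt : ∀ ξ, ‖g (τ - shift d σ ξ, ξ) * Φ (τ - shift d σ ξ, ξ)‖ₑ ≤
      ‖g (τ - shift d σ ξ, ξ)‖ₑ * ‖a τ ξ‖ₑ := by
    intro ξ
    by_cases hξ : ξ ∈ annulus d L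
    · rw [haΦ τ ξ hξ, enorm_mul]
    · rw [hsupp (τ - shift d σ ξ, ξ) hξ, zero_mul, enorm_zero]
      exact zero_le
  refine (lintegral_mono hpt).trans ((lintegral_enorm_mul_le_eLpNorm_mul
    (measurable_sheared_slice σ hg τ).aestronglyMeasurable
    (ha τ).aestronglyMeasurable).trans ?_)
  gcongr
  exact hA τ

/-- Modulation of a function of `(t, x)` by a time frequency. -/
def modulate {d : ℕ} (τ : ℝ) (F : ℝ → Space d → ℂ) (t : ℝ) (x : Space d) : ℂ :=
  Complex.exp ((2 * π * (t * τ) : ℝ) * Complex.I) * F t x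

theorem norm_modulate {d : ℕ} (τ : ℝ) (F : ℝ → Space d → ℂ) (t : ℝ) (x : Space d) :
    ‖modulate τ F t x‖ = ‖F t x‖ := by
  rw [modulate, norm_mul, Complex.norm_exp_ofReal_mul_I, one_mul]

theorem IsTest.modulate {d : ℕ} {F : ℝ → Space d → ℂ} (hF : IsTest F) (τ : ℝ) :
    IsTest (modulate τ F) := by
  obtain ⟨M, hM⟩ := hF.bounded
  obtain ⟨R, hR⟩ := hF.support
  refine ⟨?_, ⟨M, fun t x => ?_⟩, ⟨R, fun t x h => ?_⟩⟩
  · have h1 : Measurable fun z : ℝ × Space d =>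
        Complex.exp ((2 * π * (z.1 * τ) : ℝ) * Complex.I) :=
      Continuous.measurable (by fun_prop)
    exact h1.mul hF.measurable
  · rw [norm_modulate]
    exact hM t x
  · rw [Whitham.modulate, hR t x h, mul_zero]

/-- On the sheared coordinates, the space-time inverse Fourier transform of a test function is the
adjoint of the group applied to its modulation. -/
theorem fourierInv_spaceTime_eq_adjoint {d : ℕ} (L σ τ : ℝ) {ξ : Space d} (hξ : ξ ∈ annulus d L)
    {F : ℝ → Space d → ℂ} (hF : IsTest F) :
    𝓕⁻ (fun ζ : SpaceTime d => F ζ.fst ζ.snd) (WithLp.toLp 2 (τ - shift d σ ξ, ξ)) =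
      adjoint L σ (modulate τ F) ξ := by
  have hphase : Continuous fun z : ℝ × Space d => Complex.exp
      ((2 * π * (z.1 * (τ - shift d σ ξ) + inner ℝ z.2 ξ) : ℝ) * Complex.I) := by
    fun_prop
  have hint : Integrable (fun z : ℝ × Space d => Complex.exp
      ((2 * π * (z.1 * (τ - shift d σ ξ) + inner ℝ z.2 ξ) : ℝ) * Complex.I) * F z.1 z.2)
      (volume.prod volume) :=
    hF.integrable.bdd_mul (c := 1) hphase.aestronglyMeasurable
      (Filter.Eventually.of_forall fun z => (Complex.norm_exp_ofReal_mul_I _).le)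
  have h1 : 𝓕⁻ (fun ζ : SpaceTime d => F ζ.fst ζ.snd) (WithLp.toLp 2 (τ - shift d σ ξ, ξ)) =
      ∫ z : ℝ × Space d, Complex.exp
        ((2 * π * (z.1 * (τ - shift d σ ξ) + inner ℝ z.2 ξ) : ℝ) * Complex.I) * F z.1 z.2 := by
    rw [Real.fourierInv_eq', integral_spaceTime]
    congr 1
    ext z
    rw [smul_eq_mul, WithLp.prod_inner_apply]
    congr 4
    simp [mul_comm]
  rw [h1, Measure.volume_eq_prod, integral_prod _ hint, adjoint]
  congr 1
  ext t
  rw [symbol, Set.indicator_of_mem hξ, Real.fourierInv_eq', ← integral_const_mul]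
  congr 1
  ext x
  rw [modulate, smul_eq_mul]
  simp only [← mul_assoc, ← Complex.exp_add]
  congr 2
  have hπ : (π : ℂ) ≠ 0 := by exact_mod_cast Real.pi_ne_zero
  rw [shift]
  push_cast
  field_simp
  ring

/-- The superposition principle behind the transference from free waves to Bourgain spaces, in dual
form. -/
theorem enorm_integral_mul_fourierInv_le {d : ℕ} {L σ : ℝ} {g : ℝ × Space d → ℂ}
    (hg : Measurable g) (hsupp : ∀ z : ℝ × Space d, z.2 ∉ annulus d L → g z = 0) {A : ℝ≥0∞}
    {F : ℝ → Space d → ℂ} (hF : IsTest F)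
    (hA : ∀ τ, eLpNorm (adjoint L σ (modulate τ F)) 2 volume ≤ A) :
    ‖∫ z : ℝ × Space d, g z *
        𝓕⁻ (fun ζ : SpaceTime d => F ζ.fst ζ.snd) (WithLp.toLp 2 z)‖ₑ ≤
      (∫⁻ τ, eLpNorm (fun ξ => g (τ - shift d σ ξ, ξ)) 2 volume) * A := by
  have hFst : Integrable fun ζ : SpaceTime d => F ζ.fst ζ.snd := by
    have := ((measurePreserving_toLp d).integrable_comp_emb
      (MeasurableEquiv.toLp 2 (ℝ × Space d)).measurableEmbedding
      (g := fun ζ : SpaceTime d => F ζ.fst ζ.snd)).1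
    exact this hF.integrable
  have hΦ : Measurable fun z : ℝ × Space d =>
      𝓕⁻ (fun ζ : SpaceTime d => F ζ.fst ζ.snd) (WithLp.toLp 2 z) :=
    (continuous_fourierInv hFst).measurable.comp (MeasurableEquiv.toLp 2 (ℝ × Space d)).measurable
  exact (enorm_integral_le_lintegral_enorm _).trans (lintegral_enorm_mul_le_of_sheared hg hΦ hsupp
    (fun τ => (hF.modulate τ).measurable_adjoint L σ)
    (fun τ ξ hξ => fourierInv_spaceTime_eq_adjoint L σ τ hξ hF) hA)

/-! ### The weight of the Bourgain norm -/

theorem one_le_japanese {V : Type*} [NormedAddCommGroup V] (x : V) : 1 ≤ japanese x := by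
  rw [japanese, Real.one_le_sqrt]
  nlinarith [norm_nonneg x]

theorem measurable_japanese : Measurable fun x : ℝ => japanese x := by
  unfold japanese
  fun_prop

/-- `⟨2πτ⟩^{-b}` is square integrable for `b > 1/2`. -/
theorem lintegral_japanese_lt_top {b : ℝ} (hb : 1 / 2 < b) :
    ∫⁻ τ : ℝ, ENNReal.ofReal (japanese (2 * π * τ) ^ (-b)) ^ (2 : ℝ) < ⊤ := by
  have h1 : Integrable fun x : ℝ => (1 + ‖x‖ ^ 2) ^ (-(2 * b) / 2) :=
    integrable_rpow_neg_one_add_norm_sq (by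
      rw [Module.finrank_self, Nat.cast_one]
      linarith)
  have h2 := h1.comp_mul_left' (R := 2 * π) (by positivity)
  refine lt_of_eq_of_lt ?_ h2.lintegral_lt_top
  congr 1
  ext τ
  have hpos : 0 < 1 + ‖2 * π * τ‖ ^ 2 := by positivity
  rw [ENNReal.ofReal_rpow_of_nonneg (by unfold japanese; positivity) zero_le_two, japanese,
    Real.sqrt_eq_rpow, ← Real.rpow_mul hpos.le, ← Real.rpow_mul hpos.le]
  congr 2
  ring

/-- The square of the `L²` norm with weight `⟨τ + σ m(ξ)⟩^b`, for a function of two variables in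
Mathlib's normalization of frequencies. -/
def weightedSq (d : ℕ) (b σ : ℝ) (g : ℝ × Space d → ℂ) : ℝ≥0∞ :=
  ∫⁻ τ, ∫⁻ ξ, (ENNReal.ofReal (japanese (2 * π * τ + σ * dispersion d ((2 * π) • ξ)) ^ b) *
    ‖g (τ, ξ)‖ₑ) ^ (2 : ℝ)

theorem lintegral_eLpNorm_shift_le {d : ℕ} {b σ : ℝ} {g : ℝ × Space d → ℂ} (hg : Measurable g) :
    ∫⁻ τ, eLpNorm (fun ξ => g (τ - shift d σ ξ, ξ)) 2 volume ≤
      (∫⁻ τ : ℝ, ENNReal.ofReal (japanese (2 * π * τ) ^ (-b)) ^ (2 : ℝ)) ^ (1 / 2 : ℝ) *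
        weightedSq d b σ g ^ (1 / 2 : ℝ) := by
  have hdisp : Measurable fun ξ : Space d => dispersion d ((2 * π) • ξ) :=
    (measurable_dispersion d).comp (measurable_const_smul (α := Space d) (2 * π))
  have hj : Measurable fun τ : ℝ => japanese (2 * π * τ) :=
    measurable_japanese.comp (measurable_id.const_mul (2 * π))
  have hpos : ∀ τ : ℝ, 0 < japanese (2 * π * τ) := fun τ => zero_lt_one.trans_le (one_le_japanese _)
  have h1 : ∀ τ, eLpNorm (fun ξ => g (τ - shift d σ ξ, ξ)) 2 volume =
      ENNReal.ofReal (japanese (2 * π * τ) ^ (-b)) * (ENNReal.ofReal (japanese (2 * π * τ) ^ b) *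
        eLpNorm (fun ξ => g (τ - shift d σ ξ, ξ)) 2 volume) := by
    intro τ
    rw [← mul_assoc, ← ENNReal.ofReal_mul (Real.rpow_nonneg (hpos τ).le _),
      ← Real.rpow_add (hpos τ), neg_add_cancel, Real.rpow_zero, ENNReal.ofReal_one, one_mul]
  rw [lintegral_congr h1]
  refine (ENNReal.lintegral_mul_le_Lp_mul_Lq volume Real.HolderConjugate.two_two
    (hj.pow_const (-b)).ennreal_ofReal.aemeasurable
    ((hj.pow_const b).ennreal_ofReal.mul
      (measurable_eLpNorm_sheared σ hg)).aemeasurable).trans_eq ?_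
  congr 2
  have hwm : Measurable fun z : ℝ × Space d =>
      (ENNReal.ofReal (japanese (2 * π * z.1 + σ * dispersion d ((2 * π) • z.2)) ^ b) *
        ‖g z‖ₑ) ^ (2 : ℝ) := by
    have : Measurable fun z : ℝ × Space d =>
        2 * π * z.1 + σ * dispersion d ((2 * π) • z.2) :=
      (measurable_fst.const_mul _).add ((hdisp.comp measurable_snd).const_mul _)
    exact (((measurable_japanese.comp this).pow_const b).ennreal_ofReal.mul hg.enorm).pow_const _
  have h2 := lintegral_shift σ hwm
  rw [weightedSq]
  refine Eq.trans ?_ h2.symm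
  congr 1
  ext τ
  have h3 : ∀ ξ : Space d, 2 * π * (τ - shift d σ ξ) + σ * dispersion d ((2 * π) • ξ) =
      2 * π * τ := by
    intro ξ
    rw [shift]
    field_simp
    ring
  simp only [h3]
  simp_rw [ENNReal.mul_rpow_of_nonneg _ _ zero_le_two]
  rw [lintegral_const_mul _ ((measurable_sheared_slice σ hg τ).enorm.pow_const _)]
  rw [lintegral_enorm_sq_eq_eLpNorm, ← ENNReal.mul_rpow_of_nonneg _ _ zero_le_two]
  rfl

theorem integrable_of_weightedSq_lt_top {d : ℕ} {L b σ : ℝ} (hb : 1 / 2 < b)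
    {g : ℝ × Space d → ℂ} (hg : Measurable g)
    (hsupp : ∀ z : ℝ × Space d, z.2 ∉ annulus d L → g z = 0) (hw : weightedSq d b σ g < ⊤) :
    Integrable g (volume.prod volume) := by
  refine ⟨hg.aestronglyMeasurable, ?_⟩
  rw [hasFiniteIntegral_iff_enorm, lintegral_prod _ hg.enorm.aemeasurable,
    lintegral_shift σ (f := fun z => ‖g z‖ₑ) hg.enorm]
  have hA := volume_annulus_lt_top d L
  calc ∫⁻ τ, ∫⁻ ξ, ‖g (τ - shift d σ ξ, ξ)‖ₑ
      ≤ ∫⁻ τ, eLpNorm (fun ξ => g (τ - shift d σ ξ, ξ)) 2 volume *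
        eLpNorm ((annulus d L).indicator fun _ => (1 : ℂ)) 2 volume := by
        refine lintegral_mono fun τ => ?_
        refine le_trans (le_of_eq ?_) (lintegral_enorm_mul_le_eLpNorm_mul
          (measurable_sheared_slice σ hg τ).aestronglyMeasurable
          (measurable_const.indicator (isClosed_annulus d L).measurableSet).aestronglyMeasurable)
        refine lintegral_congr fun ξ => ?_
        by_cases hξ : ξ ∈ annulus d L
        · rw [Set.indicator_of_mem hξ]
          simp
        · rw [Set.indicator_of_notMem hξ]
          have : g (τ - shift d σ ξ, ξ) = 0 := hsupp (τ - shift d σ ξ, ξ) hξ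
          simp [this]
    _ = (∫⁻ τ, eLpNorm (fun ξ => g (τ - shift d σ ξ, ξ)) 2 volume) *
        eLpNorm ((annulus d L).indicator fun _ => (1 : ℂ)) 2 volume :=
        lintegral_mul_const' _ _ (memLp_indicator_const 2 (isClosed_annulus d L).measurableSet _
          (Or.inr hA.ne)).eLpNorm_lt_top.ne
    _ < ⊤ := by
        refine ENNReal.mul_lt_top ((lintegral_eLpNorm_shift_le (b := b) hg).trans_lt ?_)
          (memLp_indicator_const 2 (isClosed_annulus d L).measurableSet _
            (Or.inr hA.ne)).eLpNorm_lt_top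
        exact ENNReal.mul_lt_top
          (ENNReal.rpow_lt_top_of_nonneg (by norm_num) (lintegral_japanese_lt_top hb).ne)
          (ENNReal.rpow_lt_top_of_nonneg (by norm_num) hw.ne)

/-! ### Distributions with finite Bourgain norm -/

section Represented

variable {V : Type*} [NormedAddCommGroup V] [InnerProductSpace ℝ V] [FiniteDimensional ℝ V]
  [MeasurableSpace V] [BorelSpace V]

theorem IsRepresentedBy.congr_ae {T : 𝓢'(V, ℂ)} {g g' : V → ℂ} (h : IsRepresentedBy T g)
    (hg : g =ᵐ[volume] g') : IsRepresentedBy T g' := by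
  refine ⟨h.1.congr hg, fun φ => ?_⟩
  have hφ : (fun x => φ x * g x) =ᵐ[volume] fun x => φ x * g' x := by
    filter_upwards [hg] with x hx
    rw [hx]
  exact ⟨(h.2 φ).1.congr hφ, (h.2 φ).2.trans (integral_congr_ae hφ)⟩

/-- A distribution with integrable Fourier transform is a bounded continuous function. -/
theorem IsRepresentedBy.fourierInv {T : 𝓢'(V, ℂ)} {g : V → ℂ} (h : IsRepresentedBy (𝓕 T) g)
    (hg : Integrable g) : IsRepresentedBy T (𝓕⁻ g) := by
  refine ⟨(continuous_fourierInv hg).aestronglyMeasurable, fun φ => ⟨?_, ?_⟩⟩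
  · exact φ.integrable.mul_bdd (continuous_fourierInv hg).aestronglyMeasurable
      (Filter.Eventually.of_forall fun x => norm_fourierInv_le g x)
  · have h1 := (h.2 (𝓕⁻ φ)).2
    rw [TemperedDistribution.fourier_apply, FourierTransform.fourier_fourierInv_eq] at h1
    rw [h1, SchwartzMap.fourierInv_coe, integral_fourierInv_mul_eq φ.integrable hg]

end Represented

theorem lintegral_le_lintegral_comp_smul {d : ℕ} (ψ : SpaceTime d → ℝ≥0∞) :
    ∫⁻ η, ψ η ≤ ∫⁻ ζ : SpaceTime d, ψ ((2 * π)⁻¹ • ζ) := by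
  have hc : (2 * π)⁻¹ ≠ 0 := by positivity
  have h1 : ∫⁻ ζ : SpaceTime d, ψ ((2 * π)⁻¹ • ζ) =
      ∫⁻ η, ψ η ∂(Measure.map (fun ζ : SpaceTime d => (2 * π)⁻¹ • ζ) volume) :=
    (lintegral_map_equiv ψ (Homeomorph.smulOfNeZero (α := SpaceTime d) _ hc).toMeasurableEquiv).symm
  rw [h1, Measure.map_addHaar_smul volume hc, lintegral_smul_measure, smul_eq_mul]
  refine le_mul_of_one_le_left zero_le ?_
  rw [ENNReal.one_le_ofReal, inv_pow, inv_inv, abs_of_nonneg (by positivity)]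
  refine one_le_pow₀ ?_
  linarith [Real.pi_gt_three]

/-- Passing from `ζ` to `η = ζ / 2π` in the square of the Bourgain norm costs a power of `2π`, which
is at least `1`. -/
theorem lintegral_weight_mul_sq_le {d : ℕ} (b σ : ℝ) (g : SpaceTime d → ℂ) :
    ∫⁻ η : SpaceTime d, (ENNReal.ofReal (japanese (2 * π * η.fst +
        σ * dispersion d ((2 * π) • η.snd)) ^ b) * ‖g η‖ₑ) ^ (2 : ℝ) ≤
      eLpNorm (fun ζ : SpaceTime d =>
        ((japanese ζ.snd ^ (0 : ℝ) * japanese (ζ.fst + σ * dispersion d ζ.snd) ^ b : ℝ) : ℂ) *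
          g ((2 * π)⁻¹ • ζ)) 2 volume ^ (2 : ℝ) := by
  refine (lintegral_le_lintegral_comp_smul _).trans_eq ?_
  rw [eLpNorm_eq_lintegral_rpow_enorm_toReal two_ne_zero ENNReal.ofNat_ne_top, ← ENNReal.rpow_mul,
    ENNReal.toReal_ofNat, one_div_mul_cancel two_ne_zero, ENNReal.rpow_one]
  refine lintegral_congr fun ζ => ?_
  have h2π : 2 * π ≠ 0 := by positivity
  have h1 : 2 * π * ((2 * π)⁻¹ • ζ).fst = ζ.fst := by
    rw [WithLp.smul_fst, smul_eq_mul, mul_inv_cancel_left₀ h2π]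
  have h2 : (2 * π) • ((2 * π)⁻¹ • ζ).snd = ζ.snd := by
    rw [WithLp.smul_snd, smul_inv_smul₀ h2π]
  rw [h1, h2, enorm_mul, Real.rpow_zero, one_mul]
  congr 2
  rw [← ofReal_norm, Complex.norm_real, Real.norm_of_nonneg
    (Real.rpow_nonneg (zero_le_one.trans (one_le_japanese _)) _)]

theorem annulus_preimage_closed (d : ℕ) (L : ℝ) :
    IsClosed {ζ : SpaceTime d | ζ.snd ∈ annulus d L} :=
  (isClosed_annulus d L).preimage (by fun_prop)

/-- A Littlewood-Paley piece with a Fourier transform of finite weighted norm has a measurable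
Fourier transform that vanishes identically off the shell. -/
theorem exists_measurable_representative {d : ℕ} {χ : ℝ → ℝ} (hχ : IsCutoff χ) {L b σ : ℝ}
    (hL : 2 ≤ L) (hb : 0 ≤ b) (u : 𝓢'(SpaceTime d, ℂ)) {g : SpaceTime d → ℂ}
    (hg : IsRepresentedBy (𝓕 (lpProjST d χ L u)) g)
    (hfin : eLpNorm (fun ζ : SpaceTime d =>
      ((japanese ζ.snd ^ (0 : ℝ) * japanese (ζ.fst + σ * dispersion d ζ.snd) ^ b : ℝ) : ℂ) *
        g ((2 * π)⁻¹ • ζ)) 2 volume < ⊤) :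
    ∃ k : SpaceTime d → ℂ, Measurable k ∧ (∀ ζ, ζ.snd ∉ annulus d L → k ζ = 0) ∧
      g =ᵐ[volume] k := by
  have hle := lintegral_weight_mul_sq_le b σ g
  have hmem : MemLp g 2 volume := by
    refine ⟨hg.1, ?_⟩
    have h1 : eLpNorm g 2 volume ^ (2 : ℝ) < ⊤ := by
      rw [← lintegral_enorm_sq_eq_eLpNorm]
      refine (lintegral_mono fun η => ?_).trans_lt
        (hle.trans_lt (ENNReal.rpow_lt_top_of_nonneg zero_le_two hfin.ne))
      refine ENNReal.rpow_le_rpow (le_mul_of_one_le_left zero_le ?_) zero_le_two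
      rw [ENNReal.one_le_ofReal]
      exact Real.one_le_rpow (one_le_japanese _) hb
    by_contra htop
    rw [not_lt, top_le_iff] at htop
    rw [htop, ENNReal.top_rpow_of_pos two_pos] at h1
    exact lt_irrefl _ h1
  have hsupp : ∀ᵐ ζ, ζ ∉ {ζ : SpaceTime d | ζ.snd ∈ annulus d L} → g ζ = 0 :=
    ae_eq_zero_of_fourierMultiplier (annulus_preimage_closed d L)
      (s := fun p : SpaceTime d => (lpProfile χ L ‖(2 * π) • p.snd‖ : ℂ))
      (fun ζ hζ => lpProfile_norm_eq_zero hχ hL hζ) u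
      (hmem.locallyIntegrable (by norm_num)) fun φ => (hg.2 φ).2
  refine ⟨{ζ : SpaceTime d | ζ.snd ∈ annulus d L}.indicator (hg.1.mk g),
    hg.1.stronglyMeasurable_mk.measurable.indicator (annulus_preimage_closed d L).measurableSet,
    fun ζ hζ => Set.indicator_of_notMem (s := {ζ : SpaceTime d | ζ.snd ∈ annulus d L}) hζ _, ?_⟩
  filter_upwards [hsupp, hg.1.ae_eq_mk] with ζ h1 h2
  by_cases hζ : ζ ∈ {ζ : SpaceTime d | ζ.snd ∈ annulus d L}
  · rw [Set.indicator_of_mem hζ, h2]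
  · rw [Set.indicator_of_notMem hζ, h1 hζ]

/-- The Strichartz estimate for a function whose space-time Fourier transform `k` lives over the
shell. -/
theorem exists_mixedNorm_fourierInv_le {d : ℕ} (hd : d = 1 ∨ d = 2)
    {q r : ℝ≥0∞} (hq : 2 < q) (hq_top : q < ⊤) (hr : 2 ≤ r)
    (hqr : 2 / q.toReal = (d / 2 : ℝ) * (1 - 2 * (r⁻¹).toReal)) {b : ℝ} (hb : 1 / 2 < b) :
    ∃ C : ℝ, 0 < C ∧ ∀ L : ℝ, 2 ≤ L → ∀ σ ∈ ({1, -1} : Set ℝ), ∀ k : SpaceTime d → ℂ,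
      Measurable k → (∀ ζ, ζ.snd ∉ annulus d L → k ζ = 0) →
      weightedSq d b σ (fun z => k (WithLp.toLp 2 z)) < ⊤ → Integrable k ∧
      mixedNorm d q r (fun t x => 𝓕⁻ k (WithLp.toLp 2 (t, x))) ≤
        ENNReal.ofReal (C * L ^ ((3 * d / 8 : ℝ) * (1 - 2 * (r⁻¹).toReal))) *
          weightedSq d b σ (fun z => k (WithLp.toLp 2 z)) ^ (1 / 2 : ℝ) := by
  obtain ⟨C, hC, hadj⟩ := exists_eLpNorm_adjoint_le hd hq hq_top hr hqr
  set K := (∫⁻ τ : ℝ, ENNReal.ofReal (japanese (2 * π * τ) ^ (-b)) ^ (2 : ℝ)) ^ (1 / 2 : ℝ) with hK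
  have hKtop : K ≠ ⊤ :=
    ENNReal.rpow_ne_top_of_nonneg (by norm_num) (lintegral_japanese_lt_top hb).ne
  have hKle : K ≤ ENNReal.ofReal (K.toReal + 1) := by
    rw [← ENNReal.ofReal_toReal hKtop]
    refine ENNReal.ofReal_le_ofReal ?_
    rw [ENNReal.toReal_ofReal ENNReal.toReal_nonneg]
    linarith
  have hK0 : 0 ≤ K.toReal := ENNReal.toReal_nonneg
  refine ⟨C * (K.toReal + 1), by positivity, fun L hL σ hσ k hk hsupp hw => ?_⟩
  have hL0 : 0 < L := by linarith
  set g : ℝ × Space d → ℂ := fun z => k (WithLp.toLp 2 z) with hg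
  have hgm : Measurable g := hk.comp (MeasurableEquiv.toLp 2 (ℝ × Space d)).measurable
  have hgs : ∀ z : ℝ × Space d, z.2 ∉ annulus d L → g z = 0 := fun z hz => hsupp _ hz
  have hemb := (MeasurableEquiv.toLp 2 (ℝ × Space d)).measurableEmbedding
  have hkint : Integrable k :=
    ((measurePreserving_toLp d).integrable_comp_emb hemb).1
      (integrable_of_weightedSq_lt_top hb hgm hgs hw)
  refine ⟨hkint, ?_⟩
  have hcont : Continuous (Function.uncurry fun (t : ℝ) (x : Space d) =>
      𝓕⁻ k (WithLp.toLp 2 (t, x))) :=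
    (continuous_fourierInv hkint).comp (WithLp.prod_continuous_toLp 2 ℝ (Space d))
  refine mixedNorm_le_of_enorm_integral_le hq hq_top hr hqr hcont
    ⟨_, fun t x => norm_fourierInv_le k _⟩ fun F hF => ?_
  have hFst : Integrable fun ζ : SpaceTime d => F ζ.fst ζ.snd :=
    ((measurePreserving_toLp d).integrable_comp_emb hemb).1 hF.integrable
  have hpair : ∫ z : ℝ × Space d, 𝓕⁻ k (WithLp.toLp 2 (z.1, z.2)) * F z.1 z.2 =
      ∫ z : ℝ × Space d, g z *
        𝓕⁻ (fun ζ : SpaceTime d => F ζ.fst ζ.snd) (WithLp.toLp 2 z) := by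
    have h := integral_fourierInv_mul_eq hkint hFst
    rw [integral_spaceTime, integral_spaceTime] at h
    exact h
  rw [hpair]
  set N := mixedLintegral (dualExponent r) (q.toReal.conjExponent) fun t x => ‖F t x‖ₑ with hN
  have hA : ∀ τ, eLpNorm (adjoint L σ (modulate τ F)) 2 volume ≤
      ENNReal.ofReal (C * L ^ ((3 * d / 8 : ℝ) * (1 - 2 * (r⁻¹).toReal))) * N := by
    intro τ
    refine (hadj L hL σ hσ _ (hF.modulate τ)).trans_eq ?_
    have : ∀ t x, ‖modulate τ F t x‖ₑ = ‖F t x‖ₑ := fun t x => by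
      rw [← ofReal_norm, norm_modulate, ofReal_norm]
    simp_rw [this]
    rfl
  calc _ ≤ (∫⁻ τ, eLpNorm (fun ξ => g (τ - shift d σ ξ, ξ)) 2 volume) *
        (ENNReal.ofReal (C * L ^ ((3 * d / 8 : ℝ) * (1 - 2 * (r⁻¹).toReal))) * N) :=
        enorm_integral_mul_fourierInv_le hgm hgs hF hA
    _ ≤ (ENNReal.ofReal (K.toReal + 1) * weightedSq d b σ g ^ (1 / 2 : ℝ)) *
        (ENNReal.ofReal (C * L ^ ((3 * d / 8 : ℝ) * (1 - 2 * (r⁻¹).toReal))) * N) := by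
        gcongr
        refine (lintegral_eLpNorm_shift_le (b := b) hgm).trans ?_
        gcongr
    _ = _ := by
        rw [mul_assoc C, mul_comm (K.toReal + 1), ← mul_assoc C,
          ENNReal.ofReal_mul (p := C * _) (by positivity)]
        ring

/-- The transference of the Strichartz estimate to Bourgain spaces. -/
theorem exists_mixedNormDist_le {d : ℕ} (hd : d = 1 ∨ d = 2) {χ : ℝ → ℝ} (hχ : IsCutoff χ)
    {q r : ℝ≥0∞} (hq : 2 < q) (hq_top : q < ⊤) (hr : 2 ≤ r)
    (hqr : 2 / q.toReal = (d / 2 : ℝ) * (1 - 2 * (r⁻¹).toReal)) {b : ℝ} (hb : 1 / 2 < b) :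
    ∃ C : ℝ, 0 < C ∧ ∀ L : ℝ, IsDyadic L → 1 < L →
      ∀ σ ∈ ({1, -1} : Set ℝ), ∀ u : 𝓢'(SpaceTime d, ℂ),
        mixedNormDist d q r (lpProjST d χ L u) ≤
          ENNReal.ofReal (C * L ^ ((3 * d / 8 : ℝ) * (1 - 2 * (r⁻¹).toReal))) *
            bourgainNorm d 0 b σ (lpProjST d χ L u) := by
  obtain ⟨C, hC, hest⟩ := exists_mixedNorm_fourierInv_le hd hq hq_top hr hqr hb
  refine ⟨C, hC, fun L hLd hL1 σ hσ u => ?_⟩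
  have hL := hLd.two_le hL1
  have hL0 : 0 < L := by linarith
  set c := ENNReal.ofReal (C * L ^ ((3 * d / 8 : ℝ) * (1 - 2 * (r⁻¹).toReal))) with hc
  have hc0 : c ≠ 0 := (ENNReal.ofReal_pos.2 (by positivity)).ne'
  have hct : c ≠ ⊤ := ENNReal.ofReal_ne_top
  rw [mul_comm, ← ENNReal.div_le_iff hc0 hct, bourgainNorm]
  refine le_iInf₂ fun g hg => ?_
  rw [ENNReal.div_le_iff hc0 hct, mul_comm]
  set N := eLpNorm (fun ζ : SpaceTime d =>
    ((japanese ζ.snd ^ (0 : ℝ) * japanese (ζ.fst + σ * dispersion d ζ.snd) ^ b : ℝ) : ℂ) *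
      g ((2 * π)⁻¹ • ζ)) 2 volume with hN
  rcases eq_or_ne N ⊤ with htop | htop
  · rw [htop, ENNReal.mul_top hc0]
    exact le_top
  obtain ⟨k, hk, hks, hgk⟩ := exists_measurable_representative hχ hL (by linarith) u hg
    (lt_top_iff_ne_top.2 htop)
  have hwm : Measurable fun η : SpaceTime d => (ENNReal.ofReal (japanese (2 * π * η.fst +
      σ * dispersion d ((2 * π) • η.snd)) ^ b) * ‖k η‖ₑ) ^ (2 : ℝ) := by
    have h1 : Measurable fun η : SpaceTime d => η.fst :=
      Continuous.measurable (by fun_prop)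
    have h2 : Measurable fun η : SpaceTime d => η.snd :=
      Continuous.measurable (by fun_prop)
    have h3 : Measurable fun η : SpaceTime d =>
        2 * π * η.fst + σ * dispersion d ((2 * π) • η.snd) :=
      (h1.const_mul _).add
        (((measurable_dispersion d).comp (h2.const_smul (2 * π))).const_mul σ)
    exact (((measurable_japanese.comp h3).pow_const b).ennreal_ofReal.mul hk.enorm).pow_const _
  have hW : weightedSq d b σ (fun z => k (WithLp.toLp 2 z)) ≤ N ^ (2 : ℝ) := by
    refine le_trans (le_of_eq ?_) (lintegral_weight_mul_sq_le b σ g)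
    refine (lintegral_spaceTime hwm).symm.trans (lintegral_congr_ae ?_)
    filter_upwards [hgk] with η hη
    rw [hη]
  obtain ⟨hkint, hle⟩ := hest L hL σ hσ k hk hks
    (hW.trans_lt (ENNReal.rpow_lt_top_of_nonneg zero_le_two htop))
  refine (iInf₂_le (𝓕⁻ k) ((hg.congr_ae hgk).fourierInv hkint)).trans (hle.trans ?_)
  gcongr
  refine (ENNReal.rpow_le_rpow hW (by norm_num)).trans_eq ?_
  rw [← ENNReal.rpow_mul]
  norm_num

end Whitham

end

theorem mainTheorem5 (d : ℕ) (hd : d = 1 ∨ d = 2) (χ : ℝ → ℝ) (hχ : Whitham.IsCutoff χ)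
    (q r : ℝ≥0∞) (hq : 2 < q) (hq_top : q < ⊤) (hr : 2 ≤ r)
    (hqr : 2 / q.toReal = (d / 2 : ℝ) * (1 - 2 * (r⁻¹).toReal)) :
    (∃ C : ℝ, 0 < C ∧ ∀ L : ℝ, Whitham.IsDyadic L → 1 < L →
      ∀ σ ∈ ({1, -1} : Set ℝ), ∀ (f : 𝓢'(Whitham.Space d, ℂ))
          (fL : Lp (α := Whitham.Space d) ℂ 2 volume),
        (fL : 𝓢'(Whitham.Space d, ℂ)) = Whitham.lpProj d χ L f →
        Whitham.mixedNorm d q r (fun t x => Whitham.freeWave d (σ * t) fL x) ≤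
          ENNReal.ofReal (C * L ^ ((3 * d / 8 : ℝ) * (1 - 2 * (r⁻¹).toReal))) *
            eLpNorm fL 2 volume) ∧
    (∀ b : ℝ, 1 / 2 < b →
      ∃ C : ℝ, 0 < C ∧ ∀ L : ℝ, Whitham.IsDyadic L → 1 < L →
      ∀ σ ∈ ({1, -1} : Set ℝ), ∀ u : 𝓢'(Whitham.SpaceTime d, ℂ),
        Whitham.mixedNormDist d q r (Whitham.lpProjST d χ L u) ≤
          ENNReal.ofReal (C * L ^ ((3 * d / 8 : ℝ) * (1 - 2 * (r⁻¹).toReal))) *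
            Whitham.bourgainNorm d 0 b σ (Whitham.lpProjST d χ L u)) := by
  exact ⟨Whitham.exists_mixedNorm_freeWave_le hd hχ hq hq_top hr hqr,
    fun _ hb => Whitham.exists_mixedNormDist_le hd hχ hq hq_top hr hqr hb⟩
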